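/- **Theorem (Orthogonal decomposition of the range).** Let $\mathbb{D}=\{z\in\mathbb{C}: |z|\le 1\}$, $d(z)=1-|z|^2$, and fix $\gamma\in(-1,1)$. All functions and tensors are complex-valued. Let $L^2_\gamma(\mathbb{D})=L^2(\mathbb{D},d^\gamma|dz|^2)$. Let $\partial_+S\mathbb{D}=(\mathbb{R}/2\pi\mathbb{Z})_\beta\times[-\frac{\pi}{2},\frac{\pi}{2}]_\alpha$ and $L^2_\gamma(\partial_+S\mathbb{D})=L^2(\partial_+S\mathbb{D},\mu^{-2\gamma}\,d\beta\,d\alpha)$ with $\mu=\cos\alpha$. Let $L^2_\gamma(\mathbb{D};S^m(T^*\mathbb{D}))$ be the symmetric covariant $m$-tensor fields with all components in $L^2_\gamma(\mathbb{D})$, and for $m\ge 1$ let $$L^2_\gamma(\mathbb{D};S^m_{tt}(T^*\mathbb{D}))=\{f_+\,dz^m+f_-\,d\bar z^m:\ f_\pm\in L^2_\gamma(\mathbb{D}),\ \bar\partial f_+=0,\ \partial f_-=0 \text{ in the open disk}\}.$$ For an $m$-tensor field $f$ (a function if $m=0$) define $$I_md^\gamma f(\beta,\alpha)=\int_0^{2\cos\alpha}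 f_{z(t)}(v,\dots,v)\,d(z(t))^\gamma\,dt,\qquad z(t)=e^{i\beta}+tv,\quad v=e^{i(\beta+\alpha+\pi)},$$ and $I_1=I_1d^0$. Let $H^{1,-\gamma}_0(\mathbb{D})$ be the completion of $C_c^\infty$ of the open disk for the norm $(\|u\|^2_{L^2_{-\gamma}}+\|\nabla u\|^2_{L^2_{-\gamma}})^{1/2}$, and $\star$ the Hodge star on one-forms, $\star dx=dy$, $\star dy=-dx$. For $n\ge 0$, $k\in\mathbb{Z}$ let $$\psi^{\gamma,-}_{n,k}(\beta,\alpha)=e^{i(\beta+\alpha+\pi)}\,\mu^{2\gamma+1}e^{(n-2k)i(\beta+\alpha+\pi)}\,\frac{\hat L_n^\gamma(\sin\alpha)}{2\pi},$$ where $\hat L_n^\gamma$ is the orthogonal polynomial of degree $n$ on $[-1,1]$ for the weight $(1-x^2)^{\gamma+1/2}$, with positive leading coefficient and norm $\sqrt{2\pi}$. For every $m\ge0$ and $f\in L^2_\gamma(\mathbb{D};S^m(T^*\mathbb{D}))$, and for $I_1(\star dh)$ with $h\in H_0^{1,-\gamma}(\mathbb{D})$, the defining integral converges absolutely for almost every $(\beta,\alpha)$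 and gives an element of $L^2_\gamma(\partial_+S\mathbb{D})$. Moreover: 1. If $m=2p$ with $p\ge 1$, then $$I_md^\gamma\big(L^2_\gamma(\mathbb{D};S^m(T^*\mathbb{D}))\big)=I_0d^\gamma(L^2_\gamma(\mathbb{D}))\ \oplus\ \bigoplus_{j=1}^{p}I_{2j}d^\gamma\big(L^2_\gamma(\mathbb{D};S^{2j}_{tt}(T^*\mathbb{D}))\big).$$ 2. If $m=2p+1$ with $p\ge 0$, then $$I_md^\gamma\big(L^2_\gamma(\mathbb{D};S^m(T^*\mathbb{D}))\big)=I_1\big(\star d(H^{1,-\gamma}_0(\mathbb{D}))\big)\ \oplus\ \bigoplus_{j=0}^{p}I_{2j+1}d^\gamma\big(L^2_\gamma(\mathbb{D};S^{2j+1}_{tt}(T^*\mathbb{D}))\big).$$ 3. The closure of $I_1(\star d(H^{1,-\gamma}_0(\mathbb{D})))$ in $L^2_\gamma(\partial_+S\mathbb{D})$ is the closed linear span of $\{\psi^{\gamma,-}_{n,k}: n\ge 1,\ 1\le k\le n\}$. In 1 and 2 the sums are algebraic sums of (not necessarily closed) linear subspaces that are pairwise orthogonal in $L^2_\gamma(\partial_+S\mathbb{D})$.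 -/

import Mathlib

open MeasureTheory Filter Topology
open scoped ContDiff

noncomputable section

namespace DiskXRay

/-! ### Weighted `L²` spaces on the disk and on the space of oriented geodesics -/

/-- The measure `d^γ |dz|²` on the closed unit disk, `d(z) = 1 - |z|²`. All function spaces on the
disk below are taken with respect to it; values of functions off the disk are irrelevant. -/
def diskMeasure (γ : ℝ) : Measure ℂ :=
  (volume.restrict (Metric.closedBall (0 : ℂ) 1)).withDensity
    fun z => ENNReal.ofReal ((1 - ‖z‖ ^ 2) ^ γ)

/-- The measure `μ^{-2γ} dβ dα`, `μ = cos α`, on the inward boundary of the unit tangent bundle in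
fan-beam coordinates `(β, α)`; `β ∈ ℝ/2πℤ` is represented by its fundamental domain `(0, 2π]`. -/
def dataMeasure (γ : ℝ) : Measure (ℝ × ℝ) :=
  (volume.restrict (Set.Ioc 0 (2 * Real.pi) ×ˢ Set.Icc (-(Real.pi / 2)) (Real.pi / 2))).withDensity
    fun p => ENNReal.ofReal (Real.cos p.2 ^ (-(2 * γ)))

/-- The data space `L²_γ` of complex functions on the inward boundary. -/
abbrev DataSpace (γ : ℝ) : Type := Lp ℂ 2 (dataMeasure γ)

/-! ### Covariant tensors on `ℝ² = ℂ` with complex values -/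

/-- Covariant `m`-tensors at a point. -/
abbrev Tensor (m : ℕ) : Type := MultilinearMap ℝ (fun _ : Fin m => ℂ) ℂ

/-- `f` is a field of symmetric covariant `m`-tensors on the disk, all of whose components (in the
frame `∂_x = 1`, `∂_y = i`) belong to `L²_γ` of the disk. -/
structure IsL2SymTensorField (γ : ℝ) (m : ℕ) (f : ℂ → Tensor m) : Prop where
  symm : ∀ (z : ℂ) (σ : Equiv.Perm (Fin m)) (v : Fin m → ℂ), f z (fun i => v (σ i)) = f z v
  memLp : ∀ ι : Fin m → Fin 2,
    MemLp (fun z => f z (fun i => (![1, Complex.I] : Fin 2 → ℂ) (ι i))) 2 (diskMeasure γ)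

/-- `dz^m`, that is `(v₁, …, v_m) ↦ v₁ ⋯ v_m`. -/
def dzPow (m : ℕ) : Tensor m := MultilinearMap.mkPiAlgebra ℝ (Fin m) ℂ

/-- `dz̄^m`, that is `(v₁, …, v_m) ↦ v̄₁ ⋯ v̄_m`. -/
def dzbarPow (m : ℕ) : Tensor m :=
  (MultilinearMap.mkPiAlgebra ℝ (Fin m) ℂ).compLinearMap fun _ => Complex.conjAe.toLinearMap

/-- The `L²_γ` transverse-tracefree `m`-tensor fields: `f₊ dz^m + f₋ dz̄^m` with `f₊` analytic and
`f₋` antianalytic on the open disk, both in `L²_γ` of the disk. -/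
def IsTTField (γ : ℝ) (m : ℕ) (f : ℂ → Tensor m) : Prop :=
  ∃ fp fm : ℂ → ℂ,
    MemLp fp 2 (diskMeasure γ) ∧ DifferentiableOn ℂ fp (Metric.ball 0 1) ∧
    MemLp fm 2 (diskMeasure γ) ∧
      DifferentiableOn ℂ (fun z => (starRingEnd ℂ) (fm z)) (Metric.ball 0 1) ∧
    ∀ z, f z = fp z • dzPow m + fm z • dzbarPow m

/-- The covector `dx`. -/
def dx : ℂ →ₗ[ℝ] ℂ := Complex.ofRealCLM.toLinearMap ∘ₗ Complex.reLm

/-- The covector `dy`. -/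
def dy : ℂ →ₗ[ℝ] ℂ := Complex.ofRealCLM.toLinearMap ∘ₗ Complex.imLm

/-- The Hodge star on covectors `w = w(∂_x) dx + w(∂_y) dy`, with `⋆dx = dy` and `⋆dy = -dx`. -/
def hodgeStar (w : ℂ →ₗ[ℝ] ℂ) : ℂ →ₗ[ℝ] ℂ := w 1 • dy - w Complex.I • dx

/-- A covector as a covariant tensor of order one. -/
def covectorTensor (w : ℂ →ₗ[ℝ] ℂ) : Tensor 1 := MultilinearMap.ofSubsingleton ℝ ℂ ℂ 0 w

/-- `h` belongs to `H_0^{1,γ}` of the disk, the completion of the complex smooth functions with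
compact support in the open disk for the norm `(‖u‖² + ‖∇u‖²)^{1/2}` of `L²_γ`, and `hx`, `hy` are
its partial derivatives (the limits of those of the approximating functions). -/
structure IsH01 (γ : ℝ) (h hx hy : ℂ → ℂ) : Prop where
  memLp : MemLp h 2 (diskMeasure γ)
  memLp_x : MemLp hx 2 (diskMeasure γ)
  memLp_y : MemLp hy 2 (diskMeasure γ)
  approx : ∃ φ : ℕ → ℂ → ℂ,
    (∀ n, ContDiff ℝ ∞ (φ n) ∧ HasCompactSupport (φ n) ∧ tsupport (φ n) ⊆ Metric.ball 0 1) ∧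
    Tendsto (fun n => eLpNorm (fun z => φ n z - h z) 2 (diskMeasure γ)) atTop (𝓝 0) ∧
    Tendsto (fun n => eLpNorm (fun z => fderiv ℝ (φ n) z 1 - hx z) 2 (diskMeasure γ))
      atTop (𝓝 0) ∧
    Tendsto (fun n => eLpNorm (fun z => fderiv ℝ (φ n) z Complex.I - hy z) 2 (diskMeasure γ))
      atTop (𝓝 0)

/-! ### The weighted X-ray transform -/

/-- The unit velocity `e^{i(β+π+α)}` of the geodesic with fan-beam coordinates `p = (β, α)`. -/
def direction (p : ℝ × ℝ) : ℂ := Complex.exp (((p.1 + Real.pi + p.2 : ℝ) : ℂ) * Complex.I)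

/-- The geodesic `e^{iβ} + t e^{i(β+π+α)}`, which lies in the disk for `0 ≤ t ≤ 2 cos α`. -/
def geodesic (p : ℝ × ℝ) (t : ℝ) : ℂ :=
  Complex.exp ((p.1 : ℂ) * Complex.I) + (t : ℂ) * direction p

/-- The integrand `F(γ(t), γ'(t)) d(γ(t))^γ` along a geodesic, for `F` a function of points `z` and
directions `v`. -/
def rayIntegrand (γ : ℝ) (F : ℂ → ℂ → ℂ) (p : ℝ × ℝ) (t : ℝ) : ℂ :=
  F (geodesic p t) (direction p) * (((1 - ‖geodesic p t‖ ^ 2) ^ γ : ℝ) : ℂ)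

/-- The weighted X-ray transform `I d^γ` of a function on the unit tangent bundle. -/
def xray (γ : ℝ) (F : ℂ → ℂ → ℂ) (p : ℝ × ℝ) : ℂ :=
  ∫ t in (0 : ℝ)..(2 * Real.cos p.2), rayIntegrand γ F p t

/-- The function `(z, v) ↦ f_z(v, …, v)` of an `m`-tensor field. -/
def ell {m : ℕ} (f : ℂ → Tensor m) : ℂ → ℂ → ℂ := fun z v => f z fun _ => v

/-- The range of `I_m d^γ` on the `L²_γ` symmetric `m`-tensor fields. -/
def rangeSym (γ : ℝ) (m : ℕ) : Set (DataSpace γ) :=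
  {u | ∃ f : ℂ → Tensor m, IsL2SymTensorField γ m f ∧ u =ᵐ[dataMeasure γ] xray γ (ell f)}

/-- The range of `I_m d^γ` on the `L²_γ` transverse-tracefree `m`-tensor fields. -/
def rangeTT (γ : ℝ) (m : ℕ) : Set (DataSpace γ) :=
  {u | ∃ f : ℂ → Tensor m, IsTTField γ m f ∧ u =ᵐ[dataMeasure γ] xray γ (ell f)}

/-- The range of `I_0 d^γ` on `L²_γ` of the disk. -/
def rangeFun (γ : ℝ) : Set (DataSpace γ) :=
  {u | ∃ f : ℂ → ℂ, MemLp f 2 (diskMeasure γ) ∧ u =ᵐ[dataMeasure γ] xray γ fun z _ => f z}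

/-- The one-form `⋆dh`, for `h` with partial derivatives `hx`, `hy`. -/
def starD (hx hy : ℂ → ℂ) : ℂ → Tensor 1 :=
  fun z => covectorTensor (hodgeStar (hx z • dx + hy z • dy))

/-- The space `I_1(⋆d H_0^{1,-γ})`, with `I_1 = I_1 d^0` the unweighted transform. -/
def rangeStarD (γ : ℝ) : Set (DataSpace γ) :=
  {u | ∃ h hx hy : ℂ → ℂ, IsH01 (-γ) h hx hy ∧
    u =ᵐ[dataMeasure γ] xray 0 (ell (starD hx hy))}

/-! ### Fan-beam polynomials -/

/-- The pairing `∫_{-1}^1 p q (1 - x²)^{γ+1/2} dx`. -/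
def polyPairing (γ : ℝ) (p q : Polynomial ℝ) : ℝ :=
  ∫ x in (-1 : ℝ)..1, p.eval x * q.eval x * (1 - x ^ 2) ^ (γ + 1 / 2)

/-- The monic orthogonal polynomials for the weight `(1 - x²)^{γ+1/2}`, by Gram-Schmidt. -/
def monicOrthoPoly (γ : ℝ) (n : ℕ) : Polynomial ℝ :=
  Polynomial.X ^ n - ∑ k : Fin n,
    Polynomial.C (polyPairing γ (Polynomial.X ^ n) (monicOrthoPoly γ k) /
      polyPairing γ (monicOrthoPoly γ k) (monicOrthoPoly γ k)) * monicOrthoPoly γ k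
termination_by n
decreasing_by all_goals exact k.isLt

/-- The orthogonal polynomial of degree `n` for the weight `(1 - x²)^{γ+1/2}` with positive leading
coefficient and norm `√(2π)`. -/
def orthoPoly (γ : ℝ) (n : ℕ) : Polynomial ℝ :=
  Polynomial.C (Real.sqrt (2 * Real.pi) /
    Real.sqrt (polyPairing γ (monicOrthoPoly γ n) (monicOrthoPoly γ n))) * monicOrthoPoly γ n

/-- `ψ_{n,k}^γ = μ^{2γ+1} e^{(n-2k)i(β+α+π)} L_n(sin α) / (2π)`. -/
def psi (γ : ℝ) (n : ℕ) (k : ℤ) (p : ℝ × ℝ) : ℂ :=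
  ((Real.cos p.2 ^ (2 * γ + 1) : ℝ) : ℂ) *
    Complex.exp ((((n : ℝ) - 2 * (k : ℝ)) * (p.1 + p.2 + Real.pi) : ℝ) * Complex.I) *
    (((orthoPoly γ n).eval (Real.sin p.2) : ℝ) : ℂ) / (2 * (Real.pi : ℂ))

/-- `ψ_{n,k}^{γ,-} = e^{i(β+α+π)} ψ_{n,k}^γ`. -/
def psiMinus (γ : ℝ) (n : ℕ) (k : ℤ) (p : ℝ × ℝ) : ℂ :=
  Complex.exp (((p.1 + p.2 + Real.pi : ℝ) : ℂ) * Complex.I) * psi γ n k p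

/-- The set of the (classes of the) functions `ψ_{n,k}^{γ,-}` with `n ≥ 1` and `1 ≤ k ≤ n`. -/
def psiMinusFamily (γ : ℝ) : Set (DataSpace γ) :=
  {u | ∃ (n : ℕ) (k : ℤ), 1 ≤ n ∧ 1 ≤ k ∧ k ≤ n ∧ u =ᵐ[dataMeasure γ] psiMinus γ n k}

/-! ### Orthogonal sums -/

/-- `A` is the orthogonal sum of `B` and of the finitely many `C j`: all of these are (not
necessarily closed) linear subspaces, `B` and the `C j` are pairwise orthogonal, and `A` is their
algebraic sum. -/
def IsOrthogonalSum {E : Type*} [NormedAddCommGroup E] [InnerProductSpace ℂ E] {q : ℕ}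
    (A B : Set E) (C : Fin q → Set E) : Prop :=
  ∃ (W₀ : Submodule ℂ E) (W : Fin q → Submodule ℂ E),
    (W₀ : Set E) = B ∧ (∀ j, (W j : Set E) = C j) ∧
    (∀ j, W₀ ⟂ W j) ∧ (∀ i j, i ≠ j → W i ⟂ W j) ∧
    A = ((W₀ ⊔ ⨆ j, W j : Submodule ℂ E) : Set E)

end DiskXRay

end

open DiskXRay

/-! ### Changes of variables on the disk and on the set of chords. -/

noncomputable section
namespace DiskXRay

/-! ### Invariant measures and Santaló's formula -/

/-! Write T for I_0 d^γ (`xrayL`), v for the direction e^{i(β+α+π)}, M for multiplication by v on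
the data (`modul`), and A, Ā for the closures in L²_γ of the polynomials in z and in z̄ (`bergman`,
`antiBergman`), that is, the square integrable analytic and antianalytic functions. On unit vectors
v̄ = v⁻¹, so an m-tensor field contracted with v is a Laurent polynomial in v with exponents m, m-2,
..., -m and arbitrary L²_γ coefficients. Hence the range of I_m d^γ is the sum of the M^{m-2j}
T(L²_γ) (`rangeSym_eq`), and its transverse-tracefree part is M^m T(A) + M^{-m} T(Ā) (`rangeTT_eq`).

Everything rests on one relation. For h in H_0^{1,-γ} put f = d^{-γ} ∂h and g = d^{-γ} ∂̄h. The
fundamental theorem of calculus along chords gives M T f + M⁻¹ T g = 0, and integration by parts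
gives f ⊥ A and g ⊥ Ā (`IsGradPair`). Conversely, every f ⊥ A and every g ⊥ Ā occurs
(`exists_isWeightedGrad`, `exists_isGradPair`). So M^j T(Aᗮ) = M^{j-2} T(Āᗮ) for all j: the part of
the top mode orthogonal to A moves two modes down. Passing from order m to m + 2 therefore adds
exactly the tt range (`symSpace_add_two`). In odd order the induction starts from M T(Aᗮ), which is
I_1(⋆d H_0^{1,-γ}) because the same relation merges the two terms of ⋆dh (`rangeStarD_eq`).

For the converse, h = d^{γ+1} P with P a polynomial makes f and g polynomials. A triangular
recursion writes every polynomial as such an f plus a polynomial in z (`exists_wirtPoly_add`), so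
these f are dense in Aᗮ. The estimates of `exists_wirt_bound`, proved by integration by parts in
polynomial form, let g and d^{-γ} h converge with f, so all of Aᗮ is reached and not only a dense
part.

Orthogonality is an angular selection rule. By Santaló's formula, the adjoint of T sends μ^{2γ+1}
v^j q(sin α) to the integral over v of v^j q(Im(z v̄)), a polynomial in z, z̄ of degree at most deg
q and angular momentum j; it vanishes if |j| > deg q. Since T z^n = μ^{2γ+1} v^n q(sin α) with deg q
≤ n, the data M^k T z^n are orthogonal to the range of T for k ≥ 1, and T z^n is orthogonal to
T(Aᗮ).

For the closure, let Z_{n,j} (`zernike`) be the back-projection of the n-th orthogonal polynomial in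
mode j. T sends it to a multiple of the data function it comes from. It is nonzero exactly when j =
n - 2k with 0 ≤ k ≤ n; it lies in A for k = 0 and in Aᗮ for k ≥ 1. A function orthogonal to all of
them is killed by T. So M T(Aᗮ) has the closed span of the ψ^-_{n,k}, 1 ≤ k ≤ n, as its closure. -/

/-- Arc length on the unit circle, as a measure on `ℂ`. -/
def arc : Measure ℂ :=
  Measure.map (fun θ : ℝ => Complex.exp (θ * Complex.I)) (volume.restrict (Set.Ioc 0 (2 * Real.pi)))

/-- The measure `(1 - x²)^c dx` on `(-1, 1)`. -/
def jacobiMeasure (c : ℝ) : Measure ℝ :=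
  (volume.restrict (Set.Ioo (-1) 1)).withDensity fun x => ENNReal.ofReal ((1 - x ^ 2) ^ c)

/-- The measure `μ^{2γ+2} dβ dα`, `μ = cos α`. -/
def fanMeasure (γ : ℝ) : Measure (ℝ × ℝ) :=
  (volume.restrict (Set.Ioc 0 (2 * Real.pi) ×ˢ Set.Icc (-(Real.pi / 2)) (Real.pi / 2))).withDensity
    fun p => ENNReal.ofReal (Real.cos p.2 ^ (2 * γ + 2))

lemma measurable_expI : Measurable (fun θ : ℝ => Complex.exp (θ * Complex.I)) := by fun_prop

instance : IsFiniteMeasure arc := by unfold arc; infer_instance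

lemma lintegral_arc {F : ℂ → ENNReal} (hF : Measurable F) :
    ∫⁻ v, F v ∂arc = ∫⁻ θ in Set.Ioc 0 (2 * Real.pi), F (Complex.exp ((θ : ℝ) * Complex.I)) := by
  rw [arc, lintegral_map hF measurable_expI]

lemma integral_arc {F : ℂ → ℂ} (hF : AEStronglyMeasurable F arc) :
    ∫ v, F v ∂arc = ∫ θ in (0 : ℝ)..(2 * Real.pi), F (Complex.exp ((θ : ℝ) * Complex.I)) := by
  rw [arc, integral_map measurable_expI.aemeasurable hF,
    intervalIntegral.integral_of_le (by positivity)]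

lemma ae_arc_norm : ∀ᵐ v ∂arc, ‖v‖ = 1 := by
  rw [arc, ae_map_iff measurable_expI.aemeasurable (measurableSet_eq_fun (by fun_prop) (by fun_prop))]
  exact Eventually.of_forall fun θ => Complex.norm_exp_ofReal_mul_I θ

lemma measurable_direction : Measurable direction := by unfold direction; fun_prop

@[fun_prop]
lemma continuous_direction : Continuous direction := by unfold direction; fun_prop

@[simp] lemma norm_direction (p : ℝ × ℝ) : ‖direction p‖ = 1 := Complex.norm_exp_ofReal_mul_I _

lemma direction_ne_zero (p : ℝ × ℝ) : direction p ≠ 0 := Complex.exp_ne_zero _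

lemma lintegral_expI_shift {F : ℂ → ENNReal} (hF : Measurable F) (a : ℝ) :
    ∫⁻ θ in Set.Ioc 0 (2 * Real.pi), F (Complex.exp ((θ + a : ℝ) * Complex.I)) = ∫⁻ v, F v ∂arc := by
  rw [lintegral_arc hF]
  have hper : Function.Periodic (fun θ : ℝ => F (Complex.exp ((θ : ℝ) * Complex.I)))
      (2 * Real.pi) := fun θ => by
    simp only []
    congr 1
    push_cast
    rw [add_mul, Complex.exp_add, Complex.exp_two_pi_mul_I, mul_one]
  have h2 := (isAddFundamentalDomain_Ioc (T := 2 * Real.pi) (by positivity) a volume).setLIntegral_eq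
    (isAddFundamentalDomain_Ioc (T := 2 * Real.pi) (by positivity) 0 volume)
    (fun θ : ℝ => F (Complex.exp ((θ : ℝ) * Complex.I))) hper.map_vadd_zmultiples
  rw [zero_add] at h2
  rw [← h2]
  have h3 := (measurePreserving_add_right (volume : Measure ℝ) a).setLIntegral_comp_preimage
    (s := Set.Ioc a (a + 2 * Real.pi)) measurableSet_Ioc
    (f := fun θ : ℝ => F (Complex.exp ((θ : ℝ) * Complex.I))) (hF.comp measurable_expI)
  rw [← h3]
  congr 2
  rw [Set.preimage_add_const_Ioc]
  congr 2 <;> ring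

/-- The substitution s = sin α turns cos^{2γ+2} α dα into (1 - s²)^{γ+1/2} ds, and for fixed α the
direction runs once around the circle as β does, so the shift by π + α disappears on integration. -/
lemma measurePreserving_fan (γ : ℝ) :
    MeasurePreserving (fun p : ℝ × ℝ => (direction p, Real.sin p.2)) (fanMeasure γ)
      (arc.prod (jacobiMeasure (γ + 1 / 2))) := by
  have hm : Measurable (fun p : ℝ × ℝ => (direction p, Real.sin p.2)) :=
    measurable_direction.prodMk (by fun_prop)
  have : SFinite (jacobiMeasure (γ + 1 / 2)) := by unfold jacobiMeasure; infer_instance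
  refine ⟨hm, Measure.ext_of_lintegral _ fun G hG => ?_⟩
  rw [lintegral_map hG hm, lintegral_prod_symm _ hG.aemeasurable]
  have hg : Measurable fun s : ℝ => ∫⁻ v, G (v, s) ∂arc :=
    Measurable.lintegral_prod_left' (f := G) hG
  set g := fun s : ℝ => ∫⁻ v, G (v, s) ∂arc with hgdef
  rw [fanMeasure, lintegral_withDensity_eq_lintegral_mul _ (by fun_prop)
      (show Measurable fun p : ℝ × ℝ => G (direction p, Real.sin p.2) from hG.comp hm),
    Measure.volume_eq_prod, ← Measure.prod_restrict, lintegral_prod_symm _ (by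
      refine Measurable.aemeasurable (Measurable.mul (by fun_prop) (hG.comp hm))),
    Measure.restrict_congr_set Ioo_ae_eq_Icc.symm]
  have h1 : ∀ α : ℝ, ∫⁻ β in Set.Ioc 0 (2 * Real.pi),
      ((fun p : ℝ × ℝ => ENNReal.ofReal (Real.cos p.2 ^ (2 * γ + 2))) *
        (fun p : ℝ × ℝ => G (direction p, Real.sin p.2))) (β, α) =
      ENNReal.ofReal (Real.cos α ^ (2 * γ + 2)) * g (Real.sin α) := fun α => by
    simp only [Pi.mul_apply]
    have hGs : Measurable fun v => G (v, Real.sin α) := hG.comp (by fun_prop)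
    rw [lintegral_const_mul _ (by
      exact hG.comp ((measurable_direction.comp (by fun_prop)).prodMk (by fun_prop))), hgdef]
    simp only []
    rw [← lintegral_expI_shift hGs (Real.pi + α)]
    congr 1
    refine lintegral_congr fun β => ?_
    rw [direction]
    simp only [add_assoc]
  simp_rw [h1]
  rw [jacobiMeasure, lintegral_withDensity_eq_lintegral_mul _ (by fun_prop) hg]
  have himg : Real.sin '' Set.Ioo (-(Real.pi / 2)) (Real.pi / 2) = Set.Ioo (-1) 1 :=
    Real.sinPartialHomeomorph.image_source_eq_target
  rw [← himg, lintegral_image_eq_lintegral_abs_deriv_mul measurableSet_Ioo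
    (fun x _ => (Real.hasDerivAt_sin x).hasDerivWithinAt)
    (Real.injOn_sin.mono Set.Ioo_subset_Icc_self)]
  refine setLIntegral_congr_fun measurableSet_Ioo fun α hα => ?_
  have hc := Real.cos_pos_of_mem_Ioo hα
  simp only [Pi.mul_apply]
  rw [← mul_assoc, ← ENNReal.ofReal_mul (abs_nonneg _), abs_of_pos hc]
  congr 2
  rw [← Real.cos_sq', ← Real.rpow_natCast, ← Real.rpow_mul hc.le]
  nth_rewrite 2 [← Real.rpow_one (Real.cos α)]
  rw [← Real.rpow_add hc]
  congr 1
  push_cast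
  ring

/-- The unit circle is Lebesgue null, and on the open ball the base of the power is positive, as the
laws of real exponents require. -/
lemma diskMeasure_eq_ball (γ : ℝ) :
    diskMeasure γ = (volume.restrict (Metric.ball (0 : ℂ) 1)).withDensity
      fun z => ENNReal.ofReal ((1 - ‖z‖ ^ 2) ^ γ) := by
  rw [diskMeasure]
  congr 1
  refine Measure.restrict_congr_set ?_
  refine (ae_eq_of_subset_of_measure_ge Metric.ball_subset_closedBall ?_
    measurableSet_ball.nullMeasurableSet ?_).symm
  · rw [Measure.addHaar_closedBall_eq_addHaar_ball]
  · exact (isCompact_closedBall _ _).measure_lt_top.ne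

/-- The affine parametrization of the disk by its horizontal chords. -/
def chord (q : ℝ × ℝ) : ℂ := Real.sqrt (1 - q.1 ^ 2) * q.2 + q.1 * Complex.I

lemma measurable_chord : Measurable chord := by unfold chord; fun_prop

instance (c : ℝ) : SFinite (jacobiMeasure c) := by unfold jacobiMeasure; infer_instance
instance (c : ℝ) : SFinite (diskMeasure c) := by unfold diskMeasure; infer_instance
instance (c : ℝ) : SFinite (fanMeasure c) := by unfold fanMeasure; infer_instance

lemma lintegral_jacobiMeasure (c : ℝ) {F : ℝ → ENNReal} (hF : Measurable F) :
    ∫⁻ x, F x ∂jacobiMeasure c =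
      ∫⁻ x in Set.Ioo (-1) 1, ENNReal.ofReal ((1 - x ^ 2) ^ c) * F x := by
  rw [jacobiMeasure, lintegral_withDensity_eq_lintegral_mul _ (by fun_prop) hF]
  rfl

lemma lintegral_scale {m : ℝ} (hm : 0 < m) (F : ℝ → ENNReal) :
    ∫⁻ y in Set.Ioo (-m) m, F y = ∫⁻ x in Set.Ioo (-1) 1, ENNReal.ofReal m * F (m * x) := by
  have himg : (fun x => m * x) '' Set.Ioo (-1) 1 = Set.Ioo (-m) m := by
    rw [Set.image_mul_left_Ioo hm]; simp
  rw [← himg, lintegral_image_eq_lintegral_abs_deriv_mul (f' := fun _ => m) measurableSet_Ioo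
    (fun x _ => by simpa using ((hasDerivAt_id x).const_mul m).hasDerivWithinAt)
    (fun x _ y _ h => mul_left_cancel₀ hm.ne' h), abs_of_pos hm]

/-- With z = √(1 - s²) x + i s one has 1 - |z|² = (1 - s²)(1 - x²); the Jacobian √(1 - s²) accounts
for the extra 1/2 in the exponent of the s-marginal. -/
lemma measurePreserving_chord (γ : ℝ) :
    MeasurePreserving chord ((jacobiMeasure (γ + 1 / 2)).prod (jacobiMeasure γ))
      (diskMeasure γ) := by
  refine ⟨measurable_chord, Measure.ext_of_lintegral _ fun F hF => ?_⟩
  rw [lintegral_map hF measurable_chord,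
    lintegral_prod _ (show Measurable fun q => F (chord q) from
      hF.comp measurable_chord).aemeasurable, lintegral_jacobiMeasure _
      (Measurable.lintegral_prod_right' (f := fun q => F (chord q)) (hF.comp measurable_chord)),
    diskMeasure_eq_ball, lintegral_withDensity_eq_lintegral_mul _ (by fun_prop) hF,
    ← lintegral_indicator measurableSet_ball, ← lintegral_indicator measurableSet_Ioo]
  set H := (Metric.ball (0 : ℂ) 1).indicator
    ((fun z : ℂ => ENNReal.ofReal ((1 - ‖z‖ ^ 2) ^ γ)) * F) with hH
  have hHm : Measurable H := Measurable.indicator (by fun_prop) measurableSet_ball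
  rw [← (Complex.volume_preserving_equiv_real_prod.symm).lintegral_comp hHm,
    Measure.volume_eq_prod, lintegral_prod_symm _
      (show Measurable fun a => H (Complex.measurableEquivRealProd.symm a) from
        hHm.comp Complex.measurableEquivRealProd.symm.measurable).aemeasurable]
  refine lintegral_congr fun s => ?_
  have hz : ∀ y : ℝ, Complex.measurableEquivRealProd.symm (y, s) = (y : ℂ) + s * Complex.I :=
    fun y => Complex.mk_eq_add_mul_I y s
  simp_rw [hz]
  have hn : ∀ y : ℝ, ‖(y : ℂ) + s * Complex.I‖ ^ 2 = y ^ 2 + s ^ 2 := fun y => by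
    rw [Complex.sq_norm, Complex.normSq_add_mul_I]
  by_cases hs : s ∈ Set.Ioo (-1 : ℝ) 1
  · rw [Set.indicator_of_mem hs]
    have hpos : 0 < 1 - s ^ 2 := by nlinarith [hs.1, hs.2]
    set m := Real.sqrt (1 - s ^ 2) with hm
    have hm0 : 0 < m := Real.sqrt_pos.2 hpos
    have hm2 : m ^ 2 = 1 - s ^ 2 := Real.sq_sqrt hpos.le
    have hind : (fun y : ℝ => H ((y : ℂ) + s * Complex.I)) = (Set.Ioo (-m) m).indicator
        fun y => ENNReal.ofReal ((1 - (y ^ 2 + s ^ 2)) ^ γ) * F ((y : ℂ) + s * Complex.I) := by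
      funext y
      have hiff : (y : ℂ) + s * Complex.I ∈ Metric.ball (0 : ℂ) 1 ↔ y ∈ Set.Ioo (-m) m := by
        rw [mem_ball_zero_iff, Set.mem_Ioo, ← abs_lt, ← sq_lt_one_iff₀ (norm_nonneg _), hn,
          ← sq_lt_sq₀ (abs_nonneg _) hm0.le, sq_abs, hm2]
        constructor <;> intro h <;> linarith
      rw [hH]
      by_cases hy : y ∈ Set.Ioo (-m) m
      · rw [Set.indicator_of_mem (hiff.2 hy), Set.indicator_of_mem hy, Pi.mul_apply, hn]
      · rw [Set.indicator_of_notMem (mt hiff.1 hy), Set.indicator_of_notMem hy]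
    rw [hind, lintegral_indicator measurableSet_Ioo, lintegral_scale hm0, lintegral_jacobiMeasure _
      (by exact hF.comp (measurable_chord.comp (by fun_prop))),
      ← lintegral_const_mul _ (by
        refine Measurable.mul (by fun_prop) ?_
        exact hF.comp (measurable_chord.comp (by fun_prop)))]
    refine setLIntegral_congr_fun measurableSet_Ioo fun x hx => ?_
    have hx1 : 0 < 1 - x ^ 2 := by nlinarith [hx.1, hx.2]
    rw [← mul_assoc, ← ENNReal.ofReal_mul (by positivity), ← mul_assoc,
      ← ENNReal.ofReal_mul hm0.le]
    congr 2
    · have : 1 - ((m * x) ^ 2 + s ^ 2) = (1 - s ^ 2) * (1 - x ^ 2) := by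
        rw [mul_pow, hm2]; ring
      rw [this, Real.mul_rpow hpos.le hx1.le, Real.rpow_add hpos, ← Real.sqrt_eq_rpow]
      ring
    · simp [chord, ← hm]
  · rw [Set.indicator_of_notMem hs]
    symm
    rw [lintegral_eq_zero_iff (show Measurable fun y : ℝ => H ((y : ℂ) + s * Complex.I) from
      hHm.comp (by fun_prop))]
    refine Eventually.of_forall fun y => ?_
    refine Set.indicator_of_notMem ?_ _
    rw [mem_ball_zero_iff, ← sq_lt_one_iff₀ (norm_nonneg _), hn]
    intro h
    exact hs (abs_lt.1 ((sq_lt_one_iff_abs_lt_one s).1 (by nlinarith [sq_nonneg y])))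

lemma measurePreserving_rotation (γ : ℝ) {v : ℂ} (hv : ‖v‖ = 1) :
    MeasurePreserving (fun z => v * z) (diskMeasure γ) (diskMeasure γ) := by
  have hm : Measurable fun z : ℂ => v * z := by fun_prop
  refine ⟨hm, Measure.ext_of_lintegral _ fun F hF => ?_⟩
  have hd : Measurable fun z : ℂ => ENNReal.ofReal ((1 - ‖z‖ ^ 2) ^ γ) := by fun_prop
  rw [lintegral_map hF hm]
  rw [diskMeasure, lintegral_withDensity_eq_lintegral_mul _ hd hF,
    lintegral_withDensity_eq_lintegral_mul _ hd (show Measurable fun z => F (v * z) from hF.comp hm)]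
  have hmp : MeasurePreserving (fun z : ℂ => v * z) volume volume :=
    (rotation ⟨v, mem_sphere_zero_iff_norm.2 hv⟩).measurePreserving
  rw [← hmp.setLIntegral_comp_preimage measurableSet_closedBall (hd.mul hF)]
  have : (fun z : ℂ => v * z) ⁻¹' Metric.closedBall 0 1 = Metric.closedBall 0 1 := by
    ext z; simp [hv]
  rw [this]
  refine lintegral_congr fun z => ?_
  simp [hv]

/-- The point with parameter `x ∈ (-1, 1)` on the chord with fan-beam coordinates `p`. -/
def chordPoint (p : ℝ × ℝ) (x : ℝ) : ℂ :=
  direction p * (Real.cos p.2 * x + Real.sin p.2 * Complex.I)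

@[fun_prop]
lemma continuous_chordPoint : Continuous fun q : (ℝ × ℝ) × ℝ => chordPoint q.1 q.2 := by
  unfold chordPoint; fun_prop

lemma measurable_chordPoint : Measurable fun q : (ℝ × ℝ) × ℝ => (chordPoint q.1 q.2, direction q.1) :=
  (by fun_prop : Continuous fun q : (ℝ × ℝ) × ℝ => (chordPoint q.1 q.2, direction q.1)).measurable

lemma ae_fanMeasure_cos_pos (γ : ℝ) : ∀ᵐ p ∂fanMeasure γ, 0 < Real.cos p.2 := by
  have h : fanMeasure γ ≪ (volume.restrict
      (Set.Ioc 0 (2 * Real.pi) ×ˢ Set.Icc (-(Real.pi / 2)) (Real.pi / 2))) :=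
    withDensity_absolutelyContinuous _ _
  refine h.ae_le ?_
  rw [Measure.volume_eq_prod, ← Measure.prod_restrict, Measure.restrict_congr_set Ioo_ae_eq_Icc.symm,
    Measure.prod_restrict, ← Measure.volume_eq_prod]
  exact (ae_restrict_iff' (measurableSet_Ioc.prod measurableSet_Ioo)).2
    (Eventually.of_forall fun p hp => Real.cos_pos_of_mem_Ioo hp.2)

/-- Santaló's formula. -/
lemma measurePreserving_santalo (γ : ℝ) :
    MeasurePreserving (fun q : (ℝ × ℝ) × ℝ => (chordPoint q.1 q.2, direction q.1))
      ((fanMeasure γ).prod (jacobiMeasure γ)) ((diskMeasure γ).prod arc) := by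
  refine ⟨measurable_chordPoint, Measure.ext_of_lintegral _ fun G hG => ?_⟩
  rw [lintegral_map hG measurable_chordPoint,
    lintegral_prod _ (show Measurable fun q : (ℝ × ℝ) × ℝ => G (chordPoint q.1 q.2, direction q.1)
      from hG.comp measurable_chordPoint).aemeasurable,
    lintegral_prod_symm _ hG.aemeasurable]
  have hM : Measurable fun q : (ℂ × ℝ) × ℝ => G (q.1.1 * chord (q.1.2, q.2), q.1.1) :=
    hG.comp (((measurable_fst.comp measurable_fst).mul
      (measurable_chord.comp (by fun_prop))).prodMk (by fun_prop))
  have hK : Measurable fun r : ℂ × ℝ => ∫⁻ x, G (r.1 * chord (r.2, x), r.1) ∂jacobiMeasure γ :=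
    Measurable.lintegral_prod_right' hM
  -- The chord of direction v at signed distance s = sin α from the centre is the horizontal chord
  -- at height s rotated by v, so the three changes of variables compose.
  calc ∫⁻ p, ∫⁻ x, G (chordPoint p x, direction p) ∂jacobiMeasure γ ∂fanMeasure γ
      = ∫⁻ p, (fun r : ℂ × ℝ => ∫⁻ x, G (r.1 * chord (r.2, x), r.1) ∂jacobiMeasure γ)
          (direction p, Real.sin p.2) ∂fanMeasure γ := by
        refine lintegral_congr_ae ?_
        filter_upwards [ae_fanMeasure_cos_pos γ] with p hp
        refine lintegral_congr fun x => ?_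
        rw [chordPoint, chord, ← Real.cos_sq', Real.sqrt_sq hp.le]
    _ = ∫⁻ v, ∫⁻ s, ∫⁻ x, G (v * chord (s, x), v) ∂jacobiMeasure γ
          ∂jacobiMeasure (γ + 1 / 2) ∂arc := by
        rw [(measurePreserving_fan γ).lintegral_comp hK, lintegral_prod _ hK.aemeasurable]
    _ = ∫⁻ v, ∫⁻ z, G (z, v) ∂diskMeasure γ ∂arc := by
        refine lintegral_congr_ae ?_
        filter_upwards [ae_arc_norm] with v hv
        have hGv : Measurable fun z => G (z, v) := hG.comp (by fun_prop)
        have hGv' : Measurable fun z => G (v * z, v) := hG.comp (by fun_prop)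
        rw [← (measurePreserving_rotation γ hv).lintegral_comp hGv,
          ← (measurePreserving_chord γ).lintegral_comp hGv', lintegral_prod _
            (show Measurable fun q => G (v * chord q, v) from
              hGv'.comp measurable_chord).aemeasurable]

end DiskXRay
end

/-! ### Weighted norms, finiteness of the measures, and the transform on normalized chords. -/

noncomputable section
namespace DiskXRay

/-! ### Weights -/

lemma eLpNorm_two_withDensity_eq {α : Type*} [MeasurableSpace α] {ν : Measure α} {ρ₁ ρ₂ : α → ℝ}
    (h₁ : Measurable ρ₁) (h₂ : Measurable ρ₂) {f g : α → ℂ}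
    (h : ∀ᵐ x ∂ν, 0 ≤ ρ₁ x ∧ 0 ≤ ρ₂ x ∧ ρ₁ x * ‖f x‖ ^ 2 = ρ₂ x * ‖g x‖ ^ 2) :
    eLpNorm f 2 (ν.withDensity fun x => ENNReal.ofReal (ρ₁ x)) =
      eLpNorm g 2 (ν.withDensity fun x => ENNReal.ofReal (ρ₂ x)) := by
  rw [eLpNorm_eq_lintegral_rpow_enorm_toReal (by simp) (by simp),
    eLpNorm_eq_lintegral_rpow_enorm_toReal (by simp) (by simp)]
  congr 1
  rw [lintegral_withDensity_eq_lintegral_mul_non_measurable _ (by fun_prop) (by simp),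
    lintegral_withDensity_eq_lintegral_mul_non_measurable _ (by fun_prop) (by simp)]
  refine lintegral_congr_ae ?_
  filter_upwards [h] with x hx
  simp only [Pi.mul_apply, ENNReal.toReal_ofNat, ENNReal.rpow_ofNat]
  rw [← ofReal_norm, ← ofReal_norm, ← ENNReal.ofReal_pow (norm_nonneg _),
    ← ENNReal.ofReal_pow (norm_nonneg _), ← ENNReal.ofReal_mul hx.1, ← ENNReal.ofReal_mul hx.2.1,
    hx.2.2]

lemma ae_volume_cos_pos : ∀ᵐ p ∂(volume.restrict
    (Set.Ioc 0 (2 * Real.pi) ×ˢ Set.Icc (-(Real.pi / 2)) (Real.pi / 2))), 0 < Real.cos p.2 := by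
  rw [Measure.volume_eq_prod, ← Measure.prod_restrict, Measure.restrict_congr_set Ioo_ae_eq_Icc.symm,
    Measure.prod_restrict, ← Measure.volume_eq_prod]
  exact (ae_restrict_iff' (measurableSet_Ioc.prod measurableSet_Ioo)).2
    (Eventually.of_forall fun p hp => Real.cos_pos_of_mem_Ioo hp.2)

lemma dataMeasure_ac (γ γ' : ℝ) : dataMeasure γ ≪ fanMeasure γ' := by
  refine (withDensity_absolutelyContinuous _ _).trans
    (withDensity_absolutelyContinuous' (by fun_prop) ?_)
  filter_upwards [ae_volume_cos_pos] with p hp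
  simpa using Real.rpow_pos_of_pos hp _

lemma fanMeasure_ac (γ γ' : ℝ) : fanMeasure γ ≪ dataMeasure γ' := by
  refine (withDensity_absolutelyContinuous _ _).trans
    (withDensity_absolutelyContinuous' (by fun_prop) ?_)
  filter_upwards [ae_volume_cos_pos] with p hp
  simpa using Real.rpow_pos_of_pos hp _

lemma ae_ball_pos : ∀ᵐ z ∂(volume.restrict (Metric.ball (0 : ℂ) 1)), 0 < 1 - ‖z‖ ^ 2 := by
  refine (ae_restrict_iff' measurableSet_ball).2 (Eventually.of_forall fun z hz => ?_)
  rw [mem_ball_zero_iff] at hz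
  nlinarith [norm_nonneg z]

lemma diskMeasure_ac (γ γ' : ℝ) : diskMeasure γ ≪ diskMeasure γ' := by
  rw [diskMeasure_eq_ball, diskMeasure_eq_ball]
  refine (withDensity_absolutelyContinuous _ _).trans
    (withDensity_absolutelyContinuous' (by fun_prop) ?_)
  filter_upwards [ae_ball_pos] with z hz
  simpa using Real.rpow_pos_of_pos hz _

lemma ae_diskMeasure_mem_ball (γ : ℝ) : ∀ᵐ z ∂diskMeasure γ, z ∈ Metric.ball (0 : ℂ) 1 := by
  rw [diskMeasure_eq_ball]
  exact (withDensity_absolutelyContinuous _ _).ae_le (ae_restrict_mem measurableSet_ball)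

lemma ae_dataMeasure_cos_pos (γ : ℝ) : ∀ᵐ p ∂dataMeasure γ, 0 < Real.cos p.2 :=
  (dataMeasure_ac γ γ).ae_le (ae_fanMeasure_cos_pos γ)

lemma weight_pos {z : ℂ} (hz : z ∈ Metric.ball (0 : ℂ) 1) : 0 < 1 - ‖z‖ ^ 2 := by
  rw [mem_ball_zero_iff] at hz
  nlinarith [norm_nonneg z]

/-- Multiplication by `μ^{2γ+1}` is an isometry from `L²(μ^{2γ+2} dβ dα)` to the data space. -/
lemma eLpNorm_dataMeasure (γ : ℝ) (f : ℝ × ℝ → ℂ) :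
    eLpNorm (fun p => ((Real.cos p.2 ^ (2 * γ + 1) : ℝ) : ℂ) * f p) 2 (dataMeasure γ) =
      eLpNorm f 2 (fanMeasure γ) := by
  refine eLpNorm_two_withDensity_eq (by fun_prop) (by fun_prop) ?_
  filter_upwards [ae_volume_cos_pos] with p hp
  refine ⟨by positivity, by positivity, ?_⟩
  rw [norm_mul, mul_pow, ← mul_assoc, Complex.norm_real, Real.norm_eq_abs, sq_abs]
  congr 1
  -- The exponents match: -2γ + 2(2γ + 1) = 2γ + 2.
  rw [← Real.rpow_natCast, ← Real.rpow_mul hp.le, ← Real.rpow_add hp]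
  congr 1
  push_cast
  ring

lemma memLp_dataMeasure_iff (γ : ℝ) (f : ℝ × ℝ → ℂ) :
    MemLp (fun p => ((Real.cos p.2 ^ (2 * γ + 1) : ℝ) : ℂ) * f p) 2 (dataMeasure γ) ↔
      MemLp f 2 (fanMeasure γ) := by
  rw [MemLp, MemLp, eLpNorm_dataMeasure]
  refine and_congr_left fun _ => ⟨fun h => ?_, fun h => ?_⟩
  · have hw : Measurable fun p : ℝ × ℝ => ((Real.cos p.2 ^ (2 * γ + 1) : ℝ) : ℂ)⁻¹ := by fun_prop
    refine ((hw.aestronglyMeasurable.mul (h.mono_ac (fanMeasure_ac γ γ)))).congr ?_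
    filter_upwards [ae_fanMeasure_cos_pos γ] with p hp
    have : ((Real.cos p.2 ^ (2 * γ + 1) : ℝ) : ℂ) ≠ 0 := by
      exact_mod_cast (Real.rpow_pos_of_pos hp _).ne'
    simp only [Pi.mul_apply]
    rw [inv_mul_cancel_left₀ this]
  · have hw : Measurable fun p : ℝ × ℝ => ((Real.cos p.2 ^ (2 * γ + 1) : ℝ) : ℂ) := by fun_prop
    exact hw.aestronglyMeasurable.mul (h.mono_ac (dataMeasure_ac γ γ))

/-- Multiplication by `d^γ` is an isometry from `L²_γ` to `L²_{-γ}`. -/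
lemma eLpNorm_diskMeasure_neg (γ : ℝ) (f : ℂ → ℂ) :
    eLpNorm (fun z => (((1 - ‖z‖ ^ 2) ^ γ : ℝ) : ℂ) * f z) 2 (diskMeasure (-γ)) =
      eLpNorm f 2 (diskMeasure γ) := by
  rw [diskMeasure_eq_ball, diskMeasure_eq_ball]
  refine eLpNorm_two_withDensity_eq (by fun_prop) (by fun_prop) ?_
  filter_upwards [ae_ball_pos] with z hz
  refine ⟨by positivity, by positivity, ?_⟩
  rw [norm_mul, mul_pow, ← mul_assoc, Complex.norm_real, Real.norm_eq_abs, sq_abs]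
  congr 1
  rw [← Real.rpow_mul_natCast hz.le, ← Real.rpow_add hz]
  congr 1
  push_cast
  ring

lemma memLp_diskMeasure_neg_iff (γ : ℝ) (f : ℂ → ℂ) :
    MemLp (fun z => (((1 - ‖z‖ ^ 2) ^ γ : ℝ) : ℂ) * f z) 2 (diskMeasure (-γ)) ↔
      MemLp f 2 (diskMeasure γ) := by
  rw [MemLp, MemLp, eLpNorm_diskMeasure_neg]
  refine and_congr_left fun _ => ⟨fun h => ?_, fun h => ?_⟩
  · have hw : Measurable fun z : ℂ => (((1 - ‖z‖ ^ 2) ^ γ : ℝ) : ℂ)⁻¹ := by fun_prop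
    refine ((hw.aestronglyMeasurable.mul (h.mono_ac (diskMeasure_ac γ _)))).congr ?_
    filter_upwards [ae_diskMeasure_mem_ball γ] with z hz
    have : (((1 - ‖z‖ ^ 2) ^ γ : ℝ) : ℂ) ≠ 0 := by
      exact_mod_cast (Real.rpow_pos_of_pos (weight_pos hz) _).ne'
    simp only [Pi.mul_apply]
    rw [inv_mul_cancel_left₀ this]
  · have hw : Measurable fun z : ℂ => (((1 - ‖z‖ ^ 2) ^ γ : ℝ) : ℂ) := by fun_prop
    exact hw.aestronglyMeasurable.mul (h.mono_ac (diskMeasure_ac _ γ))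

/-! ### Finiteness of the measures -/

/-- The density is (1 - x)^γ (1 + x)^γ. For γ ≤ 0 the factor whose base is at least 1 is at most 1,
so the product is dominated by (1 - x)^γ + (1 + x)^γ, integrable since γ > -1; for γ ≥ 0 the
constant 1 dominates. -/
instance (γ : ℝ) [hγ : Fact (-1 < γ)] : IsFiniteMeasure (jacobiMeasure γ) := by
  refine isFiniteMeasure_withDensity_ofReal (Integrable.hasFiniteIntegral ?_)
  have hint : ∀ a b : ℝ, IntervalIntegrable (fun x : ℝ => x ^ γ) volume a b := fun a b =>
    intervalIntegral.intervalIntegrable_rpow' hγ.out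
  have h1 : IntervalIntegrable (fun x : ℝ => (1 - x) ^ γ) volume (-1) 1 := by
    have := (hint 2 0).comp_sub_left 1
    norm_num at this
    exact this
  have h2 : IntervalIntegrable (fun x : ℝ => (1 + x) ^ γ) volume (-1) 1 := by
    have := (hint 0 2).comp_add_left 1
    norm_num at this
    exact this
  have h3 := (h1.add h2).add (intervalIntegrable_const (c := (1 : ℝ)))
  rw [intervalIntegrable_iff_integrableOn_Ioo_of_le (by norm_num)] at h3
  refine Integrable.mono' h3 (Measurable.aestronglyMeasurable (by fun_prop)) ?_
  refine (ae_restrict_iff' measurableSet_Ioo).2 (Eventually.of_forall fun x hx => ?_)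
  have ha : 0 < 1 - x := by linarith [hx.2]
  have hb : 0 < 1 + x := by linarith [hx.1]
  have he : 1 - x ^ 2 = (1 - x) * (1 + x) := by ring
  rw [he, Real.mul_rpow ha.le hb.le, Real.norm_of_nonneg (by positivity)]
  have ha' := Real.rpow_pos_of_pos ha γ
  have hb' := Real.rpow_pos_of_pos hb γ
  rcases le_total 0 γ with h0 | h0
  · have hle : (1 - x) ^ γ * (1 + x) ^ γ ≤ 1 := by
      rw [← Real.mul_rpow ha.le hb.le, ← he]
      exact Real.rpow_le_one (by rw [he]; positivity) (by nlinarith [sq_nonneg x]) h0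
    linarith
  · rcases le_total 0 x with hx0 | hx0
    · have := Real.rpow_le_one_of_one_le_of_nonpos (show (1 : ℝ) ≤ 1 + x by linarith) h0
      nlinarith
    · have := Real.rpow_le_one_of_one_le_of_nonpos (show (1 : ℝ) ≤ 1 - x by linarith) h0
      nlinarith

instance (γ : ℝ) [hγ : Fact (-1 < γ)] : IsFiniteMeasure (diskMeasure γ) := by
  have : Fact (-1 < γ + 1 / 2) := ⟨by linarith [hγ.out]⟩
  rw [← (measurePreserving_chord γ).map_eq]
  infer_instance

instance (γ : ℝ) [hγ : Fact (-1 < γ)] : IsFiniteMeasure (fanMeasure γ) := by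
  have : Fact (-1 < γ + 1 / 2) := ⟨by linarith [hγ.out]⟩
  have h := (measurePreserving_fan γ)
  refine ⟨?_⟩
  have h2 := h.measure_preimage (s := Set.univ) MeasurableSet.univ.nullMeasurableSet
  rw [Set.preimage_univ] at h2
  rw [h2]
  exact measure_lt_top _ _

/-! ### The transform in terms of the chord parametrization -/

/-- The change of parameter t = μ (1 + x) puts the midpoint of the chord at x = 0; the entry point
is e^{iβ} = v e^{-i(π+α)} = v (-cos α + i sin α). -/
lemma geodesic_eq_chordPoint (p : ℝ × ℝ) (x : ℝ) :
    geodesic p (Real.cos p.2 * x + Real.cos p.2) = chordPoint p x := by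
  have h : Complex.exp ((p.1 : ℂ) * Complex.I) =
      direction p * (-Real.cos p.2 + Real.sin p.2 * Complex.I) := by
    have h1 : (-(Real.cos p.2 : ℂ) + Real.sin p.2 * Complex.I) =
        Complex.exp ((-(Real.pi + p.2) : ℝ) * Complex.I) := by
      rw [Complex.exp_ofReal_mul_I]
      simp [Real.cos_add, Real.sin_add]
    rw [h1, direction, ← Complex.exp_add]
    congr 1
    push_cast
    ring
  rw [geodesic, chordPoint, h]
  push_cast
  ring

lemma one_sub_norm_chordPoint (p : ℝ × ℝ) (x : ℝ) :
    1 - ‖chordPoint p x‖ ^ 2 = Real.cos p.2 ^ 2 * (1 - x ^ 2) := by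
  rw [chordPoint, norm_mul, norm_direction, one_mul, Complex.sq_norm, ← Complex.ofReal_mul,
    Complex.normSq_add_mul_I]
  have := Real.sin_sq_add_cos_sq p.2
  linear_combination -this

/-- The factor dt contributes μ and the weight contributes μ^{2γ} (1 - x²)^γ; this is the origin of
the prefactor μ^{2γ+1} of all the data. -/
lemma rayIntegrand_chord (γ : ℝ) (F : ℂ → ℂ → ℂ) {p : ℝ × ℝ} (hp : 0 < Real.cos p.2) {x : ℝ}
    (hx : x ∈ Set.Ioo (-1 : ℝ) 1) :
    |Real.cos p.2| • rayIntegrand γ F p (Real.cos p.2 * x + Real.cos p.2) =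
      ((Real.cos p.2 ^ (2 * γ + 1) : ℝ) : ℂ) *
        ((ENNReal.ofReal ((1 - x ^ 2) ^ γ)).toReal • F (chordPoint p x) (direction p)) := by
  have hx1 : 0 < 1 - x ^ 2 := by nlinarith [hx.1, hx.2]
  rw [rayIntegrand, geodesic_eq_chordPoint, one_sub_norm_chordPoint,
    Real.mul_rpow (by positivity) hx1.le, ENNReal.toReal_ofReal (by positivity), abs_of_pos hp,
    Real.rpow_add hp, Real.rpow_one, ← Real.rpow_natCast, ← Real.rpow_mul hp.le]
  simp only [Complex.real_smul]
  push_cast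
  ring

lemma image_chord {m : ℝ} (hm : 0 < m) :
    (fun x => m * x + m) '' Set.Ioo (-1) 1 = Set.Ioo 0 (2 * m) := by
  have : (fun x => m * x + m) = (fun y => y + m) ∘ (fun x => m * x) := rfl
  rw [this, Set.image_comp, Set.image_mul_left_Ioo hm, Set.image_add_const_Ioo]
  congr 1 <;> ring

lemma hasDerivWithinAt_affine (m x : ℝ) (s : Set ℝ) :
    HasDerivWithinAt (fun x => m * x + m) m s x := by
  simpa using (((hasDerivAt_id x).const_mul m).add_const m).hasDerivWithinAt

lemma xray_eq_chord (γ : ℝ) (F : ℂ → ℂ → ℂ) {p : ℝ × ℝ} (hp : 0 < Real.cos p.2) :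
    xray γ F p = ((Real.cos p.2 ^ (2 * γ + 1) : ℝ) : ℂ) *
      ∫ x, F (chordPoint p x) (direction p) ∂jacobiMeasure γ := by
  rw [xray, intervalIntegral.integral_of_le (by linarith), integral_Ioc_eq_integral_Ioo,
    ← image_chord hp, integral_image_eq_integral_abs_deriv_smul measurableSet_Ioo
      (fun x _ => hasDerivWithinAt_affine _ x _)
      (fun x _ y _ h => mul_left_cancel₀ hp.ne' (add_right_cancel h)),
    jacobiMeasure, integral_withDensity_eq_integral_toReal_smul (by fun_prop) (by simp),
    ← integral_const_mul]
  exact setIntegral_congr_fun measurableSet_Ioo fun x hx => rayIntegrand_chord γ F hp hx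

lemma intervalIntegrable_rayIntegrand_iff (γ : ℝ) (F : ℂ → ℂ → ℂ) {p : ℝ × ℝ}
    (hp : 0 < Real.cos p.2) :
    IntervalIntegrable (rayIntegrand γ F p) volume 0 (2 * Real.cos p.2) ↔
      Integrable (fun x => F (chordPoint p x) (direction p)) (jacobiMeasure γ) := by
  have hne : ((Real.cos p.2 ^ (2 * γ + 1) : ℝ) : ℂ) ≠ 0 := by
    exact_mod_cast (Real.rpow_pos_of_pos hp _).ne'
  rw [intervalIntegrable_iff_integrableOn_Ioo_of_le (by linarith),
    ← image_chord hp, integrableOn_image_iff_integrableOn_abs_deriv_smul measurableSet_Ioo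
      (fun x _ => hasDerivWithinAt_affine _ x _)
      (fun x _ y _ h => mul_left_cancel₀ hp.ne' (add_right_cancel h)),
    jacobiMeasure, integrable_withDensity_iff_integrable_smul' (by fun_prop) (by simp),
    ← integrable_const_mul_iff hne.isUnit]
  exact integrableOn_congr_fun (fun x hx => rayIntegrand_chord γ F hp hx) measurableSet_Ioo

end DiskXRay
end

/-! ### Boundedness of I_0 d^γ, and multiplication of the data by powers of the direction. -/

noncomputable section
namespace DiskXRay

section Transform

set_option linter.unusedSectionVars false

variable {γ : ℝ} [hγ : Fact (-1 < γ)]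

/-! ### The bounded operator `I_0 d^γ` -/

lemma memLp_comp_santalo {f : ℂ → ℂ} (hf : MemLp f 2 (diskMeasure γ)) :
    MemLp (fun q : (ℝ × ℝ) × ℝ => f (chordPoint q.1 q.2)) 2
      ((fanMeasure γ).prod (jacobiMeasure γ)) := by
  have h1 : MemLp (fun q : ℂ × ℂ => f q.1) 2 ((diskMeasure γ).prod arc) := hf.comp_fst arc
  exact h1.comp_measurePreserving (measurePreserving_santalo γ)

/-- The pulled-back function does not involve the direction, so Santaló's formula only contributes
the square root of the total mass of the circle. -/
lemma eLpNorm_comp_santalo {f : ℂ → ℂ} (hf : AEStronglyMeasurable f (diskMeasure γ)) :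
    eLpNorm (fun q : (ℝ × ℝ) × ℝ => f (chordPoint q.1 q.2)) 2
      ((fanMeasure γ).prod (jacobiMeasure γ)) =
      arc Set.univ ^ (1 / 2 : ℝ) * eLpNorm f 2 (diskMeasure γ) := by
  have h1 : eLpNorm (fun q : ℂ × ℂ => f q.1) 2 ((diskMeasure γ).prod arc) =
      arc Set.univ ^ (1 / 2 : ℝ) * eLpNorm f 2 (diskMeasure γ) := by
    have h2 : Measure.map Prod.fst ((diskMeasure γ).prod arc) = arc Set.univ • diskMeasure γ :=
      Measure.map_fst_prod
    have h3 := eLpNorm_map_measure (p := 2) (f := (Prod.fst : ℂ × ℂ → ℂ)) (g := f)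
      (μ := (diskMeasure γ).prod arc) (by
        rw [h2]; exact hf.smul_measure _) measurable_fst.aemeasurable
    rw [h2, eLpNorm_smul_measure_of_ne_top (by simp)] at h3
    rw [show (fun q : ℂ × ℂ => f q.1) = f ∘ Prod.fst from rfl, ← h3]
    simp
  rw [← h1, ← eLpNorm_comp_measurePreserving (p := 2) (g := fun q : ℂ × ℂ => f q.1) hf.comp_fst
    (measurePreserving_santalo γ)]
  rfl

lemma ae_integrable_chord {f : ℂ → ℂ} (hf : MemLp f 2 (diskMeasure γ)) :
    ∀ᵐ p ∂fanMeasure γ, Integrable (fun x => f (chordPoint p x)) (jacobiMeasure γ) :=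
  ((memLp_comp_santalo hf).integrable (by norm_num)).prod_right_ae

/-- The operator norm bound for the transform. -/
def xrayBound (γ : ℝ) : ENNReal :=
  jacobiMeasure γ Set.univ ^ (1 / 2 : ℝ) * arc Set.univ ^ (1 / 2 : ℝ)

lemma xrayBound_ne_top : xrayBound γ ≠ ⊤ :=
  ENNReal.mul_ne_top (ENNReal.rpow_ne_top_of_nonneg (by norm_num) (measure_ne_top _ _))
    (ENNReal.rpow_ne_top_of_nonneg (by norm_num) (measure_ne_top _ _))

lemma enorm_integral_sq_le {f : ℝ → ℂ} (hf : AEStronglyMeasurable f (jacobiMeasure γ)) :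
    ‖∫ x, f x ∂jacobiMeasure γ‖ₑ ^ (2 : ℝ) ≤
      jacobiMeasure γ Set.univ * ∫⁻ x, ‖f x‖ₑ ^ (2 : ℝ) ∂jacobiMeasure γ := by
  have h1 := eLpNorm_le_eLpNorm_mul_rpow_measure_univ (p := 1) (q := 2) (by norm_num) hf
  rw [eLpNorm_one_eq_lintegral_enorm, eLpNorm_eq_lintegral_rpow_enorm_toReal (by simp) (by simp)]
    at h1
  have h2 := (enorm_integral_le_lintegral_enorm f).trans h1
  have h3 := ENNReal.rpow_le_rpow h2 (show (0 : ℝ) ≤ 2 by norm_num)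
  refine h3.trans_eq ?_
  rw [ENNReal.mul_rpow_of_nonneg _ _ (by norm_num), ← ENNReal.rpow_mul, ← ENNReal.rpow_mul]
  norm_num
  rw [mul_comm]

lemma aestronglyMeasurable_chord_integral {f : ℂ → ℂ} (hf : MemLp f 2 (diskMeasure γ)) :
    AEStronglyMeasurable (fun p => ∫ x, f (chordPoint p x) ∂jacobiMeasure γ) (fanMeasure γ) :=
  (memLp_comp_santalo hf).aestronglyMeasurable.integral_prod_right'

/-- Cauchy-Schwarz on each chord, combined with Santaló's formula. -/
lemma eLpNorm_chord_integral_le {f : ℂ → ℂ} (hf : MemLp f 2 (diskMeasure γ)) :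
    eLpNorm (fun p => ∫ x, f (chordPoint p x) ∂jacobiMeasure γ) 2 (fanMeasure γ) ≤
      xrayBound γ * eLpNorm f 2 (diskMeasure γ) := by
  rw [xrayBound, mul_assoc, ← eLpNorm_comp_santalo hf.1,
    eLpNorm_eq_lintegral_rpow_enorm_toReal (by simp) (by simp),
    eLpNorm_eq_lintegral_rpow_enorm_toReal (by simp) (by simp)]
  simp only [ENNReal.toReal_ofNat]
  rw [← ENNReal.mul_rpow_of_nonneg _ _ (by norm_num)]
  refine ENNReal.rpow_le_rpow ?_ (by norm_num)
  have hm := (memLp_comp_santalo hf).aestronglyMeasurable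
  rw [lintegral_prod _ (by exact hm.enorm.pow_const _),
    ← lintegral_const_mul'' _ (by exact (hm.enorm.pow_const _).lintegral_prod_right')]
  refine lintegral_mono_ae ?_
  filter_upwards [ae_integrable_chord hf] with p hp using enorm_integral_sq_le hp.1

lemma memLp_chord_integral {f : ℂ → ℂ} (hf : MemLp f 2 (diskMeasure γ)) :
    MemLp (fun p => ∫ x, f (chordPoint p x) ∂jacobiMeasure γ) 2 (fanMeasure γ) :=
  ⟨aestronglyMeasurable_chord_integral hf, (eLpNorm_chord_integral_le hf).trans_lt
    (ENNReal.mul_lt_top xrayBound_ne_top.lt_top hf.2)⟩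

/-- The transform of a function. -/
def xrayFun (γ : ℝ) (f : ℂ → ℂ) : ℝ × ℝ → ℂ := xray γ fun z _ => f z

lemma xrayFun_ae_eq (γ : ℝ) (f : ℂ → ℂ) : xrayFun γ f =ᵐ[dataMeasure γ] fun p =>
    ((Real.cos p.2 ^ (2 * γ + 1) : ℝ) : ℂ) * ∫ x, f (chordPoint p x) ∂jacobiMeasure γ := by
  filter_upwards [ae_dataMeasure_cos_pos γ] with p hp using xray_eq_chord γ _ hp

lemma memLp_xrayFun {f : ℂ → ℂ} (hf : MemLp f 2 (diskMeasure γ)) :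
    MemLp (xrayFun γ f) 2 (dataMeasure γ) :=
  (memLp_congr_ae (xrayFun_ae_eq γ f)).2 ((memLp_dataMeasure_iff γ _).2 (memLp_chord_integral hf))

lemma eLpNorm_xrayFun_le {f : ℂ → ℂ} (hf : MemLp f 2 (diskMeasure γ)) :
    eLpNorm (xrayFun γ f) 2 (dataMeasure γ) ≤ xrayBound γ * eLpNorm f 2 (diskMeasure γ) := by
  rw [eLpNorm_congr_ae (xrayFun_ae_eq γ f), eLpNorm_dataMeasure]
  exact eLpNorm_chord_integral_le hf

lemma ae_intervalIntegrable_rayIntegrand {f : ℂ → ℂ} (hf : MemLp f 2 (diskMeasure γ)) :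
    ∀ᵐ p ∂dataMeasure γ,
      IntervalIntegrable (rayIntegrand γ (fun z _ => f z) p) volume 0 (2 * Real.cos p.2) := by
  filter_upwards [ae_dataMeasure_cos_pos γ, (dataMeasure_ac γ γ).ae_le (ae_integrable_chord hf)]
    with p hp h using (intervalIntegrable_rayIntegrand_iff γ _ hp).2 h

/-- By Santaló's formula a null set of the disk meets almost every chord in a null set; hence the
transform descends to classes of functions. -/
lemma xrayFun_congr {f g : ℂ → ℂ} (h : f =ᵐ[diskMeasure γ] g) :
    xrayFun γ f =ᵐ[dataMeasure γ] xrayFun γ g := by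
  have h1 : ∀ᵐ q ∂((fanMeasure γ).prod (jacobiMeasure γ)),
      f (chordPoint q.1 q.2) = g (chordPoint q.1 q.2) := by
    have h2 : ∀ᵐ q ∂((diskMeasure γ).prod arc), f q.1 = g q.1 :=
      Measure.quasiMeasurePreserving_fst.ae h
    exact (measurePreserving_santalo γ).quasiMeasurePreserving.ae h2
  have h3 := (dataMeasure_ac γ γ).ae_le (Measure.ae_ae_of_ae_prod h1)
  filter_upwards [xrayFun_ae_eq γ f, xrayFun_ae_eq γ g, h3] with p hf hg hp
  rw [hf, hg]
  congr 1
  exact integral_congr_ae hp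

lemma xrayFun_add {f g : ℂ → ℂ} (hf : MemLp f 2 (diskMeasure γ)) (hg : MemLp g 2 (diskMeasure γ)) :
    xrayFun γ (fun z => f z + g z) =ᵐ[dataMeasure γ] fun p => xrayFun γ f p + xrayFun γ g p := by
  filter_upwards [xrayFun_ae_eq γ f, xrayFun_ae_eq γ g, xrayFun_ae_eq γ fun z => f z + g z,
    (dataMeasure_ac γ γ).ae_le (ae_integrable_chord hf),
    (dataMeasure_ac γ γ).ae_le (ae_integrable_chord hg)] with p h1 h2 h3 h4 h5
  rw [h1, h2, h3, integral_add h4 h5, mul_add]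

lemma xrayFun_const_mul (c : ℂ) (f : ℂ → ℂ) :
    xrayFun γ (fun z => c * f z) =ᵐ[dataMeasure γ] fun p => c * xrayFun γ f p := by
  filter_upwards [xrayFun_ae_eq γ f, xrayFun_ae_eq γ fun z => c * f z] with p h1 h2
  rw [h1, h2, integral_const_mul]
  ring

variable (γ) in
/-- The transform `I_0 d^γ` as a bounded operator. -/
def xrayL : Lp ℂ 2 (diskMeasure γ) →L[ℂ] DataSpace γ :=
  LinearMap.mkContinuous
    { toFun := fun u => (memLp_xrayFun (Lp.memLp u)).toLp _
      map_add' := fun u w => by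
        rw [← MemLp.toLp_add]
        refine MemLp.toLp_congr _ _ ?_
        exact (xrayFun_congr (Lp.coeFn_add u w)).trans (xrayFun_add (Lp.memLp u) (Lp.memLp w))
      map_smul' := fun c u => by
        rw [RingHom.id_apply, ← MemLp.toLp_const_smul]
        refine MemLp.toLp_congr _ _ ?_
        exact (xrayFun_congr (Lp.coeFn_smul c u)).trans (xrayFun_const_mul c u) }
    (xrayBound γ).toReal fun u => by
      simp only [LinearMap.coe_mk, AddHom.coe_mk]
      rw [Lp.norm_toLp, Lp.norm_def, ← ENNReal.toReal_mul]
      exact ENNReal.toReal_mono (ENNReal.mul_ne_top xrayBound_ne_top (Lp.eLpNorm_ne_top u))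
        (eLpNorm_xrayFun_le (Lp.memLp u))

lemma xrayL_ae_eq (u : Lp ℂ 2 (diskMeasure γ)) :
    xrayL γ u =ᵐ[dataMeasure γ] xrayFun γ u :=
  MemLp.coeFn_toLp (memLp_xrayFun (Lp.memLp u))

lemma xrayL_toLp {f : ℂ → ℂ} (hf : MemLp f 2 (diskMeasure γ)) :
    xrayL γ (hf.toLp f) =ᵐ[dataMeasure γ] xrayFun γ f :=
  (xrayL_ae_eq _).trans (xrayFun_congr hf.coeFn_toLp)

/-! ### Multiplication by powers of the direction -/

lemma eLpNorm_direction_zpow (γ : ℝ) (j : ℤ) (f : ℝ × ℝ → ℂ) :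
    eLpNorm (fun p => direction p ^ j * f p) 2 (dataMeasure γ) = eLpNorm f 2 (dataMeasure γ) := by
  refine eLpNorm_congr_norm_ae (Eventually.of_forall fun p => ?_)
  simp

lemma continuous_direction_zpow (j : ℤ) : Continuous fun p => direction p ^ j :=
  continuous_direction.zpow₀ j fun p => Or.inl (direction_ne_zero p)

lemma memLp_direction_zpow (j : ℤ) {f : ℝ × ℝ → ℂ} (hf : MemLp f 2 (dataMeasure γ)) :
    MemLp (fun p => direction p ^ j * f p) 2 (dataMeasure γ) :=
  ⟨(continuous_direction_zpow j).aestronglyMeasurable.mul hf.1, by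
    rw [eLpNorm_direction_zpow]; exact hf.2⟩

variable (γ) in
/-- Multiplication by `e^{ij(β+α+π)}` on the data space. -/
def modul (j : ℤ) : DataSpace γ →ₗᵢ[ℂ] DataSpace γ where
  toFun u := (memLp_direction_zpow j (Lp.memLp u)).toLp _
  map_add' u w := by
    rw [← MemLp.toLp_add]
    refine MemLp.toLp_congr _ _ ?_
    filter_upwards [Lp.coeFn_add u w] with p hp
    rw [hp, Pi.add_apply, Pi.add_apply, mul_add]
  map_smul' c u := by
    rw [RingHom.id_apply, ← MemLp.toLp_const_smul]
    refine MemLp.toLp_congr _ _ ?_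
    filter_upwards [Lp.coeFn_smul c u] with p hp
    rw [hp, Pi.smul_apply, Pi.smul_apply, smul_eq_mul, smul_eq_mul]
    ring
  norm_map' u := by
    simp only [LinearMap.coe_mk, AddHom.coe_mk]
    rw [Lp.norm_toLp, Lp.norm_def, eLpNorm_direction_zpow]

lemma modul_ae_eq (j : ℤ) (u : DataSpace γ) :
    modul γ j u =ᵐ[dataMeasure γ] fun p => direction p ^ j * u p :=
  MemLp.coeFn_toLp (memLp_direction_zpow j (Lp.memLp u))

lemma modul_modul (i j : ℤ) (u : DataSpace γ) : modul γ i (modul γ j u) = modul γ (i + j) u := by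
  refine Lp.ext ?_
  filter_upwards [modul_ae_eq i (modul γ j u), modul_ae_eq j u, modul_ae_eq (i + j) u]
    with p h1 h2 h3
  rw [h1, h2, h3, zpow_add₀ (direction_ne_zero p), mul_assoc]

lemma modul_zero (u : DataSpace γ) : modul γ 0 u = u := by
  refine Lp.ext ?_
  filter_upwards [modul_ae_eq 0 u] with p h1
  rw [h1, zpow_zero, one_mul]

end Transform

end DiskXRay
end

/-! ### Polynomials in z and z̄, back-projection, and the adjoint of the transform. -/

noncomputable section
namespace DiskXRay

section Polynomials

set_option linter.unusedSectionVars false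

open MvPolynomial in
/-- Evaluation of a polynomial in `z` and `z̄`. -/
def evalConj (P : MvPolynomial (Fin 2) ℂ) (z : ℂ) : ℂ :=
  MvPolynomial.eval ![z, (starRingEnd ℂ) z] P

/-- The monomial `z^a z̄^b`. -/
def zMono (a b : ℕ) : MvPolynomial (Fin 2) ℂ := MvPolynomial.X 0 ^ a * MvPolynomial.X 1 ^ b

@[simp] lemma evalConj_zMono (a b : ℕ) (z : ℂ) :
    evalConj (zMono a b) z = z ^ a * (starRingEnd ℂ) z ^ b := by
  simp [evalConj, zMono]

@[simp] lemma evalConj_add (P Q : MvPolynomial (Fin 2) ℂ) (z : ℂ) :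
    evalConj (P + Q) z = evalConj P z + evalConj Q z := map_add _ _ _

@[simp] lemma evalConj_sub (P Q : MvPolynomial (Fin 2) ℂ) (z : ℂ) :
    evalConj (P - Q) z = evalConj P z - evalConj Q z := map_sub _ _ _

@[simp] lemma evalConj_mul (P Q : MvPolynomial (Fin 2) ℂ) (z : ℂ) :
    evalConj (P * Q) z = evalConj P z * evalConj Q z := map_mul _ _ _

@[simp] lemma evalConj_C (c : ℂ) (z : ℂ) : evalConj (MvPolynomial.C c) z = c := by
  simp [evalConj]

@[simp] lemma evalConj_smul (c : ℂ) (P : MvPolynomial (Fin 2) ℂ) (z : ℂ) :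
    evalConj (c • P) z = c * evalConj P z := by
  simp [evalConj]

@[simp] lemma evalConj_X0 (z : ℂ) : evalConj (MvPolynomial.X 0) z = z := by
  simp [evalConj]

@[simp] lemma evalConj_X1 (z : ℂ) : evalConj (MvPolynomial.X 1) z = (starRingEnd ℂ) z := by
  simp [evalConj]

@[simp] lemma evalConj_zero (z : ℂ) : evalConj 0 z = 0 := map_zero _

@[simp] lemma evalConj_one (z : ℂ) : evalConj 1 z = 1 := map_one _

lemma evalConj_sum {ι : Type*} (s : Finset ι) (P : ι → MvPolynomial (Fin 2) ℂ) (z : ℂ) :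
    evalConj (∑ i ∈ s, P i) z = ∑ i ∈ s, evalConj (P i) z := map_sum _ _ _

@[fun_prop]
lemma continuous_evalConj (P : MvPolynomial (Fin 2) ℂ) : Continuous (evalConj P) := by
  unfold evalConj
  refine (MvPolynomial.continuous_eval P).comp ?_
  refine continuous_pi fun i => ?_
  fin_cases i
  · exact continuous_id
  · exact Complex.continuous_conj

lemma monomial_eq_zMono (s : Fin 2 →₀ ℕ) (c : ℂ) :
    MvPolynomial.monomial s c = c • zMono (s 0) (s 1) := by
  rw [MvPolynomial.monomial_eq, zMono, Finsupp.prod_fintype _ _ (by simp), Fin.prod_univ_two,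
    MvPolynomial.smul_eq_C_mul]

lemma span_zMono : Submodule.span ℂ (Set.range fun ab : ℕ × ℕ => zMono ab.1 ab.2) = ⊤ := by
  refine eq_top_iff.2 fun P _ => ?_
  induction P using MvPolynomial.induction_on' with
  | monomial s c =>
    rw [monomial_eq_zMono]
    exact Submodule.smul_mem _ _ (Submodule.subset_span ⟨(s 0, s 1), rfl⟩)
  | add P Q hP hQ => exact Submodule.add_mem _ (hP trivial) (hQ trivial)

/-- Polynomials of degree at most `N` and of angular momentum `j`. -/
def modePoly (j : ℤ) (N : ℕ) : Submodule ℂ (MvPolynomial (Fin 2) ℂ) :=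
  Submodule.span ℂ {P | ∃ a b : ℕ, (a : ℤ) - b = j ∧ a + b ≤ N ∧ P = zMono a b}

lemma modePoly_mono (j : ℤ) {N M : ℕ} (h : N ≤ M) : modePoly j N ≤ modePoly j M :=
  Submodule.span_mono fun _ ⟨a, b, h1, h2, h3⟩ => ⟨a, b, h1, h2.trans h, h3⟩

/-! ### Angular integrals -/

lemma integral_arc_zpow (k : ℤ) : ∫ v, v ^ k ∂arc = if k = 0 then 2 * (Real.pi : ℂ) else 0 := by
  have hm : Measurable fun v : ℂ => v ^ k := Measurable.pow_const measurable_id k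
  rw [integral_arc hm.aestronglyMeasurable]
  split_ifs with hk
  · subst hk; simp
  · have h : ∀ θ : ℝ, Complex.exp (θ * Complex.I) ^ k = Complex.exp ((k * Complex.I) * θ) :=
      fun θ => by
        rw [← Complex.exp_int_mul]; congr 1; ring
    simp_rw [h]
    have hk' : (k : ℂ) * Complex.I ≠ 0 :=
      mul_ne_zero (by exact_mod_cast hk) Complex.I_ne_zero
    rw [integral_exp_mul_complex hk']
    have : (k : ℂ) * Complex.I * ((2 * Real.pi : ℝ) : ℂ) = k * (2 * Real.pi * Complex.I) := by
      push_cast; ring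
    rw [this, Complex.exp_int_mul_two_pi_mul_I]
    simp

/-- `∫ v^j q(Im(z v̄)) dv` over the unit circle. -/
def backProj (q : Polynomial ℂ) (j : ℤ) (z : ℂ) : ℂ :=
  ∫ v, v ^ j * q.eval (((z * (starRingEnd ℂ) v).im : ℝ) : ℂ) ∂arc

/-- The back-projection of a power, as a polynomial in `z` and `z̄`. -/
def backProjMono (m : ℕ) (j : ℤ) : MvPolynomial (Fin 2) ℂ :=
  ∑ i ∈ Finset.range (m + 1), if j + m = 2 * i then
    (2 * Real.pi * ((-1) ^ (m - i) * (2 * Complex.I)⁻¹ ^ m * (m.choose i)) : ℂ) • zMono i (m - i)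
    else 0

/-- The back-projection of a polynomial, as a polynomial in `z` and `z̄`. -/
def backProjPoly (q : Polynomial ℂ) (j : ℤ) : MvPolynomial (Fin 2) ℂ :=
  ∑ m ∈ Finset.range (q.natDegree + 1), q.coeff m • backProjMono m j

lemma backProjMono_mem (m : ℕ) (j : ℤ) : backProjMono m j ∈ modePoly j m := by
  refine Submodule.sum_mem _ fun i hi => ?_
  rw [Finset.mem_range] at hi
  split_ifs with h
  · refine Submodule.smul_mem _ _ (Submodule.subset_span ⟨i, m - i, ?_, by lia, rfl⟩)
    push_cast [Nat.le_of_lt_succ hi]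
    lia
  · exact Submodule.zero_mem _

/-- Only the terms with j + m = 2i are kept, and then i - (m - i) = j: back-projection preserves the
mode and does not raise the degree. The orthogonality relations all come from this selection rule.
-/
lemma backProjPoly_mem (q : Polynomial ℂ) (j : ℤ) : backProjPoly q j ∈ modePoly j q.natDegree :=
  Submodule.sum_mem _ fun m hm => Submodule.smul_mem _ _
    (modePoly_mono j (Nat.le_of_lt_succ (Finset.mem_range.1 hm)) (backProjMono_mem m j))

/-- Im(z v̄) = (z v̄ - z̄ v)/(2i) with v̄ = v⁻¹. The binomial expansion separates the powers of v,
of which integration over the circle keeps only the exponent zero. -/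
lemma im_mul_conj_pow (z : ℂ) {v : ℂ} (hv : ‖v‖ = 1) (m : ℕ) (j : ℤ) :
    v ^ j * (((z * (starRingEnd ℂ) v).im : ℝ) : ℂ) ^ m =
      ∑ i ∈ Finset.range (m + 1), ((-1) ^ (m - i) * (2 * Complex.I)⁻¹ ^ m * (m.choose i) *
        (z ^ i * (starRingEnd ℂ) z ^ (m - i))) * v ^ (j + m - 2 * i : ℤ) := by
  have hv0 : v ≠ 0 := by rintro rfl; simp at hv
  have hc : (starRingEnd ℂ) v = v⁻¹ := by
    rw [Complex.inv_def, Complex.normSq_eq_norm_sq, hv]; simp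
  have h : (((z * (starRingEnd ℂ) v).im : ℝ) : ℂ) =
      (2 * Complex.I)⁻¹ * (z * v⁻¹ + -((starRingEnd ℂ) z * v)) := by
    rw [Complex.im_eq_sub_conj, map_mul, Complex.conj_conj, hc]
    field_simp
    ring
  rw [h, mul_pow, add_pow, Finset.mul_sum, Finset.mul_sum]
  refine Finset.sum_congr rfl fun i hi => ?_
  have hi' : i ≤ m := Nat.le_of_lt_succ (Finset.mem_range.1 hi)
  have hz : v ^ (j + m - 2 * i : ℤ) = v ^ j * (v⁻¹ ^ i * v ^ (m - i)) := by
    rw [← zpow_natCast v (m - i), inv_pow, ← zpow_natCast v i, ← zpow_neg, ← zpow_add₀ hv0,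
      ← zpow_add₀ hv0]
    congr 1
    push_cast [hi']
    ring
  rw [hz, mul_pow, neg_pow, mul_pow]
  ring

lemma integrable_arc_of_bound {F : ℂ → ℂ} (hF : AEStronglyMeasurable F arc) (C : ℝ)
    (h : ∀ v, ‖v‖ = 1 → ‖F v‖ ≤ C) : Integrable F arc :=
  Integrable.of_bound hF C (ae_arc_norm.mono fun v hv => h v hv)

lemma integrable_arc_zpow (k : ℤ) : Integrable (fun v : ℂ => v ^ k) arc :=
  integrable_arc_of_bound (Measurable.pow_const measurable_id k).aestronglyMeasurable 1
    fun v hv => by simp [hv]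

lemma integral_backProjMono (m : ℕ) (j : ℤ) (z : ℂ) :
    Integrable (fun v => v ^ j * (((z * (starRingEnd ℂ) v).im : ℝ) : ℂ) ^ m) arc ∧
    ∫ v, v ^ j * (((z * (starRingEnd ℂ) v).im : ℝ) : ℂ) ^ m ∂arc =
      evalConj (backProjMono m j) z := by
  have hae : (fun v => v ^ j * (((z * (starRingEnd ℂ) v).im : ℝ) : ℂ) ^ m) =ᵐ[arc] fun v =>
      ∑ i ∈ Finset.range (m + 1), ((-1) ^ (m - i) * (2 * Complex.I)⁻¹ ^ m * (m.choose i) *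
        (z ^ i * (starRingEnd ℂ) z ^ (m - i))) * v ^ (j + m - 2 * i : ℤ) := by
    filter_upwards [ae_arc_norm] with v hv using im_mul_conj_pow z hv m j
  have hint : ∀ i ∈ Finset.range (m + 1), Integrable (fun v : ℂ =>
      ((-1) ^ (m - i) * (2 * Complex.I)⁻¹ ^ m * (m.choose i) *
        (z ^ i * (starRingEnd ℂ) z ^ (m - i))) * v ^ (j + m - 2 * i : ℤ)) arc :=
    fun i _ => (integrable_arc_zpow _).const_mul _
  refine ⟨(integrable_congr hae).2 (integrable_finsetSum _ hint), ?_⟩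
  rw [integral_congr_ae hae, integral_finsetSum _ hint, backProjMono, evalConj_sum]
  refine Finset.sum_congr rfl fun i hi => ?_
  rw [integral_const_mul, integral_arc_zpow]
  by_cases h : j + m = 2 * i
  · rw [if_pos (by lia), if_pos h, evalConj_smul, evalConj_zMono]
    ring
  · rw [if_neg (by lia), if_neg h, evalConj_zero, mul_zero]

lemma evalConj_backProjPoly (q : Polynomial ℂ) (j : ℤ) (z : ℂ) :
    evalConj (backProjPoly q j) z = backProj q j z := by
  rw [backProj, backProjPoly, evalConj_sum]
  simp_rw [Polynomial.eval_eq_sum_range, Finset.mul_sum]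
  rw [integral_finsetSum]
  · refine Finset.sum_congr rfl fun m _ => ?_
    rw [evalConj_smul, ← (integral_backProjMono m j z).2, ← integral_const_mul]
    congr 1
    funext v
    ring
  · intro m _
    refine (((integral_backProjMono m j z).1).const_mul (q.coeff m)).congr
      (Eventually.of_forall fun v => ?_)
    simp only []
    ring

variable {γ : ℝ} [hγ : Fact (-1 < γ)]

/-! ### Polynomials in the disk space -/

/-- The space `L²_γ` of the disk. -/
abbrev DiskSpace (γ : ℝ) : Type := Lp ℂ 2 (diskMeasure γ)

lemma memLp_of_continuous {f : ℂ → ℂ} (hf : Continuous f) : MemLp f 2 (diskMeasure γ) := by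
  obtain ⟨C, hC⟩ := (isCompact_closedBall (0 : ℂ) 1).exists_bound_of_continuousOn hf.continuousOn
  refine MemLp.of_bound hf.aestronglyMeasurable C ?_
  filter_upwards [ae_diskMeasure_mem_ball γ] with z hz using hC z (Metric.ball_subset_closedBall hz)

lemma memLp_evalConj (P : MvPolynomial (Fin 2) ℂ) : MemLp (evalConj P) 2 (diskMeasure γ) :=
  memLp_of_continuous (continuous_evalConj P)

variable (γ) in
/-- Polynomials in `z` and `z̄` as elements of `L²_γ`. -/
def polyLp : MvPolynomial (Fin 2) ℂ →ₗ[ℂ] DiskSpace γ where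
  toFun P := (memLp_evalConj P).toLp _
  map_add' P Q := by
    rw [← MemLp.toLp_add]
    exact MemLp.toLp_congr _ _ (Eventually.of_forall fun z => evalConj_add P Q z)
  map_smul' c P := by
    rw [RingHom.id_apply, ← MemLp.toLp_const_smul]
    exact MemLp.toLp_congr _ _ (Eventually.of_forall fun z => evalConj_smul c P z)

lemma polyLp_ae_eq (P : MvPolynomial (Fin 2) ℂ) : polyLp γ P =ᵐ[diskMeasure γ] evalConj P :=
  MemLp.coeFn_toLp (memLp_evalConj P)

lemma inner_eq_integral {α : Type*} [MeasurableSpace α] {μ : Measure α} {u w : Lp ℂ 2 μ}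
    {f g : α → ℂ} (hu : u =ᵐ[μ] f) (hw : w =ᵐ[μ] g) :
    inner ℂ u w = ∫ x, (starRingEnd ℂ) (f x) * g x ∂μ := by
  rw [L2.inner_def]
  refine integral_congr_ae ?_
  filter_upwards [hu, hw] with x h1 h2
  rw [h1, h2, RCLike.inner_apply, mul_comm]

/-! ### Polynomial data -/

lemma integral_dataMeasure (F : ℝ × ℝ → ℂ) :
    ∫ p, ((Real.cos p.2 ^ (2 * γ + 1) : ℝ) : ℂ) * (((Real.cos p.2 ^ (2 * γ + 1) : ℝ) : ℂ) * F p)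
      ∂dataMeasure γ = ∫ p, F p ∂fanMeasure γ := by
  rw [dataMeasure, fanMeasure, integral_withDensity_eq_integral_toReal_smul (by fun_prop) (by simp),
    integral_withDensity_eq_integral_toReal_smul (by fun_prop) (by simp)]
  refine integral_congr_ae ?_
  filter_upwards [ae_volume_cos_pos] with p hp
  rw [ENNReal.toReal_ofReal (by positivity), ENNReal.toReal_ofReal (by positivity),
    Complex.real_smul, Complex.real_smul, ← mul_assoc, ← mul_assoc, ← Complex.ofReal_mul,
    ← Complex.ofReal_mul, ← Real.rpow_add hp, ← Real.rpow_add hp]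
  congr 3
  ring

/-- The function `v^j q(sin α)` on the data space. -/
def fanMode (q : Polynomial ℂ) (j : ℤ) (p : ℝ × ℝ) : ℂ :=
  direction p ^ j * q.eval ((Real.sin p.2 : ℝ) : ℂ)

lemma continuous_fanMode (q : Polynomial ℂ) (j : ℤ) : Continuous (fanMode q j) :=
  (continuous_direction_zpow j).mul (q.continuous.comp (by fun_prop))

lemma exists_bound_eval (q : Polynomial ℂ) :
    ∃ C : ℝ, ∀ x : ℝ, |x| ≤ 1 → ‖q.eval (x : ℂ)‖ ≤ C := by
  obtain ⟨C, hC⟩ := (isCompact_closedBall (0 : ℂ) 1).exists_bound_of_continuousOn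
    q.continuous.continuousOn
  exact ⟨C, fun x hx => hC x (by simpa using hx)⟩

lemma exists_bound_fanMode (q : Polynomial ℂ) (j : ℤ) : ∃ C : ℝ, ∀ p, ‖fanMode q j p‖ ≤ C := by
  obtain ⟨C, hC⟩ := exists_bound_eval q
  exact ⟨C, fun p => by simpa [fanMode] using hC _ (Real.abs_sin_le_one p.2)⟩

lemma memLp_fanMode (q : Polynomial ℂ) (j : ℤ) : MemLp (fanMode q j) 2 (fanMeasure γ) := by
  obtain ⟨C, hC⟩ := exists_bound_fanMode q j
  exact MemLp.of_bound (continuous_fanMode q j).aestronglyMeasurable C (Eventually.of_forall hC)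

variable (γ) in
/-- The functions `μ^{2γ+1} v^j q(sin α)` as elements of the data space. -/
def fanLp (j : ℤ) : Polynomial ℂ →ₗ[ℂ] DataSpace γ where
  toFun q := ((memLp_dataMeasure_iff γ _).2 (memLp_fanMode q j)).toLp _
  map_add' q r := by
    rw [← MemLp.toLp_add]
    refine MemLp.toLp_congr _ _ (Eventually.of_forall fun p => ?_)
    simp only [fanMode, Polynomial.eval_add, Pi.add_apply]
    ring
  map_smul' c q := by
    rw [RingHom.id_apply, ← MemLp.toLp_const_smul]
    refine MemLp.toLp_congr _ _ (Eventually.of_forall fun p => ?_)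
    simp only [fanMode, Polynomial.eval_smul, Pi.smul_apply, smul_eq_mul]
    ring

lemma fanLp_ae_eq (j : ℤ) (q : Polynomial ℂ) : fanLp γ j q =ᵐ[dataMeasure γ] fun p =>
    ((Real.cos p.2 ^ (2 * γ + 1) : ℝ) : ℂ) * fanMode q j p :=
  MemLp.coeFn_toLp ((memLp_dataMeasure_iff γ _).2 (memLp_fanMode q j))

lemma modul_fanLp (i j : ℤ) (q : Polynomial ℂ) : modul γ i (fanLp γ j q) = fanLp γ (i + j) q := by
  refine Lp.ext ?_
  filter_upwards [modul_ae_eq i (fanLp γ j q), fanLp_ae_eq j q, fanLp_ae_eq (i + j) q]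
    with p h1 h2 h3
  rw [h1, h2, h3, fanMode, fanMode, zpow_add₀ (direction_ne_zero p)]
  ring

lemma inner_fanLp (j : ℤ) (q : Polynomial ℂ) {u : DataSpace γ} {g : ℝ × ℝ → ℂ}
    (hu : u =ᵐ[dataMeasure γ] fun p => ((Real.cos p.2 ^ (2 * γ + 1) : ℝ) : ℂ) * g p) :
    inner ℂ (fanLp γ j q) u = ∫ p, (starRingEnd ℂ) (fanMode q j p) * g p ∂fanMeasure γ := by
  rw [inner_eq_integral (fanLp_ae_eq j q) hu, ← integral_dataMeasure]
  congr 1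
  funext p
  rw [map_mul, Complex.conj_ofReal]
  ring

/-- In the coordinates (v, sin α) the measure is a product, so the modes decouple and the
polynomials are paired with the weight (1 - x²)^{γ+1/2}. -/
lemma inner_fanLp_fanLp (j j' : ℤ) (q q' : Polynomial ℂ) :
    inner ℂ (fanLp γ j q) (fanLp γ j' q') = (if j = j' then 2 * (Real.pi : ℂ) else 0) *
      ∫ x, (starRingEnd ℂ) (q.eval (x : ℂ)) * q'.eval (x : ℂ) ∂jacobiMeasure (γ + 1 / 2) := by
  rw [inner_fanLp j q (fanLp_ae_eq j' q')]
  have hz : Measurable fun v : ℂ => v ^ (j' - j) := Measurable.pow_const measurable_id _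
  have hc : Measurable fun x : ℝ => (starRingEnd ℂ) (q.eval (x : ℂ)) * q'.eval (x : ℂ) :=
    (by fun_prop : Continuous fun x : ℝ =>
      (starRingEnd ℂ) (q.eval (x : ℂ)) * q'.eval (x : ℂ)).measurable
  have h := integral_map (μ := fanMeasure γ) (measurePreserving_fan γ).measurable.aemeasurable
    (f := fun r : ℂ × ℝ => r.1 ^ (j' - j) *
      ((starRingEnd ℂ) (q.eval (r.2 : ℂ)) * q'.eval (r.2 : ℂ)))
    ((hz.comp measurable_fst).mul (hc.comp measurable_snd)).aestronglyMeasurable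
  rw [(measurePreserving_fan γ).map_eq, integral_prod_mul (μ := arc)
    (ν := jacobiMeasure (γ + 1 / 2)) (fun v : ℂ => v ^ (j' - j))
    (fun x : ℝ => (starRingEnd ℂ) (q.eval (x : ℂ)) * q'.eval (x : ℂ)), integral_arc_zpow] at h
  simp only [sub_eq_zero, eq_comm (a := j')] at h
  rw [h]
  congr 1
  funext p
  rw [fanMode, fanMode, map_mul, map_zpow₀]
  have hcd : (starRingEnd ℂ) (direction p) = (direction p)⁻¹ := by
    rw [Complex.inv_def, Complex.normSq_eq_norm_sq, norm_direction]; simp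
  rw [hcd, zpow_sub₀ (direction_ne_zero p), inv_zpow]
  ring

/-- This is why the adjoint averages over directions: a function of sin α on the data is a function
of z and v on the disk, constant along each chord. -/
lemma im_chordPoint_mul_conj_direction (p : ℝ × ℝ) (x : ℝ) :
    (chordPoint p x * (starRingEnd ℂ) (direction p)).im = Real.sin p.2 := by
  have : chordPoint p x * (starRingEnd ℂ) (direction p) =
      ((Real.cos p.2 * x : ℝ) : ℂ) + (Real.sin p.2 : ℝ) * Complex.I := by
    rw [chordPoint, mul_right_comm, Complex.mul_conj, Complex.normSq_eq_norm_sq, norm_direction]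
    push_cast
    ring
  rw [this, Complex.add_im, Complex.ofReal_im, Complex.im_ofReal_mul, Complex.I_im]
  ring

/-- The adjoint of the transform on polynomial data. -/
lemma inner_fanLp_xrayL (j : ℤ) (q : Polynomial ℂ) (u : DiskSpace γ) :
    inner ℂ (fanLp γ j q) (xrayL γ u) = inner ℂ (polyLp γ (backProjPoly q j)) u := by
  have hu := Lp.memLp u
  rw [inner_fanLp j q ((xrayL_ae_eq u).trans (xrayFun_ae_eq γ u)),
    inner_eq_integral (polyLp_ae_eq _) (ae_eq_refl (u : ℂ → ℂ))]
  obtain ⟨C, hC⟩ := exists_bound_fanMode q j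
  obtain ⟨C', hC'⟩ := exists_bound_eval q
  have hsan := memLp_comp_santalo hu
  have hint : Integrable (fun r : (ℝ × ℝ) × ℝ =>
      (starRingEnd ℂ) (fanMode q j r.1) * u (chordPoint r.1 r.2))
      ((fanMeasure γ).prod (jacobiMeasure γ)) := by
    refine Integrable.bdd_mul (c := C) (hsan.integrable (by norm_num)) ?_ ?_
    · exact (Complex.continuous_conj.comp
        ((continuous_fanMode q j).comp continuous_fst)).aestronglyMeasurable
    · exact Eventually.of_forall fun r => by simpa using hC r.1
  have h1 : ∫ p, (starRingEnd ℂ) (fanMode q j p) * ∫ x, u (chordPoint p x) ∂jacobiMeasure γ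
      ∂fanMeasure γ = ∫ r, (starRingEnd ℂ) (fanMode q j r.1) * u (chordPoint r.1 r.2)
      ∂((fanMeasure γ).prod (jacobiMeasure γ)) := by
    rw [integral_prod _ hint]
    congr 1
    funext p
    exact (integral_const_mul _ _).symm
  have hk : Measurable fun r : ℂ × ℂ => (starRingEnd ℂ) (r.2 ^ j *
      q.eval (((r.1 * (starRingEnd ℂ) r.2).im : ℝ) : ℂ)) := by
    refine Complex.continuous_conj.measurable.comp (Measurable.mul
      (Measurable.pow_const measurable_snd j) (Continuous.measurable ?_))
    exact q.continuous.comp (by fun_prop)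
  have hF : AEStronglyMeasurable (fun r : ℂ × ℂ => (starRingEnd ℂ) (r.2 ^ j *
      q.eval (((r.1 * (starRingEnd ℂ) r.2).im : ℝ) : ℂ)) * u r.1) ((diskMeasure γ).prod arc) :=
    hk.aestronglyMeasurable.mul hu.1.comp_fst
  have hFint : Integrable (fun r : ℂ × ℂ => (starRingEnd ℂ) (r.2 ^ j *
      q.eval (((r.1 * (starRingEnd ℂ) r.2).im : ℝ) : ℂ)) * u r.1) ((diskMeasure γ).prod arc) := by
    refine Integrable.bdd_mul (c := C') ((hu.comp_fst arc).integrable (by norm_num))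
      hk.aestronglyMeasurable ?_
    have hb1 : ∀ᵐ r ∂((diskMeasure γ).prod arc), r.1 ∈ Metric.ball (0 : ℂ) 1 :=
      Measure.quasiMeasurePreserving_fst.ae (ae_diskMeasure_mem_ball γ)
    have hb2 : ∀ᵐ r ∂((diskMeasure γ).prod arc), ‖r.2‖ = 1 :=
      Measure.quasiMeasurePreserving_snd.ae ae_arc_norm
    filter_upwards [hb1, hb2] with r h1 h2
    rw [RCLike.norm_conj, norm_mul, norm_zpow, h2, one_zpow, one_mul]
    refine hC' _ ((Complex.abs_im_le_norm _).trans ?_)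
    rw [norm_mul, RCLike.norm_conj, h2, mul_one]
    exact (mem_ball_zero_iff.1 h1).le
  -- Santaló's formula passes from chords to pairs (z, v): q(sin α) becomes q(Im(z v̄)), and the
  -- inner integral over v is the conjugate of the back-projection.
  have h2 := integral_map (measurePreserving_santalo γ).measurable.aemeasurable
    (μ := (fanMeasure γ).prod (jacobiMeasure γ))
    (f := fun r : ℂ × ℂ => (starRingEnd ℂ) (r.2 ^ j *
      q.eval (((r.1 * (starRingEnd ℂ) r.2).im : ℝ) : ℂ)) * u r.1)
    (by rw [(measurePreserving_santalo γ).map_eq]; exact hF)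
  rw [(measurePreserving_santalo γ).map_eq, integral_prod _ hFint] at h2
  rw [h1]
  simp only [im_chordPoint_mul_conj_direction] at h2
  simp only [fanMode]
  rw [← h2]
  congr 1
  funext z
  rw [integral_mul_const, integral_conj, evalConj_backProjPoly, backProj]

/-! ### The transform of monomials -/

lemma integral_jacobi_odd (n : ℕ) (hn : Odd n) : ∫ x, (x : ℂ) ^ n ∂jacobiMeasure γ = 0 := by
  have h : ∫ x, (x : ℂ) ^ n ∂jacobiMeasure γ = - ∫ x, (x : ℂ) ^ n ∂jacobiMeasure γ := by
    nth_rewrite 1 [jacobiMeasure]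
    rw [jacobiMeasure, integral_withDensity_eq_integral_toReal_smul (by fun_prop) (by simp),
      ← integral_Ioc_eq_integral_Ioo, ← intervalIntegral.integral_of_le (by norm_num),
      ← intervalIntegral.integral_neg]
    have := intervalIntegral.integral_comp_neg (a := -1) (b := 1) (fun x : ℝ =>
      (ENNReal.ofReal ((1 - x ^ 2) ^ γ)).toReal • (x : ℂ) ^ n)
    rw [neg_neg] at this
    rw [← this]
    congr 1
    funext x
    simp [hn.neg_pow]
  exact self_eq_neg.1 h

lemma integrable_jacobi_pow (n : ℕ) : Integrable (fun x : ℝ => (x : ℂ) ^ n) (jacobiMeasure γ) := by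
  refine Integrable.of_bound (Continuous.aestronglyMeasurable (by fun_prop)) 1 ?_
  have : ∀ᵐ x ∂jacobiMeasure γ, x ∈ Set.Ioo (-1 : ℝ) 1 :=
    (withDensity_absolutelyContinuous _ _).ae_le (ae_restrict_mem measurableSet_Ioo)
  filter_upwards [this] with x hx
  rw [norm_pow, Complex.norm_real, Real.norm_eq_abs]
  exact pow_le_one₀ (abs_nonneg x) (abs_le.2 ⟨hx.1.le, hx.2.le⟩)

/-- Expanding both powers gives terms c^{i+k} s^{a+b-i-k} x^{i+k}. The odd moments of x vanish, and
in the other terms c² = 1 - s² leaves a polynomial in s of degree at most a + b. -/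
lemma exists_poly_chord (a b : ℕ) : ∃ q : Polynomial ℂ, q.natDegree ≤ a + b ∧
    ∀ c s : ℝ, c ^ 2 + s ^ 2 = 1 → ∫ x : ℝ, ((c : ℂ) * x + s * Complex.I) ^ a *
      ((c : ℂ) * x - s * Complex.I) ^ b ∂jacobiMeasure γ = q.eval (s : ℂ) := by
  open Polynomial in
  let t : ℕ → ℕ → ℂ[X] := fun i k => if Even (i + k) then
    C ((a.choose i : ℂ) * (b.choose k) * Complex.I ^ (a - i) * (-Complex.I) ^ (b - k) *
      ∫ x, (x : ℂ) ^ (i + k) ∂jacobiMeasure γ) * ((1 - X ^ 2) ^ ((i + k) / 2) *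
        X ^ (a - i + (b - k))) else 0
  refine ⟨∑ i ∈ Finset.range (a + 1), ∑ k ∈ Finset.range (b + 1), t i k, ?_, fun c s hcs => ?_⟩
  · refine Polynomial.natDegree_sum_le_of_forall_le _ _ fun i hi =>
      Polynomial.natDegree_sum_le_of_forall_le _ _ fun k hk => ?_
    rw [Finset.mem_range] at hi hk
    simp only [t]
    split_ifs with h
    · refine (Polynomial.natDegree_C_mul_le _ _).trans (Polynomial.natDegree_mul_le.trans ?_)
      have h1 : ((1 - Polynomial.X ^ 2 : Polynomial ℂ) ^ ((i + k) / 2)).natDegree ≤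
          (i + k) / 2 * 2 := by
        refine Polynomial.natDegree_pow_le.trans (Nat.mul_le_mul_left _ ?_)
        compute_degree
      rw [Polynomial.natDegree_X_pow]
      have h2 := Nat.div_mul_le_self (i + k) 2
      lia
    · simp
  · have hexp : ∀ x : ℝ, ((c : ℂ) * x + s * Complex.I) ^ a * ((c : ℂ) * x - s * Complex.I) ^ b =
        ∑ i ∈ Finset.range (a + 1), ∑ k ∈ Finset.range (b + 1),
          ((a.choose i : ℂ) * (b.choose k) * Complex.I ^ (a - i) * (-Complex.I) ^ (b - k) *
            (c : ℂ) ^ (i + k) * (s : ℂ) ^ (a - i + (b - k))) * (x : ℂ) ^ (i + k) := fun x => by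
      rw [sub_eq_add_neg, ← mul_neg, add_pow, add_pow, Finset.sum_mul_sum]
      refine Finset.sum_congr rfl fun i _ => Finset.sum_congr rfl fun k _ => ?_
      rw [mul_pow, mul_pow, mul_pow, mul_pow]
      ring
    simp_rw [hexp]
    rw [integral_finsetSum _ fun i _ => integrable_finsetSum _ fun k _ =>
      (integrable_jacobi_pow _).const_mul _, Polynomial.eval_finsetSum]
    refine Finset.sum_congr rfl fun i _ => ?_
    rw [integral_finsetSum _ fun k _ => (integrable_jacobi_pow _).const_mul _,
      Polynomial.eval_finsetSum]
    refine Finset.sum_congr rfl fun k _ => ?_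
    rw [integral_const_mul]
    simp only [t]
    split_ifs with h
    · obtain ⟨l, hl⟩ := h
      have hc : (c : ℂ) ^ (i + k) = (1 - (s : ℂ) ^ 2) ^ ((i + k) / 2) := by
        have : (1 - (s : ℂ) ^ 2) = (c : ℂ) ^ 2 := by
          rw [eq_comm, eq_sub_iff_add_eq]; exact_mod_cast hcs
        rw [this, ← pow_mul]
        congr 1
        lia
      rw [hc]
      simp only [Polynomial.eval_mul, Polynomial.eval_C, Polynomial.eval_pow, Polynomial.eval_sub,
        Polynomial.eval_one, Polynomial.eval_X]
      ring
    · rw [integral_jacobi_odd _ (Nat.not_even_iff_odd.1 h)]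
      simp

/-- On a chord z = v (μ x + i sin α) and v̄ = v⁻¹, so z^a z̄^b is v^{a-b} times the integrand of
`exists_poly_chord`. -/
lemma exists_xrayL_zMono (a b : ℕ) : ∃ q : Polynomial ℂ, q.natDegree ≤ a + b ∧
    xrayL γ (polyLp γ (zMono a b)) = fanLp γ ((a : ℤ) - b) q := by
  obtain ⟨q, hq, h⟩ := exists_poly_chord (γ := γ) a b
  refine ⟨q, hq, Lp.ext ?_⟩
  filter_upwards [xrayL_toLp (memLp_evalConj (γ := γ) (zMono a b)),
    xrayFun_ae_eq γ (evalConj (zMono a b)), fanLp_ae_eq (γ := γ) ((a : ℤ) - b) q] with p h1 h2 h3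
  rw [h3, polyLp]
  refine (h1.trans h2).trans ?_
  congr 1
  rw [fanMode, ← h (Real.cos p.2) (Real.sin p.2) (Real.cos_sq_add_sin_sq _), ← integral_const_mul]
  congr 1
  funext x
  have hcd : (starRingEnd ℂ) (direction p) = (direction p)⁻¹ := by
    rw [Complex.inv_def, Complex.normSq_eq_norm_sq, norm_direction]; simp
  rw [evalConj_zMono, chordPoint, map_mul, hcd, mul_pow, mul_pow, zpow_sub₀ (direction_ne_zero p),
    zpow_natCast, zpow_natCast, inv_pow]
  simp only [map_add, map_mul, Complex.conj_ofReal, Complex.conj_I]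
  rw [mul_neg, ← sub_eq_add_neg]
  ring

end Polynomials

end DiskXRay
end

/-! ### Density of polynomials, angular modes, and the weighted Bergman spaces. -/

noncomputable section
namespace DiskXRay

section Bergman

set_option linter.unusedSectionVars false

variable {γ : ℝ} [hγ : Fact (-1 < γ)]

/-! ### Density of polynomials -/

/-- The complex conjugate of a polynomial in `z` and `z̄`. -/
def conjPoly : MvPolynomial (Fin 2) ℂ →+* MvPolynomial (Fin 2) ℂ :=
  (MvPolynomial.rename (R := ℂ) (Equiv.swap (0 : Fin 2) 1)).toRingHom.comp
    (MvPolynomial.map (starRingEnd ℂ))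

@[simp] lemma conjPoly_C (c : ℂ) :
    conjPoly (MvPolynomial.C c) = MvPolynomial.C ((starRingEnd ℂ) c) := by
  simp [conjPoly]

@[simp] lemma conjPoly_X0 : conjPoly (MvPolynomial.X 0) = MvPolynomial.X 1 := by
  simp [conjPoly]

@[simp] lemma conjPoly_X1 : conjPoly (MvPolynomial.X 1) = MvPolynomial.X 0 := by
  simp [conjPoly]

@[simp] lemma conjPoly_zMono (a b : ℕ) : conjPoly (zMono a b) = zMono b a := by
  simp only [zMono, map_mul, map_pow, conjPoly_X0, conjPoly_X1]
  ring

lemma evalConj_conjPoly (P : MvPolynomial (Fin 2) ℂ) (z : ℂ) :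
    evalConj (conjPoly P) z = (starRingEnd ℂ) (evalConj P z) := by
  induction P using MvPolynomial.induction_on with
  | C c => simp
  | add P Q hP hQ => simp [hP, hQ]
  | mul_X P i hP =>
    rw [map_mul, evalConj_mul, evalConj_mul, hP, map_mul]
    fin_cases i <;> simp

/-- Stone-Weierstrass on the closed disk: the star subalgebra generated by the polynomials in z
consists of polynomials in z and z̄. -/
lemma exists_evalConj_near {g : ℂ → ℂ} (hg : Continuous g) {ε : ℝ} (hε : 0 < ε) :
    ∃ P : MvPolynomial (Fin 2) ℂ, ∀ z ∈ Metric.closedBall (0 : ℂ) 1,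
      ‖g z - evalConj P z‖ ≤ ε := by
  let S : Set ℂ := Metric.closedBall 0 1
  have : CompactSpace S := isCompact_iff_compactSpace.1 (isCompact_closedBall 0 1)
  let T : StarSubalgebra ℂ C(S, ℂ) :=
    { carrier := {f | ∃ P : MvPolynomial (Fin 2) ℂ, ∀ z, f z = evalConj P z}
      mul_mem' := fun ⟨P, hP⟩ ⟨Q, hQ⟩ => ⟨P * Q, fun z => by simp [hP, hQ]⟩
      add_mem' := fun ⟨P, hP⟩ ⟨Q, hQ⟩ => ⟨P + Q, fun z => by simp [hP, hQ]⟩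
      algebraMap_mem' := fun c => ⟨MvPolynomial.C c, fun z => by simp⟩
      star_mem' := fun ⟨P, hP⟩ => ⟨conjPoly P, fun z => by
        rw [evalConj_conjPoly, ContinuousMap.star_apply, hP]; rfl⟩ }
  have hT : (polynomialFunctions S).starClosure ≤ T := by
    rw [Subalgebra.starClosure_le_iff]
    rintro f ⟨q, -, rfl⟩
    refine ⟨q.sum fun n c => c • zMono n 0, fun z => ?_⟩
    rw [Polynomial.sum, evalConj_sum]
    simp [Polynomial.eval_eq_sum, Polynomial.sum]
  have hmem : (⟨fun z : S => g z, by fun_prop⟩ : C(S, ℂ)) ∈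
      (polynomialFunctions S).starClosure.topologicalClosure := by
    rw [polynomialFunctions.starClosure_topologicalClosure]
    trivial
  obtain ⟨f, hf, hd⟩ := Metric.mem_closure_iff.1 hmem ε hε
  obtain ⟨P, hP⟩ := hT hf
  refine ⟨P, fun z hz => ?_⟩
  have h1 := (ContinuousMap.dist_apply_le_dist (⟨z, hz⟩ : S)).trans hd.le
  rw [hP, dist_eq_norm] at h1
  exact h1

lemma dense_polyLp : (LinearMap.range (polyLp γ)).topologicalClosure = ⊤ := by
  refine eq_top_iff.2 fun u _ => ?_
  rw [← SetLike.mem_coe, Submodule.topologicalClosure_coe]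
  refine Metric.mem_closure_iff.2 fun ε hε => ?_
  obtain ⟨g, -, hg1, hg2, hg3⟩ := (Lp.memLp u).exists_hasCompactSupport_eLpNorm_sub_le (by simp)
    (ε := ENNReal.ofReal (ε / 3)) (by simpa using hε)
  set m := (diskMeasure γ Set.univ ^ (2 : ENNReal).toReal⁻¹).toReal with hm
  have hm0 : 0 ≤ m := ENNReal.toReal_nonneg
  -- Here m is the square root of the total mass, which compares the uniform norm with the L² norm;
  -- m + 1 keeps the denominator positive.
  obtain ⟨P, hP⟩ := exists_evalConj_near hg2 (ε := ε / (3 * (m + 1))) (by positivity)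
  have h2 : eLpNorm (g - evalConj P) 2 (diskMeasure γ) ≤ ENNReal.ofReal (ε / 3) := by
    refine (eLpNorm_le_of_ae_bound (C := ε / (3 * (m + 1))) ?_).trans ?_
    · filter_upwards [ae_diskMeasure_mem_ball γ] with z hz using
        hP z (Metric.ball_subset_closedBall hz)
    · rw [← ENNReal.ofReal_toReal (a := diskMeasure γ Set.univ ^ (2 : ENNReal).toReal⁻¹)
        (ENNReal.rpow_ne_top_of_nonneg (by positivity) (measure_ne_top _ _)), ← hm,
        ← ENNReal.ofReal_mul hm0]
      refine ENNReal.ofReal_le_ofReal ?_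
      rw [mul_div_assoc', div_le_div_iff₀ (by positivity) (by positivity)]
      nlinarith
  refine ⟨polyLp γ P, ⟨P, rfl⟩, ?_⟩
  have h3 : dist u (hg3.toLp g) ≤ ε / 3 := by
    rw [Lp.dist_def]
    refine ENNReal.toReal_le_of_le_ofReal (by positivity) ((eLpNorm_congr_ae ?_).trans_le hg1)
    filter_upwards [hg3.coeFn_toLp] with z hz
    rw [Pi.sub_apply, Pi.sub_apply, hz]
  have h4 : dist (hg3.toLp g) (polyLp γ P) ≤ ε / 3 := by
    rw [Lp.dist_def]
    refine ENNReal.toReal_le_of_le_ofReal (by positivity) ((eLpNorm_congr_ae ?_).trans_le h2)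
    filter_upwards [hg3.coeFn_toLp, polyLp_ae_eq P] with z hz hz'
    rw [Pi.sub_apply, Pi.sub_apply, hz, hz']
  linarith [dist_triangle u (hg3.toLp g) (polyLp γ P)]

/-! ### Orthogonality of angular modes -/

lemma integral_zMono_eq_zero {μ : Measure ℂ}
    (hμ : ∀ v : ℂ, ‖v‖ = 1 → MeasurePreserving (fun z => v * z) μ μ) {a b : ℕ} (hab : a ≠ b) :
    ∫ z, z ^ a * (starRingEnd ℂ) z ^ b ∂μ = 0 := by
  -- Rotation by this angle multiplies z^a z̄^b by e^{i(a-b)θ} = -1, so the integral equals its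
  -- opposite.
  set θ : ℝ := Real.pi / ((a : ℝ) - b) with hθ
  set v : ℂ := Complex.exp (θ * Complex.I) with hv
  have hv1 : ‖v‖ = 1 := Complex.norm_exp_ofReal_mul_I θ
  have hc : v ^ a * (starRingEnd ℂ) v ^ b = -1 := by
    rw [hv, ← Complex.exp_conj, ← Complex.exp_nat_mul, ← Complex.exp_nat_mul, ← Complex.exp_add,
      ← Complex.exp_pi_mul_I]
    congr 1
    have h1 : ((a : ℂ) - b) ≠ 0 := sub_ne_zero.2 (by exact_mod_cast hab)
    rw [map_mul, Complex.conj_ofReal, Complex.conj_I, hθ]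
    push_cast
    field_simp
    ring
  have h := integral_map (hμ v hv1).measurable.aemeasurable (μ := μ)
    (f := fun z => z ^ a * (starRingEnd ℂ) z ^ b)
    (Continuous.aestronglyMeasurable (by fun_prop))
  rw [(hμ v hv1).map_eq] at h
  have h2 : ∀ z : ℂ, (v * z) ^ a * (starRingEnd ℂ) (v * z) ^ b =
      -1 * (z ^ a * (starRingEnd ℂ) z ^ b) := fun z => by
    rw [← hc, map_mul, mul_pow, mul_pow]; ring
  simp_rw [h2] at h
  rw [integral_const_mul, neg_one_mul] at h
  exact self_eq_neg.1 h

lemma inner_zMono (a b c d : ℕ) : inner ℂ (polyLp γ (zMono a b)) (polyLp γ (zMono c d)) =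
    ∫ z, z ^ (b + c) * (starRingEnd ℂ) z ^ (a + d) ∂diskMeasure γ := by
  rw [inner_eq_integral (polyLp_ae_eq _) (polyLp_ae_eq _)]
  congr 1
  funext z
  simp only [evalConj_zMono, map_mul, map_pow, Complex.conj_conj]
  ring

lemma inner_polyLp_eq_zero {j j' : ℤ} (hj : j ≠ j') {N N' : ℕ} {P Q : MvPolynomial (Fin 2) ℂ}
    (hP : P ∈ modePoly j N) (hQ : Q ∈ modePoly j' N') :
    inner ℂ (polyLp γ P) (polyLp γ Q) = 0 := by
  induction hP using Submodule.span_induction with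
  | mem P hP =>
    obtain ⟨a, b, h1, -, rfl⟩ := hP
    induction hQ using Submodule.span_induction with
    | mem Q hQ =>
      obtain ⟨c, d, h2, -, rfl⟩ := hQ
      rw [inner_zMono]
      exact integral_zMono_eq_zero (fun v hv => measurePreserving_rotation γ hv) (by lia)
    | zero => simp
    | add Q R _ _ hQ hR => rw [map_add, inner_add_right, hQ, hR, add_zero]
    | smul c Q _ hQ => rw [map_smul, inner_smul_right, hQ, mul_zero]
  | zero => simp
  | add P R _ _ hP hR => rw [map_add, inner_add_left, hP, hR, add_zero]
  | smul c P _ hP => rw [map_smul, inner_smul_left, hP, mul_zero]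

/-! ### The Bergman spaces -/

variable (γ) in
/-- The closure of the polynomials in `z`. -/
def bergman : Submodule ℂ (DiskSpace γ) :=
  (Submodule.span ℂ (Set.range fun n => polyLp γ (zMono n 0))).topologicalClosure

variable (γ) in
/-- The closure of the polynomials in `z̄`. -/
def antiBergman : Submodule ℂ (DiskSpace γ) :=
  (Submodule.span ℂ (Set.range fun n => polyLp γ (zMono 0 n))).topologicalClosure

lemma zMono_mem_bergman (n : ℕ) : polyLp γ (zMono n 0) ∈ bergman γ :=
  Submodule.le_topologicalClosure _ (Submodule.subset_span ⟨n, rfl⟩)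

lemma zMono_mem_antiBergman (n : ℕ) : polyLp γ (zMono 0 n) ∈ antiBergman γ :=
  Submodule.le_topologicalClosure _ (Submodule.subset_span ⟨n, rfl⟩)

lemma inner_eq_zero_of_mem_closure {E F : Type*} [NormedAddCommGroup E] [NormedSpace ℂ E]
    [NormedAddCommGroup F] [InnerProductSpace ℂ F] {S : Set E} (L : E →L[ℂ] F) (w : F)
    (h : ∀ x ∈ S, inner ℂ (L x) w = 0) {x : E}
    (hx : x ∈ (Submodule.span ℂ S).topologicalClosure) : inner ℂ (L x) w = 0 := by
  have hle : (Submodule.span ℂ S).topologicalClosure ≤ (ℂ ∙ w)ᗮ.comap L.toLinearMap := by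
    refine Submodule.topologicalClosure_minimal _ (Submodule.span_le.2 fun y hy => ?_) ?_
    · exact Submodule.mem_orthogonal_singleton_iff_inner_left.2 (h y hy)
    · exact (Submodule.isClosed_orthogonal _).preimage L.continuous
  exact Submodule.mem_orthogonal_singleton_iff_inner_left.1 (hle hx)

lemma mem_bergman_orthogonal_iff {u : DiskSpace γ} :
    u ∈ (bergman γ)ᗮ ↔ ∀ n, inner ℂ (polyLp γ (zMono n 0)) u = 0 := by
  refine ⟨fun h n => h _ (zMono_mem_bergman n), fun h x hx => ?_⟩
  exact inner_eq_zero_of_mem_closure (ContinuousLinearMap.id ℂ _) u (by rintro _ ⟨n, rfl⟩; exact h n)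
    hx

lemma mem_antiBergman_orthogonal_iff {u : DiskSpace γ} :
    u ∈ (antiBergman γ)ᗮ ↔ ∀ n, inner ℂ (polyLp γ (zMono 0 n)) u = 0 := by
  refine ⟨fun h n => h _ (zMono_mem_antiBergman n), fun h x hx => ?_⟩
  exact inner_eq_zero_of_mem_closure (ContinuousLinearMap.id ℂ _) u (by rintro _ ⟨n, rfl⟩; exact h n)
    hx

lemma modePoly_eq_bot {j : ℤ} {N : ℕ} (h : (N : ℤ) < |j|) : modePoly j N = ⊥ := by
  refine Submodule.span_eq_bot.2 ?_
  rintro P ⟨a, b, h1, h2, -⟩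
  exfalso
  rcases abs_cases j with h3 | h3 <;> lia

lemma modePoly_eq_span (N : ℕ) : modePoly N N = ℂ ∙ zMono N 0 := by
  unfold modePoly
  congr 1
  ext P
  constructor
  · rintro ⟨a, b, h1, h2, rfl⟩
    obtain rfl : b = 0 := by lia
    obtain rfl : a = N := by lia
    rfl
  · rintro rfl
    exact ⟨N, 0, by simp, by simp, rfl⟩

lemma modePoly_neg_eq_span (N : ℕ) : modePoly (-N) N = ℂ ∙ zMono 0 N := by
  unfold modePoly
  congr 1
  ext P
  constructor
  · rintro ⟨a, b, h1, h2, rfl⟩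
    obtain rfl : a = 0 := by lia
    obtain rfl : b = N := by lia
    rfl
  · rintro rfl
    exact ⟨0, N, by simp, by simp, rfl⟩

/-- The data M^k T z^n have mode n + k but polynomial degree at most n, so their back-projection
would be a polynomial whose angular momentum exceeds its degree: it is zero. Continuity extends this
from the powers of z to the Bergman space. -/
lemma inner_modul_xrayL_bergman {g : DiskSpace γ} (hg : g ∈ bergman γ) {k : ℤ} (hk : 1 ≤ k)
    (f : DiskSpace γ) : inner ℂ (modul γ k (xrayL γ g)) (xrayL γ f) = 0 := by
  refine inner_eq_zero_of_mem_closure ((modul γ k).toContinuousLinearMap.comp (xrayL γ)) _ ?_ hg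
  rintro _ ⟨n, rfl⟩
  obtain ⟨q, hq, h⟩ := exists_xrayL_zMono (γ := γ) n 0
  simp only [ContinuousLinearMap.comp_apply, LinearIsometry.coe_toContinuousLinearMap]
  rw [h, modul_fanLp, inner_fanLp_xrayL]
  have hm := backProjPoly_mem q (k + ((n : ℤ) - (0 : ℕ)))
  rw [modePoly_eq_bot (by rw [abs_of_nonneg] <;> push_cast <;> lia), Submodule.mem_bot] at hm
  rw [hm, map_zero, inner_zero_left]

lemma inner_modul_xrayL_antiBergman {g : DiskSpace γ} (hg : g ∈ antiBergman γ) {k : ℤ}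
    (hk : k ≤ -1) (f : DiskSpace γ) : inner ℂ (modul γ k (xrayL γ g)) (xrayL γ f) = 0 := by
  refine inner_eq_zero_of_mem_closure ((modul γ k).toContinuousLinearMap.comp (xrayL γ)) _ ?_ hg
  rintro _ ⟨n, rfl⟩
  obtain ⟨q, hq, h⟩ := exists_xrayL_zMono (γ := γ) 0 n
  simp only [ContinuousLinearMap.comp_apply, LinearIsometry.coe_toContinuousLinearMap]
  rw [h, modul_fanLp, inner_fanLp_xrayL]
  have hm := backProjPoly_mem q (k + (((0 : ℕ) : ℤ) - n))
  rw [modePoly_eq_bot (by rw [abs_of_nonpos] <;> push_cast <;> lia), Submodule.mem_bot] at hm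
  rw [hm, map_zero, inner_zero_left]

/-- Without a shift of mode the angular momentum equals the degree bound, so the back-projection of
T z^n is a multiple of z^n, to which f is orthogonal. -/
lemma inner_xrayL_bergman {g f : DiskSpace γ} (hg : g ∈ bergman γ) (hf : f ∈ (bergman γ)ᗮ) :
    inner ℂ (xrayL γ g) (xrayL γ f) = 0 := by
  refine inner_eq_zero_of_mem_closure (xrayL γ) _ ?_ hg
  rintro _ ⟨n, rfl⟩
  obtain ⟨q, hq, h⟩ := exists_xrayL_zMono (γ := γ) n 0
  simp only []
  rw [h, inner_fanLp_xrayL]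
  have hm := modePoly_mono _ hq (backProjPoly_mem q ((n : ℤ) - (0 : ℕ)))
  rw [Nat.cast_zero, sub_zero, add_zero, modePoly_eq_span] at hm
  obtain ⟨c, hc⟩ := Submodule.mem_span_singleton.1 hm
  rw [Nat.cast_zero, sub_zero, ← hc, map_smul, inner_smul_left, hf _ (zMono_mem_bergman n), mul_zero]

lemma inner_xrayL_antiBergman {g f : DiskSpace γ} (hg : g ∈ antiBergman γ)
    (hf : f ∈ (antiBergman γ)ᗮ) : inner ℂ (xrayL γ g) (xrayL γ f) = 0 := by
  refine inner_eq_zero_of_mem_closure (xrayL γ) _ ?_ hg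
  rintro _ ⟨n, rfl⟩
  obtain ⟨q, hq, h⟩ := exists_xrayL_zMono (γ := γ) 0 n
  simp only []
  rw [h, inner_fanLp_xrayL]
  have hm := modePoly_mono _ hq (backProjPoly_mem q (((0 : ℕ) : ℤ) - n))
  rw [Nat.cast_zero, zero_sub, zero_add, modePoly_neg_eq_span] at hm
  obtain ⟨c, hc⟩ := Submodule.mem_span_singleton.1 hm
  rw [Nat.cast_zero, zero_sub, ← hc, map_smul, inner_smul_left, hf _ (zMono_mem_antiBergman n),
    mul_zero]

/-! ### Analytic representatives -/

lemma diskMeasure_annulus_pos (γ : ℝ) {r : ℝ} (hr0 : 0 ≤ r) (hr : r < 1) :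
    0 < diskMeasure γ {z | r < ‖z‖} := by
  refine pos_iff_ne_zero.2 fun h => ?_
  have hac : volume.restrict (Metric.ball (0 : ℂ) 1) ≪ diskMeasure γ := by
    rw [diskMeasure_eq_ball]
    refine withDensity_absolutelyContinuous' (by fun_prop) ?_
    filter_upwards [ae_ball_pos] with z hz
    simpa using Real.rpow_pos_of_pos hz _
  have h1 := hac h
  have ho : IsOpen {z : ℂ | r < ‖z‖} := isOpen_lt continuous_const continuous_norm
  rw [Measure.restrict_apply ho.measurableSet] at h1
  refine ((ho.inter Metric.isOpen_ball).measure_pos volume ⟨(((r + 1) / 2 : ℝ) : ℂ), ?_, ?_⟩).ne' h1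
  · rw [Set.mem_ofPred_eq, Complex.norm_real, Real.norm_of_nonneg (by linarith)]; linarith
  · rw [mem_ball_zero_iff, Complex.norm_real, Real.norm_of_nonneg (by linarith)]; linarith

lemma norm_zMono_sq (n : ℕ) :
    ‖polyLp γ (zMono n 0)‖ ^ 2 = ∫ z, ‖z‖ ^ (2 * n) ∂diskMeasure γ := by
  have h : ((‖polyLp γ (zMono n 0)‖ ^ 2 : ℝ) : ℂ) =
      ((∫ z, ‖z‖ ^ (2 * n) ∂diskMeasure γ : ℝ) : ℂ) := by
    rw [Complex.ofReal_pow, ← integral_complex_ofReal]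
    refine (inner_self_eq_norm_sq_to_K (𝕜 := ℂ) (polyLp γ (zMono n 0))).symm.trans ?_
    rw [inner_zMono]
    congr 1
    funext z
    rw [zero_add, add_zero, ← mul_pow, Complex.mul_conj, Complex.normSq_eq_norm_sq]
    push_cast
    ring
  exact_mod_cast h

/-- The annulus r < |z| alone contributes its mass times at least r^{2n}. Lower bounds on the norms
of z^n bound the Taylor coefficients from above. -/
lemma exists_norm_zMono_ge {r : ℝ} (hr0 : 0 ≤ r) (hr : r < 1) :
    ∃ c > 0, ∀ n, c * r ^ n ≤ ‖polyLp γ (zMono n 0)‖ := by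
  set m := (diskMeasure γ).real {z | r < ‖z‖}
  have hm : 0 < m := ENNReal.toReal_pos (diskMeasure_annulus_pos γ hr0 hr).ne' (measure_ne_top _ _)
  refine ⟨Real.sqrt m, Real.sqrt_pos.2 hm, fun n => ?_⟩
  refine (sq_le_sq₀ (by positivity) (norm_nonneg _)).1 ?_
  rw [mul_pow, Real.sq_sqrt hm.le, norm_zMono_sq]
  have hint : Integrable (fun z : ℂ => ‖z‖ ^ (2 * n)) (diskMeasure γ) := by
    refine Integrable.of_bound (Continuous.aestronglyMeasurable (by fun_prop)) 1 ?_
    filter_upwards [ae_diskMeasure_mem_ball γ] with z hz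
    rw [norm_pow, norm_norm]
    exact pow_le_one₀ (norm_nonneg z) (mem_ball_zero_iff.1 hz).le
  have hms : MeasurableSet {z : ℂ | r < ‖z‖} :=
    (isOpen_lt continuous_const continuous_norm).measurableSet
  calc m * (r ^ n) ^ 2 = ∫ z in {z : ℂ | r < ‖z‖}, r ^ (2 * n) ∂diskMeasure γ := by
        rw [setIntegral_const, smul_eq_mul, ← pow_mul, mul_comm n]
    _ ≤ ∫ z in {z : ℂ | r < ‖z‖}, ‖z‖ ^ (2 * n) ∂diskMeasure γ := by
        refine setIntegral_mono_on (integrable_const _) hint.integrableOn hms fun z hz => ?_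
        exact pow_le_pow_left₀ hr0 (le_of_lt hz) _
    _ ≤ ∫ z, ‖z‖ ^ (2 * n) ∂diskMeasure γ :=
        setIntegral_le_integral hint (Eventually.of_forall fun z => by positivity)

lemma norm_zMono_pos (n : ℕ) : 0 < ‖polyLp γ (zMono n 0)‖ := by
  obtain ⟨c, hc, h⟩ := exists_norm_zMono_ge (γ := γ) (r := 1 / 2) (by norm_num) (by norm_num)
  exact lt_of_lt_of_le (by positivity) (h n)

/-- The Taylor coefficients of an element of the Bergman space. -/
def taylorCoeff (n : ℕ) (u : DiskSpace γ) : ℂ :=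
  inner ℂ (polyLp γ (zMono n 0)) u / (‖polyLp γ (zMono n 0)‖ : ℂ) ^ 2

lemma norm_taylorCoeff_le (n : ℕ) (u : DiskSpace γ) :
    ‖taylorCoeff n u‖ ≤ ‖u‖ / ‖polyLp γ (zMono n 0)‖ := by
  have hp := norm_zMono_pos (γ := γ) n
  rw [taylorCoeff, norm_div, norm_pow, Complex.norm_real, norm_norm,
    div_le_div_iff₀ (by positivity) hp]
  have := norm_inner_le_norm (𝕜 := ℂ) (polyLp γ (zMono n 0)) u
  nlinarith

/-- The n-th coefficient is at most ‖u‖ / (c s^n) with s = (r + 1)/2, strictly between r and 1. On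
|z| ≤ r this gives a geometric series of ratio r/s, uniform in z and linear in ‖u‖. -/
lemma exists_summable_bound {r : ℝ} (hr0 : 0 ≤ r) (hr : r < 1) :
    ∃ B : ℕ → ℝ, Summable B ∧ ∀ n (u : DiskSpace γ) (z : ℂ), ‖z‖ ≤ r →
      ‖taylorCoeff n u * z ^ n‖ ≤ ‖u‖ * B n := by
  obtain ⟨c, hc, h⟩ := exists_norm_zMono_ge (γ := γ) (r := (r + 1) / 2) (by linarith) (by linarith)
  have hs0 : 0 < (r + 1) / 2 := by linarith
  refine ⟨fun n => c⁻¹ * (r / ((r + 1) / 2)) ^ n, (summable_geometric_of_lt_one (by positivity)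
    ((div_lt_one hs0).2 (by linarith))).mul_left _, fun n u z hz => ?_⟩
  rw [norm_mul, norm_pow]
  calc ‖taylorCoeff n u‖ * ‖z‖ ^ n ≤ ‖u‖ / (c * ((r + 1) / 2) ^ n) * r ^ n := by
        refine mul_le_mul ((norm_taylorCoeff_le n u).trans ?_)
          (pow_le_pow_left₀ (norm_nonneg z) hz n) (by positivity) (by positivity)
        exact div_le_div_of_nonneg_left (norm_nonneg u) (by positivity) (h n)
    _ = ‖u‖ * (c⁻¹ * (r / ((r + 1) / 2)) ^ n) := by
        generalize (r + 1) / 2 = s at hs0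
        rw [div_pow]
        field_simp

lemma summable_taylor (u : DiskSpace γ) {z : ℂ} (hz : ‖z‖ < 1) :
    Summable fun n => taylorCoeff n u * z ^ n := by
  obtain ⟨B, hB, h⟩ := exists_summable_bound (γ := γ) (norm_nonneg z) hz
  exact Summable.of_norm_bounded (hB.mul_left ‖u‖) fun n => h n u z le_rfl

lemma taylorCoeff_zMono (n m : ℕ) :
    taylorCoeff n (polyLp γ (zMono m 0)) = if n = m then 1 else 0 := by
  rw [taylorCoeff]
  split_ifs with h
  · subst h
    rw [inner_self_eq_norm_sq_to_K]
    exact div_self (pow_ne_zero 2 (Complex.ofReal_ne_zero.2 (norm_zMono_pos (γ := γ) n).ne'))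
  · rw [inner_zMono, integral_zMono_eq_zero (fun v hv => measurePreserving_rotation γ hv) (by lia),
      zero_div]

lemma evalConj_eq_tsum {P : MvPolynomial (Fin 2) ℂ}
    (hP : P ∈ Submodule.span ℂ (Set.range fun n => zMono n 0)) {z : ℂ} :
    HasSum (fun n => taylorCoeff n (polyLp γ P) * z ^ n) (evalConj P z) := by
  induction hP using Submodule.span_induction with
  | mem P hP =>
    obtain ⟨m, rfl⟩ := hP
    simp only [taylorCoeff_zMono]
    convert hasSum_single m ?_ using 1
    · simp
    · intro n hn
      simp [hn]
  | zero => simp [taylorCoeff]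
  | add P Q _ _ hP hQ =>
    rw [evalConj_add]
    convert hP.add hQ using 2 with n
    simp only [taylorCoeff, map_add, inner_add_right]
    ring
  | smul c P _ hP =>
    rw [evalConj_smul]
    have e : (fun n => taylorCoeff n (polyLp γ (c • P)) * z ^ n) =
        fun n => c * (taylorCoeff n (polyLp γ P) * z ^ n) := by
      funext n
      simp only [taylorCoeff, map_smul, inner_smul_right]
      ring
    rw [e]
    exact hP.mul_left c

/-- Elements of the closure of the polynomials in `z` have analytic representatives. -/
lemma exists_analytic_of_mem_bergman {u : DiskSpace γ} (hu : u ∈ bergman γ) :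
    ∃ f : ℂ → ℂ, DifferentiableOn ℂ f (Metric.ball 0 1) ∧ u =ᵐ[diskMeasure γ] f := by
  refine ⟨fun z => ∑' n, taylorCoeff n u * z ^ n, ?_, ?_⟩
  · intro z hz
    rw [mem_ball_zero_iff] at hz
    obtain ⟨r, hzr, hr1⟩ := exists_between hz
    obtain ⟨B, hB, h⟩ := exists_summable_bound (γ := γ) ((norm_nonneg z).trans hzr.le) hr1
    have hd : DifferentiableOn ℂ (fun z => ∑' n, taylorCoeff n u * z ^ n) (Metric.ball 0 r) :=
      Complex.differentiableOn_tsum_of_summable_norm (hB.mul_left ‖u‖)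
        (fun n => by fun_prop) Metric.isOpen_ball
        fun n w hw => h n u w (mem_ball_zero_iff.1 hw).le
    exact (hd.differentiableAt (Metric.isOpen_ball.mem_nhds
      (mem_ball_zero_iff.2 hzr))).differentiableWithinAt
  · rw [bergman, ← SetLike.mem_coe, Submodule.topologicalClosure_coe,
      mem_closure_iff_seq_limit] at hu
    obtain ⟨x, hx, hlim⟩ := hu
    have hx' : ∀ k, ∃ P ∈ Submodule.span ℂ (Set.range fun n => zMono n 0), polyLp γ P = x k := by
      intro k
      have h1 := hx k
      rw [SetLike.mem_coe, show (Set.range fun n => polyLp γ (zMono n 0)) =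
        polyLp γ '' (Set.range fun n => zMono n 0) from by rw [← Set.range_comp]; rfl,
        ← Submodule.map_span] at h1
      exact h1
    choose P hP hPx using hx'
    -- L² convergence yields convergence almost everywhere along a subsequence, while the
    -- coefficient bounds yield convergence to the Taylor series at every point of the open disk;
    -- the two limits coincide.
    obtain ⟨ns, hns, hae⟩ := (tendstoInMeasure_of_tendsto_Lp hlim).exists_seq_tendsto_ae
    have hev : ∀ᵐ z ∂diskMeasure γ, ∀ k, x k z = evalConj (P k) z := by
      rw [ae_all_iff]
      intro k
      rw [← hPx]
      exact polyLp_ae_eq (P k)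
    filter_upwards [hae, hev, ae_diskMeasure_mem_ball γ] with z h1 h2 hz
    rw [mem_ball_zero_iff] at hz
    refine tendsto_nhds_unique h1 (Tendsto.comp (g := fun k => x k z) ?_ hns.tendsto_atTop)
    obtain ⟨B, hB, h⟩ := exists_summable_bound (γ := γ) (norm_nonneg z) hz
    rw [tendsto_iff_norm_sub_tendsto_zero]
    have hnorm := (tendsto_iff_norm_sub_tendsto_zero.1 hlim).mul_const (∑' n, B n)
    rw [zero_mul] at hnorm
    refine squeeze_zero (fun _ => norm_nonneg _) (fun k => ?_) hnorm
    rw [h2, ← (evalConj_eq_tsum (γ := γ) (hP k) (z := z)).tsum_eq, hPx,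
      ← (summable_taylor _ hz).tsum_sub (summable_taylor _ hz), ← tsum_mul_left]
    refine tsum_of_norm_bounded (hB.mul_left _).hasSum fun n => ?_
    have h3 : taylorCoeff n (x k) * z ^ n - taylorCoeff n u * z ^ n =
        taylorCoeff n (x k - u) * z ^ n := by
      rw [taylorCoeff, taylorCoeff, taylorCoeff, inner_sub_right]; ring
    rw [h3]
    exact h n _ z le_rfl

/-- On a disk of radius ρ < 1 the Taylor series can be integrated term by term against z̄^n, and
rotation invariance keeps only its n-th term. Letting ρ tend to 1 gives 0 = ⟨z^n, f⟩ = a_n ‖z^n‖².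
-/
lemma eq_zero_of_analytic_of_orthogonal {f : ℂ → ℂ} (hf : MemLp f 2 (diskMeasure γ))
    (hd : DifferentiableOn ℂ f (Metric.ball 0 1))
    (h0 : ∀ n, inner ℂ (polyLp γ (zMono n 0)) (hf.toLp f) = 0) : f =ᵐ[diskMeasure γ] 0 := by
  set a : ℕ → ℂ := fun n => (n.factorial : ℂ)⁻¹ * iteratedDeriv n f 0 with ha
  have hsum : ∀ z ∈ Metric.ball (0 : ℂ) 1, HasSum (fun n => a n * z ^ n) (f z) := fun z hz => by
    have := Complex.hasSum_taylorSeries_on_ball hd hz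
    simp only [sub_zero, smul_eq_mul] at this
    have e : (fun n => a n * z ^ n) =
        fun n => (n.factorial : ℂ)⁻¹ * (z ^ n * iteratedDeriv n f 0) := by
      funext n
      simp only [ha]
      ring
    rw [e]
    exact this
  clear_value a
  suffices h : ∀ n, a n = 0 by
    filter_upwards [ae_diskMeasure_mem_ball γ] with z hz
    have := hsum z hz
    simp only [h, zero_mul] at this
    exact this.unique hasSum_zero
  intro n
  have hball : ∀ ρ : ℝ, 0 < ρ → ρ < 1 →
      ∫ z in Metric.ball (0 : ℂ) ρ, (starRingEnd ℂ) (z ^ n) * f z ∂diskMeasure γ =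
        a n * ∫ z in Metric.ball (0 : ℂ) ρ, z ^ n * (starRingEnd ℂ) z ^ n ∂diskMeasure γ := by
    intro ρ hρ0 hρ
    have hrot : ∀ v : ℂ, ‖v‖ = 1 → MeasurePreserving (fun z => v * z)
        ((diskMeasure γ).restrict (Metric.ball 0 ρ))
        ((diskMeasure γ).restrict (Metric.ball 0 ρ)) := fun v hv => by
      have := (measurePreserving_rotation γ hv).restrict_preimage
        (s := Metric.ball (0 : ℂ) ρ) measurableSet_ball
      have hpre : (fun z : ℂ => v * z) ⁻¹' Metric.ball 0 ρ = Metric.ball 0 ρ := by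
        ext z; simp [hv]
      rwa [hpre] at this
    have hbd : ∀ (m : ℕ) (z : ℂ), z ∈ Metric.ball (0 : ℂ) ρ →
        ‖a m * (z ^ m * (starRingEnd ℂ) z ^ n)‖ ≤ ‖a m * (ρ : ℂ) ^ m‖ := fun m z hz => by
      rw [mem_ball_zero_iff] at hz
      rw [norm_mul, norm_mul, norm_mul, norm_pow, norm_pow, norm_pow, RCLike.norm_conj,
        Complex.norm_real, Real.norm_of_nonneg hρ0.le]
      refine mul_le_mul_of_nonneg_left ?_ (norm_nonneg _)
      calc ‖z‖ ^ m * ‖z‖ ^ n ≤ ρ ^ m * 1 := mul_le_mul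
            (pow_le_pow_left₀ (norm_nonneg z) hz.le m)
            (pow_le_one₀ (norm_nonneg z) (hz.le.trans hρ.le)) (by positivity) (by positivity)
        _ = ρ ^ m := mul_one _
    have hbd' : ∀ m : ℕ, ∀ᵐ z ∂(diskMeasure γ).restrict (Metric.ball 0 ρ),
        ‖a m * (z ^ m * (starRingEnd ℂ) z ^ n)‖ ≤ ‖a m * (ρ : ℂ) ^ m‖ := fun m =>
      (ae_restrict_iff' measurableSet_ball).2 (Eventually.of_forall fun z hz => hbd m z hz)
    have hint : ∀ m, Integrable (fun z : ℂ => a m * (z ^ m * (starRingEnd ℂ) z ^ n))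
        ((diskMeasure γ).restrict (Metric.ball 0 ρ)) := fun m =>
      Integrable.of_bound (Continuous.aestronglyMeasurable (by fun_prop)) _ (hbd' m)
    have hsumρ : Summable fun m => ‖a m * (ρ : ℂ) ^ m‖ :=
      (hsum (ρ : ℂ) (by rw [mem_ball_zero_iff, Complex.norm_real,
        Real.norm_of_nonneg hρ0.le]; exact hρ)).summable.norm
    have hs := hasSum_integral_of_summable_integral_norm hint (by
      refine Summable.of_nonneg_of_le (fun m => integral_nonneg fun z => norm_nonneg _)
        (fun m => ?_) (hsumρ.mul_right ((diskMeasure γ).real (Metric.ball 0 ρ)))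
      refine (integral_mono_ae (hint m).norm (integrable_const _) (hbd' m)).trans_eq ?_
      rw [integral_const, smul_eq_mul, measureReal_restrict_apply_univ, mul_comm])
    have hs2 : ∫ z in Metric.ball (0 : ℂ) ρ, ∑' m, a m * (z ^ m * (starRingEnd ℂ) z ^ n)
        ∂diskMeasure γ =
        ∫ z in Metric.ball (0 : ℂ) ρ, (starRingEnd ℂ) (z ^ n) * f z ∂diskMeasure γ := by
      refine setIntegral_congr_fun measurableSet_ball fun z hz => ?_
      have h1 := (hsum z (Metric.ball_subset_ball hρ.le hz)).mul_right ((starRingEnd ℂ) z ^ n)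
      simp only [mul_assoc] at h1
      rw [h1.tsum_eq, map_pow, mul_comm]
    rw [hs2] at hs
    rw [hs.unique (hasSum_single n fun m hm => ?_), integral_const_mul]
    rw [integral_const_mul, integral_zMono_eq_zero hrot hm, mul_zero]
  -- Radii increasing to 1; the shift by 2 makes the one at k = 0 positive already.
  set ρ : ℕ → ℝ := fun k => 1 - 1 / ((k : ℝ) + 2) with hρ
  have hρ0 : ∀ k, 0 < ρ k := fun k => by
    rw [hρ]; simp only [sub_pos]; rw [div_lt_one (by positivity)]; linarith [Nat.cast_nonneg (α := ℝ) k]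
  have hρ1 : ∀ k, ρ k < 1 := fun k => by
    rw [hρ]; simp only [sub_lt_self_iff]; positivity
  have hmono : Monotone fun k => Metric.ball (0 : ℂ) (ρ k) := fun k l hkl => by
    refine Metric.ball_subset_ball (sub_le_sub_left ?_ _)
    exact one_div_le_one_div_of_le (by positivity) (by gcongr)
  have hU : ⋃ k, Metric.ball (0 : ℂ) (ρ k) = Metric.ball 0 1 := by
    ext z
    rw [Set.mem_iUnion]
    refine ⟨fun ⟨k, hk⟩ => Metric.ball_subset_ball (hρ1 k).le hk, fun hz => ?_⟩
    rw [mem_ball_zero_iff] at hz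
    have hlim : Tendsto ρ atTop (𝓝 1) := by
      have := (tendsto_one_div_add_atTop_nhds_zero_nat (𝕜 := ℝ)).comp (tendsto_add_atTop_nat 1)
      have h2 := this.const_sub 1
      rw [sub_zero] at h2
      refine h2.congr fun k => ?_
      rw [hρ]
      simp only [Function.comp_apply]
      push_cast
      ring_nf
    obtain ⟨k, hk⟩ := (hlim.eventually (lt_mem_nhds hz)).exists
    exact ⟨k, mem_ball_zero_iff.2 hk⟩
  have hres : (diskMeasure γ).restrict (Metric.ball 0 1) = diskMeasure γ :=
    Measure.restrict_eq_self_of_ae_mem (ae_diskMeasure_mem_ball γ)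
  have hi1 : Integrable (fun z => (starRingEnd ℂ) (z ^ n) * f z) (diskMeasure γ) := by
    have h1 : MemLp (fun z : ℂ => (starRingEnd ℂ) (z ^ n)) 2 (diskMeasure γ) :=
      memLp_of_continuous (by fun_prop)
    exact h1.integrable_mul hf
  have hi2 : Integrable (fun z : ℂ => z ^ n * (starRingEnd ℂ) z ^ n) (diskMeasure γ) :=
    (memLp_of_continuous (by fun_prop)).integrable (by norm_num : (1 : ENNReal) ≤ 2)
  have hl1 := tendsto_setIntegral_of_monotone (fun k => measurableSet_ball) hmono hi1.integrableOn
  have hl2 := tendsto_setIntegral_of_monotone (fun k => measurableSet_ball) hmono hi2.integrableOn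
  rw [hU, hres] at hl1 hl2
  have heq := tendsto_nhds_unique (hl1.congr fun k => hball _ (hρ0 k) (hρ1 k)) (hl2.const_mul (a n))
  have h1 := h0 n
  rw [inner_eq_integral (polyLp_ae_eq _) hf.coeFn_toLp] at h1
  simp only [evalConj_zMono, pow_zero, mul_one] at h1
  rw [h1] at heq
  have h2 := inner_zMono (γ := γ) n 0 n 0
  rw [zero_add, add_zero] at h2
  rw [← h2, inner_self_eq_norm_sq_to_K] at heq
  refine (mul_eq_zero.1 heq.symm).resolve_right (pow_ne_zero 2 ?_)
  exact Complex.ofReal_ne_zero.2 (norm_zMono_pos (γ := γ) n).ne'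

/-- Square integrable analytic functions belong to the closure of the polynomials in `z`. -/
lemma toLp_mem_bergman {f : ℂ → ℂ} (hf : MemLp f 2 (diskMeasure γ))
    (hd : DifferentiableOn ℂ f (Metric.ball 0 1)) : hf.toLp f ∈ bergman γ := by
  have : CompleteSpace (bergman γ) := (Submodule.isClosed_topologicalClosure _).completeSpace_coe
  -- The orthogonal component w is a difference of two functions with analytic representatives,
  -- hence has one itself, and analytic functions orthogonal to all z^n vanish.
  obtain ⟨y, hy, w, hw, hyw⟩ := (bergman γ).exists_add_mem_mem_orthogonal (hf.toLp f)
  obtain ⟨g, hg, hyg⟩ := exists_analytic_of_mem_bergman hy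
  have hgm : MemLp g 2 (diskMeasure γ) := (memLp_congr_ae hyg).1 (Lp.memLp y)
  have hw' : (hf.sub hgm).toLp _ = w := by
    rw [MemLp.toLp_sub hf hgm, hyw, ← (MemLp.toLp_eq_toLp_iff (Lp.memLp y) hgm).2 hyg, Lp.toLp_coeFn]
    simp
  have h0 := eq_zero_of_analytic_of_orthogonal (hf.sub hgm) (hd.sub hg)
    (by rw [hw']; exact mem_bergman_orthogonal_iff.1 hw)
  have : w = 0 := by
    rw [← hw', Lp.eq_zero_iff_ae_eq_zero]
    exact (MemLp.coeFn_toLp _).trans h0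
  rw [hyw, this, add_zero]
  exact hy

/-! ### Conjugation -/

variable (γ) in
/-- Complex conjugation on `L²_γ`. -/
def conjLp : DiskSpace γ →L[ℝ] DiskSpace γ :=
  (Complex.conjCLE : ℂ →L[ℝ] ℂ).compLpL 2 (diskMeasure γ)

lemma conjLp_ae_eq (u : DiskSpace γ) :
    conjLp γ u =ᵐ[diskMeasure γ] fun z => (starRingEnd ℂ) (u z) :=
  ContinuousLinearMap.coeFn_compLpL _ u

lemma conjLp_toLp {f : ℂ → ℂ} (hf : MemLp f 2 (diskMeasure γ)) :
    conjLp γ (hf.toLp f) = (MemLp.star hf).toLp (star f) := by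
  refine Lp.ext ?_
  filter_upwards [conjLp_ae_eq (hf.toLp f), hf.coeFn_toLp, (MemLp.star hf).coeFn_toLp]
    with z h1 h2 h3
  rw [h1, h2, h3]
  rfl

lemma conjLp_conjLp (u : DiskSpace γ) : conjLp γ (conjLp γ u) = u := by
  refine Lp.ext ?_
  filter_upwards [conjLp_ae_eq (conjLp γ u), conjLp_ae_eq u] with z h1 h2
  rw [h1, h2, Complex.conj_conj]

lemma conjLp_polyLp (P : MvPolynomial (Fin 2) ℂ) :
    conjLp γ (polyLp γ P) = polyLp γ (conjPoly P) := by
  refine Lp.ext ?_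
  filter_upwards [conjLp_ae_eq (polyLp γ P), polyLp_ae_eq (γ := γ) P,
    polyLp_ae_eq (γ := γ) (conjPoly P)] with z h1 h2 h3
  rw [h1, h2, h3, evalConj_conjPoly]

lemma conjLp_smul (c : ℂ) (u : DiskSpace γ) :
    conjLp γ (c • u) = (starRingEnd ℂ) c • conjLp γ u := by
  refine Lp.ext ?_
  filter_upwards [conjLp_ae_eq (c • u), conjLp_ae_eq u, Lp.coeFn_smul c u,
    Lp.coeFn_smul ((starRingEnd ℂ) c) (conjLp γ u)] with z h1 h2 h3 h4
  rw [h1, h3, h4, Pi.smul_apply, Pi.smul_apply, h2, smul_eq_mul, smul_eq_mul, map_mul]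

lemma conjLp_mem_closure {P Q : ℕ → MvPolynomial (Fin 2) ℂ} (h : ∀ n, conjPoly (P n) = Q n)
    {u : DiskSpace γ}
    (hu : u ∈ (Submodule.span ℂ (Set.range fun n => polyLp γ (P n))).topologicalClosure) :
    conjLp γ u ∈ (Submodule.span ℂ (Set.range fun n => polyLp γ (Q n))).topologicalClosure := by
  rw [← SetLike.mem_coe, Submodule.topologicalClosure_coe] at hu ⊢
  refine map_mem_closure (conjLp γ).continuous hu fun x hx => ?_
  rw [SetLike.mem_coe] at hx ⊢
  induction hx using Submodule.span_induction with
  | mem x hx =>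
    obtain ⟨n, rfl⟩ := hx
    refine Submodule.subset_span ⟨n, ?_⟩
    simp only [conjLp_polyLp, h]
  | zero => rw [map_zero]; exact Submodule.zero_mem _
  | add x y _ _ hx hy => rw [map_add]; exact Submodule.add_mem _ hx hy
  | smul c x _ hx => rw [conjLp_smul]; exact Submodule.smul_mem _ _ hx

lemma conjLp_mem_antiBergman {u : DiskSpace γ} (hu : u ∈ bergman γ) : conjLp γ u ∈ antiBergman γ :=
  conjLp_mem_closure (fun n => conjPoly_zMono n 0) hu

lemma conjLp_mem_bergman {u : DiskSpace γ} (hu : u ∈ antiBergman γ) : conjLp γ u ∈ bergman γ :=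
  conjLp_mem_closure (fun n => conjPoly_zMono 0 n) hu

lemma exists_antianalytic_of_mem_antiBergman {u : DiskSpace γ} (hu : u ∈ antiBergman γ) :
    ∃ f : ℂ → ℂ, DifferentiableOn ℂ (fun z => (starRingEnd ℂ) (f z)) (Metric.ball 0 1) ∧
      u =ᵐ[diskMeasure γ] f := by
  obtain ⟨f, hf, h⟩ := exists_analytic_of_mem_bergman (conjLp_mem_bergman hu)
  refine ⟨fun z => (starRingEnd ℂ) (f z), by simpa using hf, ?_⟩
  filter_upwards [h, conjLp_ae_eq u] with z h1 h2
  rw [← h1, h2, Complex.conj_conj]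

lemma toLp_mem_antiBergman {f : ℂ → ℂ} (hf : MemLp f 2 (diskMeasure γ))
    (hd : DifferentiableOn ℂ (fun z => (starRingEnd ℂ) (f z)) (Metric.ball 0 1)) :
    hf.toLp f ∈ antiBergman γ := by
  have h := conjLp_mem_antiBergman (toLp_mem_bergman (MemLp.star hf) hd)
  rwa [← conjLp_toLp, conjLp_conjLp] at h

end Bergman

end DiskXRay
end

/-! ### Weighted gradients of the functions d^{γ+1} P. -/

noncomputable section
namespace DiskXRay

section Sobolev

set_option linter.unusedSectionVars false

/-! ### Differential operators on polynomials -/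

lemma pderiv_comm (P : MvPolynomial (Fin 2) ℂ) :
    MvPolynomial.pderiv 0 (MvPolynomial.pderiv 1 P) =
      MvPolynomial.pderiv 1 (MvPolynomial.pderiv 0 P) := by
  have h : ⁅MvPolynomial.pderiv (R := ℂ) (0 : Fin 2), MvPolynomial.pderiv (R := ℂ) (1 : Fin 2)⁆ = 0 := by
    refine MvPolynomial.derivation_ext fun i => ?_
    rw [Derivation.commutator_apply]
    fin_cases i <;> simp [MvPolynomial.pderiv_X]
  have h2 := congrArg (fun D => D P) h
  simp only [Derivation.commutator_apply, Derivation.zero_apply] at h2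
  exact sub_eq_zero.1 h2

/-- The weight `1 - z z̄` as a polynomial. -/
def weightPoly : MvPolynomial (Fin 2) ℂ := 1 - MvPolynomial.X 0 * MvPolynomial.X 1

/-- The operator `P ↦ d^{-γ} ∂(d^{γ+1} P)`. -/
def wirtPoly (γ : ℝ) (P : MvPolynomial (Fin 2) ℂ) : MvPolynomial (Fin 2) ℂ :=
  weightPoly * MvPolynomial.pderiv 0 P - MvPolynomial.C (γ + 1 : ℂ) * (MvPolynomial.X 1 * P)

/-- The operator `P ↦ d^{-γ} ∂̄(d^{γ+1} P)`. -/
def wirtBarPoly (γ : ℝ) (P : MvPolynomial (Fin 2) ℂ) : MvPolynomial (Fin 2) ℂ :=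
  weightPoly * MvPolynomial.pderiv 1 P - MvPolynomial.C (γ + 1 : ℂ) * (MvPolynomial.X 0 * P)

/-- The real linear map `w ↦ a w + b w̄`. -/
def wirt (a b : ℂ) : ℂ →L[ℝ] ℂ :=
  ContinuousLinearMap.mul ℝ ℂ a + (ContinuousLinearMap.mul ℝ ℂ b).comp (Complex.conjCLE : ℂ →L[ℝ] ℂ)

@[simp] lemma wirt_apply (a b w : ℂ) : wirt a b w = a * w + b * (starRingEnd ℂ) w := rfl

lemma hasFDerivAt_evalConj (P : MvPolynomial (Fin 2) ℂ) (z : ℂ) :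
    HasFDerivAt (evalConj P) (wirt (evalConj (MvPolynomial.pderiv 0 P) z)
      (evalConj (MvPolynomial.pderiv 1 P) z)) z := by
  induction P using MvPolynomial.induction_on with
  | C c =>
    have h1 : evalConj (MvPolynomial.C c) = fun _ => c := funext fun z => evalConj_C c z
    rw [h1]
    refine (hasFDerivAt_const c z).congr_fderiv ?_
    ext w; simp
  | add P Q hP hQ =>
    have h1 : evalConj (P + Q) = evalConj P + evalConj Q := funext fun z => evalConj_add P Q z
    rw [h1]
    refine (hP.add hQ).congr_fderiv ?_
    ext w <;> simp <;> ring
  | mul_X P i hP =>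
    have hX : HasFDerivAt (evalConj (MvPolynomial.X i))
        (wirt (evalConj (MvPolynomial.pderiv 0 (MvPolynomial.X i)) z)
          (evalConj (MvPolynomial.pderiv 1 (MvPolynomial.X i)) z)) z := by
      fin_cases i
      · have h1 : evalConj (MvPolynomial.X 0) = id := funext fun z => evalConj_X0 z
        simp only [Fin.zero_eta]
        rw [h1]
        refine (hasFDerivAt_id z).congr_fderiv ?_
        ext w <;> simp [MvPolynomial.pderiv_X]
      · have h1 : evalConj (MvPolynomial.X 1) = (Complex.conjCLE : ℂ →L[ℝ] ℂ) :=
          funext fun z => evalConj_X1 z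
        simp only [Fin.mk_one]
        rw [h1]
        refine ((Complex.conjCLE : ℂ →L[ℝ] ℂ).hasFDerivAt).congr_fderiv ?_
        ext w <;> simp [MvPolynomial.pderiv_X]
    have h1 : evalConj (P * MvPolynomial.X i) = evalConj P * evalConj (MvPolynomial.X i) :=
      funext fun z => evalConj_mul P _ z
    rw [h1]
    refine (hP.mul hX).congr_fderiv (ContinuousLinearMap.ext fun w => ?_)
    simp only [_root_.add_apply, _root_.smul_apply, wirt_apply,
      smul_eq_mul, Derivation.leibniz, evalConj_add, evalConj_mul]
    ring

lemma hasFDerivAt_weight (z : ℂ) :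
    HasFDerivAt (fun z : ℂ => 1 - ‖z‖ ^ 2) (-(2 • (innerSL ℝ z))) z := by
  have h := ((hasFDerivAt_id (𝕜 := ℝ) z).norm_sq).const_sub 1
  simpa using h

lemma ofReal_inner_eq (z w : ℂ) :
    ((2 * inner ℝ z w : ℝ) : ℂ) = (starRingEnd ℂ) z * w + z * (starRingEnd ℂ) w := by
  rw [Complex.inner]
  apply Complex.ext <;> simp <;> ring

lemma evalConj_weightPoly (z : ℂ) : evalConj weightPoly z = ((1 - ‖z‖ ^ 2 : ℝ) : ℂ) := by
  rw [weightPoly, evalConj_sub, evalConj_one, evalConj_mul, evalConj_X0, evalConj_X1,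
    Complex.mul_conj, Complex.normSq_eq_norm_sq]
  push_cast
  ring

lemma hasFDerivAt_weight_mul (γ : ℝ) (P : MvPolynomial (Fin 2) ℂ) {z : ℂ}
    (hz : z ∈ Metric.ball (0 : ℂ) 1) :
    HasFDerivAt (fun z => (((1 - ‖z‖ ^ 2) ^ (γ + 1) : ℝ) : ℂ) * evalConj P z)
      ((((1 - ‖z‖ ^ 2) ^ γ : ℝ) : ℂ) • wirt (evalConj (wirtPoly γ P) z)
        (evalConj (wirtBarPoly γ P) z)) z := by
  have hd := weight_pos hz
  have h1 := (hasFDerivAt_weight z).rpow_const (p := γ + 1) (Or.inl hd.ne')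
  have h2 := (Complex.ofRealCLM.hasFDerivAt (x := (1 - ‖z‖ ^ 2) ^ (γ + 1))).comp z h1
  refine (h2.mul (hasFDerivAt_evalConj P z)).congr_fderiv (ContinuousLinearMap.ext fun w => ?_)
  have hi := ofReal_inner_eq z w
  have hp : (((1 - ‖z‖ ^ 2) ^ (γ + 1) : ℝ) : ℂ) =
      (((1 - ‖z‖ ^ 2) ^ γ : ℝ) : ℂ) * evalConj weightPoly z := by
    rw [evalConj_weightPoly, ← Complex.ofReal_mul, Real.rpow_add hd, Real.rpow_one]
  simp only [_root_.add_apply, _root_.smul_apply, wirt_apply,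
    ContinuousLinearMap.comp_apply, Complex.ofRealCLM_apply, _root_.neg_apply,
    smul_eq_mul, innerSL_apply_apply, Function.comp_apply, wirtPoly, wirtBarPoly, evalConj_sub,
    evalConj_mul, evalConj_C, evalConj_X0, evalConj_X1, hp, add_sub_cancel_right, nsmul_eq_mul]
  have h3 : ((((γ + 1) * (1 - ‖z‖ ^ 2) ^ γ * -(((2 : ℕ) : ℝ) * inner ℝ z w) : ℝ)) : ℂ) =
      -((γ + 1 : ℂ) * (((1 - ‖z‖ ^ 2) ^ γ : ℝ) : ℂ) *
        ((starRingEnd ℂ) z * w + z * (starRingEnd ℂ) w)) := by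
    rw [← hi]
    push_cast
    ring
  rw [h3]
  ring

/-! ### Cutoffs -/

lemma deriv_smoothTransition_of_one_lt {x : ℝ} (hx : 1 < x) : deriv Real.smoothTransition x = 0 := by
  have : Real.smoothTransition =ᶠ[𝓝 x] fun _ => 1 := by
    filter_upwards [lt_mem_nhds hx] with y hy using Real.smoothTransition.one_of_one_le hy.le
  rw [this.deriv_eq, deriv_const]

lemma deriv_smoothTransition_of_neg {x : ℝ} (hx : x < 0) : deriv Real.smoothTransition x = 0 := by
  have : Real.smoothTransition =ᶠ[𝓝 x] fun _ => 0 := by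
    filter_upwards [gt_mem_nhds hx] with y hy using Real.smoothTransition.zero_of_nonpos hy.le
  rw [this.deriv_eq, deriv_const]

lemma exists_deriv_smoothTransition_bound :
    ∃ M : ℝ, 0 ≤ M ∧ ∀ x, |deriv Real.smoothTransition x| ≤ M := by
  have hc : Continuous (deriv Real.smoothTransition) :=
    (Real.smoothTransition.contDiff (n := 1)).continuous_deriv le_rfl
  obtain ⟨M, hM⟩ := (isCompact_Icc (a := (0 : ℝ)) (b := 1)).exists_bound_of_continuousOn
    hc.continuousOn
  have hM0 : 0 ≤ M := (norm_nonneg _).trans (hM 0 ⟨le_rfl, zero_le_one⟩)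
  refine ⟨M, hM0, fun x => ?_⟩
  rcases lt_or_ge x 0 with h | h
  · rw [deriv_smoothTransition_of_neg h, abs_zero]; exact hM0
  rcases lt_or_ge 1 x with h1 | h1
  · rw [deriv_smoothTransition_of_one_lt h1, abs_zero]; exact hM0
  exact hM x ⟨h, h1⟩

/-- A smooth cutoff, equal to one where `n d ≥ 2` and to zero where `n d ≤ 1`. -/
def cutoff (n : ℝ) (z : ℂ) : ℝ := Real.smoothTransition (n * (1 - ‖z‖ ^ 2) - 1)

lemma contDiff_cutoff (n : ℝ) : ContDiff ℝ ∞ (cutoff n) :=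
  Real.smoothTransition.contDiff.comp (((contDiff_const.sub (contDiff_norm_sq ℝ)).const_smul n).sub
    contDiff_const)

lemma hasFDerivAt_cutoff (n : ℝ) (z : ℂ) : HasFDerivAt (cutoff n)
    ((deriv Real.smoothTransition (n * (1 - ‖z‖ ^ 2) - 1) * n) • (-(2 • (innerSL ℝ z)) : ℂ →L[ℝ] ℝ)) z := by
  have h1 := ((hasFDerivAt_weight z).const_mul n).sub_const 1
  have h2 : HasDerivAt Real.smoothTransition (deriv Real.smoothTransition (n * (1 - ‖z‖ ^ 2) - 1))
      (n * (1 - ‖z‖ ^ 2) - 1) :=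
    ((Real.smoothTransition.contDiff (n := 1)).differentiable one_ne_zero _).hasDerivAt
  refine (h2.comp_hasFDerivAt z h1).congr_fderiv ?_
  rw [smul_smul]

lemma contDiff_evalConj (P : MvPolynomial (Fin 2) ℂ) : ContDiff ℝ ∞ (evalConj P) := by
  induction P using MvPolynomial.induction_on with
  | C c =>
    have h1 : evalConj (MvPolynomial.C c) = fun _ => c := funext fun z => evalConj_C c z
    rw [h1]; exact contDiff_const
  | add P Q hP hQ =>
    have h1 : evalConj (P + Q) = fun z => evalConj P z + evalConj Q z :=
      funext fun z => evalConj_add P Q z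
    rw [h1]
    exact hP.add hQ
  | mul_X P i hP =>
    have h1 : evalConj (P * MvPolynomial.X i) =
        fun z => evalConj P z * evalConj (MvPolynomial.X i) z :=
      funext fun z => evalConj_mul P _ z
    rw [h1]
    refine hP.mul ?_
    fin_cases i
    · have h1 : evalConj (MvPolynomial.X 0) = id := funext fun z => evalConj_X0 z
      simp only [Fin.zero_eta]
      rw [h1]; exact contDiff_id
    · have h1 : evalConj (MvPolynomial.X 1) = (Complex.conjCLE : ℂ →L[ℝ] ℂ) :=
        funext fun z => evalConj_X1 z
      simp only [Fin.mk_one]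
      rw [h1]; exact (Complex.conjCLE : ℂ →L[ℝ] ℂ).contDiff

lemma contDiffAt_weight_mul (γ : ℝ) (P : MvPolynomial (Fin 2) ℂ) {z : ℂ}
    (hz : z ∈ Metric.ball (0 : ℂ) 1) :
    ContDiffAt ℝ ∞ (fun z => (((1 - ‖z‖ ^ 2) ^ (γ + 1) : ℝ) : ℂ) * evalConj P z) z := by
  have h1 : ContDiffAt ℝ ∞ (fun z : ℂ => (1 - ‖z‖ ^ 2) ^ (γ + 1)) z :=
    (contDiff_const.sub (contDiff_norm_sq ℝ)).contDiffAt.rpow_const_of_ne (weight_pos hz).ne'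
  have h2 := contDiff_evalConj P
  exact ((Complex.ofRealCLM.contDiff).contDiffAt.comp z h1).mul h2.contDiffAt

/-- The cut off function `d^{γ+1} P`. -/
def cutoffWeight (γ : ℝ) (P : MvPolynomial (Fin 2) ℂ) (n : ℝ) (z : ℂ) : ℂ :=
  (cutoff n z : ℂ) * ((((1 - ‖z‖ ^ 2) ^ (γ + 1) : ℝ) : ℂ) * evalConj P z)

lemma cutoff_eq_zero {n : ℝ} {z : ℂ} (h : n * (1 - ‖z‖ ^ 2) ≤ 1) : cutoff n z = 0 :=
  Real.smoothTransition.zero_of_nonpos (by linarith)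

lemma tsupport_cutoffWeight (γ : ℝ) (P : MvPolynomial (Fin 2) ℂ) (n : ℝ) :
    tsupport (cutoffWeight γ P n) ⊆ {z | 1 ≤ n * (1 - ‖z‖ ^ 2)} := by
  refine closure_minimal (fun z hz => ?_) (isClosed_le continuous_const (by fun_prop))
  by_contra h
  refine hz ?_
  rw [cutoffWeight, cutoff_eq_zero (le_of_lt (not_le.1 h)), Complex.ofReal_zero, zero_mul]

lemma cutoff_set_subset {n : ℝ} (hn : 0 < n) :
    {z : ℂ | 1 ≤ n * (1 - ‖z‖ ^ 2)} ⊆ Metric.ball 0 1 := fun z hz => by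
  rw [mem_ball_zero_iff]
  have h1 : 0 < 1 - ‖z‖ ^ 2 := pos_of_mul_pos_right (lt_of_lt_of_le one_pos hz) hn.le
  nlinarith [norm_nonneg z]

lemma hasCompactSupport_cutoffWeight (γ : ℝ) (P : MvPolynomial (Fin 2) ℂ) {n : ℝ} (hn : 0 < n) :
    HasCompactSupport (cutoffWeight γ P n) :=
  (isCompact_closedBall (0 : ℂ) 1).of_isClosed_subset (isClosed_tsupport _)
    ((tsupport_cutoffWeight γ P n).trans ((cutoff_set_subset hn).trans Metric.ball_subset_closedBall))

lemma contDiff_cutoffWeight (γ : ℝ) (P : MvPolynomial (Fin 2) ℂ) {n : ℝ} (hn : 0 < n) :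
    ContDiff ℝ ∞ (cutoffWeight γ P n) := by
  refine contDiff_iff_contDiffAt.2 fun z => ?_
  by_cases hz : z ∈ Metric.ball (0 : ℂ) 1
  · exact ((Complex.ofRealCLM.contDiff.comp (contDiff_cutoff n)).contDiffAt).mul
      (contDiffAt_weight_mul γ P hz)
  · have h0 : n * (1 - ‖z‖ ^ 2) < 1 := by
      rw [mem_ball_zero_iff, not_lt] at hz
      have h1 : 1 - ‖z‖ ^ 2 ≤ 0 := by nlinarith
      linarith [mul_nonpos_of_nonneg_of_nonpos hn.le h1]
    have : cutoffWeight γ P n =ᶠ[𝓝 z] fun _ => 0 := by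
      have hc : Continuous fun z : ℂ => n * (1 - ‖z‖ ^ 2) := by fun_prop
      filter_upwards [(hc.tendsto z).eventually (gt_mem_nhds h0)] with w hw
      rw [cutoffWeight, cutoff_eq_zero (le_of_lt hw), Complex.ofReal_zero, zero_mul]
    exact contDiffAt_const.congr_of_eventuallyEq this

/-- The gradient of the cutoff is of order n, but it multiplies d^{γ+1} = d^γ d. Grouping n with d
exhibits a quantity that is bounded wherever the derivative of the cutoff is nonzero, and the factor
d^γ comes out. -/
lemma fderiv_cutoffWeight (γ : ℝ) (P : MvPolynomial (Fin 2) ℂ) (n : ℝ) {z : ℂ}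
    (hz : z ∈ Metric.ball (0 : ℂ) 1) (w : ℂ) :
    fderiv ℝ (cutoffWeight γ P n) z w = (((1 - ‖z‖ ^ 2) ^ γ : ℝ) : ℂ) *
      ((cutoff n z : ℂ) * wirt (evalConj (wirtPoly γ P) z) (evalConj (wirtBarPoly γ P) z) w -
        ((deriv Real.smoothTransition (n * (1 - ‖z‖ ^ 2) - 1) * (n * (1 - ‖z‖ ^ 2)) *
          (2 * inner ℝ z w) : ℝ) : ℂ) * evalConj P z) := by
  have h1 := (Complex.ofRealCLM.hasFDerivAt (x := cutoff n z)).comp z (hasFDerivAt_cutoff n z)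
  have h2 := h1.mul (hasFDerivAt_weight_mul γ P hz)
  have h3 : fderiv ℝ (cutoffWeight γ P n) z = _ := h2.fderiv
  rw [h3]
  have hp : (((1 - ‖z‖ ^ 2) ^ (γ + 1) : ℝ) : ℂ) =
      (((1 - ‖z‖ ^ 2) ^ γ : ℝ) : ℂ) * ((1 - ‖z‖ ^ 2 : ℝ) : ℂ) := by
    rw [← Complex.ofReal_mul, Real.rpow_add (weight_pos hz), Real.rpow_one]
  simp only [_root_.add_apply, _root_.smul_apply,
    ContinuousLinearMap.comp_apply, Complex.ofRealCLM_apply, _root_.neg_apply,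
    smul_eq_mul, innerSL_apply_apply, Function.comp_apply, hp, nsmul_eq_mul]
  push_cast
  ring

lemma tendsto_eLpNorm_of_bounded {α : Type*} [MeasurableSpace α] {μ : Measure α} [IsFiniteMeasure μ]
    {f : ℕ → α → ℂ} (hm : ∀ n, AEStronglyMeasurable (f n) μ) (C : ℝ)
    (hb : ∀ n, ∀ᵐ x ∂μ, ‖f n x‖ ≤ C) (hl : ∀ᵐ x ∂μ, Tendsto (fun n => f n x) atTop (𝓝 0)) :
    Tendsto (fun n => eLpNorm (f n) 2 μ) atTop (𝓝 0) := by
  simp_rw [eLpNorm_eq_lintegral_rpow_enorm_toReal (p := 2) (by simp) (by simp)]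
  have h := tendsto_lintegral_of_dominated_convergence' (μ := μ)
    (F := fun n x => ‖f n x‖ₑ ^ (2 : ENNReal).toReal) (f := fun _ => 0)
    (fun _ => ENNReal.ofReal C ^ (2 : ENNReal).toReal) (fun n => (hm n).enorm.pow_const _)
    (fun n => by
      filter_upwards [hb n] with x hx
      refine ENNReal.rpow_le_rpow ?_ (by simp)
      rw [← ofReal_norm]
      exact ENNReal.ofReal_le_ofReal hx)
    (by
      rw [lintegral_const]
      exact ENNReal.mul_ne_top (ENNReal.rpow_ne_top_of_nonneg (by simp) (by simp))
        (measure_ne_top _ _))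
    (by
      filter_upwards [hl] with x hx
      have h1 : Tendsto (fun n => ‖f n x‖ₑ) atTop (𝓝 0) := by
        have := hx.enorm
        rwa [enorm_zero] at this
      have h2 := ((ENNReal.continuous_rpow_const (y := (2 : ENNReal).toReal)).tendsto 0).comp h1
      rwa [ENNReal.zero_rpow_of_pos (by simp)] at h2)
  rw [lintegral_zero] at h
  have h2 := ((ENNReal.continuous_rpow_const (y := 1 / (2 : ENNReal).toReal)).tendsto 0).comp h
  rwa [ENNReal.zero_rpow_of_pos (by simp)] at h2

lemma tendsto_cutoff {z : ℂ} (hz : z ∈ Metric.ball (0 : ℂ) 1) :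
    ∀ᶠ n : ℕ in atTop, cutoff (n + 1) z = 1 ∧
      deriv Real.smoothTransition (((n : ℝ) + 1) * (1 - ‖z‖ ^ 2) - 1) = 0 := by
  have hd := weight_pos hz
  have h : Tendsto (fun n : ℕ => ((n : ℝ) + 1) * (1 - ‖z‖ ^ 2)) atTop atTop :=
    (tendsto_atTop_add_const_right _ _ tendsto_natCast_atTop_atTop).atTop_mul_const hd
  filter_upwards [h.eventually (eventually_gt_atTop 2)] with n hn
  exact ⟨Real.smoothTransition.one_of_one_le (by linarith),
    deriv_smoothTransition_of_one_lt (by linarith)⟩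

lemma cutoff_mem_Icc (n : ℝ) (z : ℂ) : 0 ≤ cutoff n z ∧ cutoff n z ≤ 1 :=
  ⟨Real.smoothTransition.nonneg _, Real.smoothTransition.le_one _⟩

variable {γ : ℝ} [hγ : Fact (-1 < γ)]

/-- `u`, `f`, `g` are the functions `d^{-γ} h`, `d^{-γ} ∂h`, `d^{-γ} ∂̄h` for some `h` in
`H_0^{1,-γ}`. -/
def IsWeightedGrad (γ : ℝ) (u f g : DiskSpace γ) : Prop :=
  IsH01 (-γ) (fun z => (((1 - ‖z‖ ^ 2) ^ γ : ℝ) : ℂ) * u z)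
    (fun z => (((1 - ‖z‖ ^ 2) ^ γ : ℝ) : ℂ) * (f z + g z))
    (fun z => (((1 - ‖z‖ ^ 2) ^ γ : ℝ) : ℂ) * (Complex.I * (f z - g z)))

lemma exists_bound_evalConj (P : MvPolynomial (Fin 2) ℂ) :
    ∃ C : ℝ, 0 ≤ C ∧ ∀ z ∈ Metric.ball (0 : ℂ) 1, ‖evalConj P z‖ ≤ C := by
  obtain ⟨C, hC⟩ := (isCompact_closedBall (0 : ℂ) 1).exists_bound_of_continuousOn
    (continuous_evalConj P).continuousOn
  exact ⟨C, (norm_nonneg _).trans (hC 0 (by simp)),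
    fun z hz => hC z (Metric.ball_subset_closedBall hz)⟩

lemma eLpNorm_neg_eq_of_ball {F f : ℂ → ℂ}
    (h : ∀ z ∈ Metric.ball (0 : ℂ) 1, F z = (((1 - ‖z‖ ^ 2) ^ γ : ℝ) : ℂ) * f z) :
    eLpNorm F 2 (diskMeasure (-γ)) = eLpNorm f 2 (diskMeasure γ) := by
  rw [← eLpNorm_diskMeasure_neg γ f]
  refine eLpNorm_congr_ae ?_
  filter_upwards [ae_diskMeasure_mem_ball (-γ)] with z hz using h z hz

/-- Divided by d^γ, the error is bounded uniformly in n and vanishes at each point of the disk for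
large n; dominated convergence applies because d^γ |dz|² is a finite measure. -/
lemma tendsto_fderiv_cutoffWeight (P : MvPolynomial (Fin 2) ℂ) (w : ℂ) :
    Tendsto (fun n : ℕ => eLpNorm (fun z => fderiv ℝ (cutoffWeight γ P (n + 1)) z w -
      (((1 - ‖z‖ ^ 2) ^ γ : ℝ) : ℂ) * wirt (evalConj (wirtPoly γ P) z)
        (evalConj (wirtBarPoly γ P) z) w) 2 (diskMeasure (-γ))) atTop (𝓝 0) := by
  obtain ⟨M, hM0, hM⟩ := exists_deriv_smoothTransition_bound
  obtain ⟨C, hC0, hC⟩ := exists_bound_evalConj P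
  obtain ⟨C1, hC10, hC1⟩ := exists_bound_evalConj (wirtPoly γ P)
  obtain ⟨C2, hC20, hC2⟩ := exists_bound_evalConj (wirtBarPoly γ P)
  set f : ℕ → ℂ → ℂ := fun n z =>
    ((cutoff (n + 1) z : ℂ) - 1) * wirt (evalConj (wirtPoly γ P) z) (evalConj (wirtBarPoly γ P) z) w
      - ((deriv Real.smoothTransition (((n : ℝ) + 1) * (1 - ‖z‖ ^ 2) - 1) *
        (((n : ℝ) + 1) * (1 - ‖z‖ ^ 2)) * (2 * inner ℝ z w) : ℝ) : ℂ) * evalConj P z with hf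
  have h1 : ∀ n : ℕ, eLpNorm (fun z => fderiv ℝ (cutoffWeight γ P (n + 1)) z w -
      (((1 - ‖z‖ ^ 2) ^ γ : ℝ) : ℂ) * wirt (evalConj (wirtPoly γ P) z)
        (evalConj (wirtBarPoly γ P) z) w) 2 (diskMeasure (-γ)) =
      eLpNorm (f n) 2 (diskMeasure γ) := fun n => eLpNorm_neg_eq_of_ball fun z hz => by
    rw [fderiv_cutoffWeight γ P _ hz, hf]
    ring
  simp_rw [h1]
  -- In this bound M * 2 controls the derivative of the transition times n d, since that derivative
  -- vanishes for n d > 2; 2 * ‖w‖ controls 2⟨z, w⟩ and C controls P.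
  refine tendsto_eLpNorm_of_bounded (fun n => ?_)
    ((C1 * ‖w‖ + C2 * ‖w‖) + M * 2 * (2 * ‖w‖) * C) (fun n => ?_) ?_
  · have hc1 : Continuous (cutoff ((n : ℝ) + 1)) := (contDiff_cutoff _).continuous
    have hc2 : Continuous (deriv Real.smoothTransition) :=
      (Real.smoothTransition.contDiff (n := 1)).continuous_deriv le_rfl
    refine Continuous.aestronglyMeasurable ?_
    simp only [hf, wirt_apply]
    fun_prop
  · filter_upwards [ae_diskMeasure_mem_ball γ] with z hz
    have hz1 : ‖z‖ ≤ 1 := (mem_ball_zero_iff.1 hz).le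
    have hd := weight_pos hz
    simp only [hf]
    refine (norm_sub_le _ _).trans (add_le_add ?_ ?_)
    · rw [norm_mul]
      have h2 : ‖((cutoff ((n : ℝ) + 1) z : ℝ) : ℂ) - 1‖ ≤ 1 := by
        rw [← Complex.ofReal_one, ← Complex.ofReal_sub, Complex.norm_real, Real.norm_eq_abs,
          abs_le]
        have := cutoff_mem_Icc ((n : ℝ) + 1) z
        constructor <;> linarith
      have h3 : ‖wirt (evalConj (wirtPoly γ P) z) (evalConj (wirtBarPoly γ P) z) w‖ ≤
          C1 * ‖w‖ + C2 * ‖w‖ := by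
        rw [wirt_apply]
        refine (norm_add_le _ _).trans (add_le_add ?_ ?_)
        · rw [norm_mul]; exact mul_le_mul_of_nonneg_right (hC1 z hz) (norm_nonneg _)
        · rw [norm_mul, RCLike.norm_conj]
          exact mul_le_mul_of_nonneg_right (hC2 z hz) (norm_nonneg _)
      calc _ ≤ 1 * (C1 * ‖w‖ + C2 * ‖w‖) := mul_le_mul h2 h3 (norm_nonneg _) zero_le_one
        _ = _ := one_mul _
    · rw [norm_mul, Complex.norm_real, Real.norm_eq_abs, abs_mul, abs_mul]
      refine mul_le_mul (mul_le_mul ?_ ?_ (abs_nonneg _) (by positivity)) (hC z hz) (norm_nonneg _)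
        (by positivity)
      · rcases lt_or_ge 2 (((n : ℝ) + 1) * (1 - ‖z‖ ^ 2)) with h4 | h4
        · rw [deriv_smoothTransition_of_one_lt (by linarith), abs_zero, zero_mul]
          positivity
        · refine mul_le_mul (hM _) ?_ (abs_nonneg _) hM0
          rwa [abs_of_pos (by positivity)]
      · rw [abs_mul, abs_two]
        refine mul_le_mul_of_nonneg_left ?_ zero_le_two
        refine (abs_real_inner_le_norm z w).trans ?_
        nlinarith [norm_nonneg w]
  · filter_upwards [ae_diskMeasure_mem_ball γ] with z hz
    refine tendsto_const_nhds.congr' ?_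
    filter_upwards [tendsto_cutoff hz] with n hn
    simp only [hf]
    rw [hn.1, hn.2]
    simp

lemma tendsto_cutoffWeight (P : MvPolynomial (Fin 2) ℂ) :
    Tendsto (fun n : ℕ => eLpNorm (fun z => cutoffWeight γ P (n + 1) z -
      (((1 - ‖z‖ ^ 2) ^ γ : ℝ) : ℂ) * evalConj (weightPoly * P) z) 2 (diskMeasure (-γ)))
      atTop (𝓝 0) := by
  obtain ⟨C, hC0, hC⟩ := exists_bound_evalConj (weightPoly * P)
  set f : ℕ → ℂ → ℂ := fun n z =>
    ((cutoff (n + 1) z : ℂ) - 1) * evalConj (weightPoly * P) z with hf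
  have h1 : ∀ n : ℕ, eLpNorm (fun z => cutoffWeight γ P (n + 1) z -
      (((1 - ‖z‖ ^ 2) ^ γ : ℝ) : ℂ) * evalConj (weightPoly * P) z) 2 (diskMeasure (-γ)) =
      eLpNorm (f n) 2 (diskMeasure γ) := fun n => eLpNorm_neg_eq_of_ball fun z hz => by
    rw [cutoffWeight, hf]
    simp only [evalConj_mul, evalConj_weightPoly]
    rw [Real.rpow_add (weight_pos hz), Real.rpow_one]
    push_cast
    ring
  simp_rw [h1]
  refine tendsto_eLpNorm_of_bounded (fun n => ?_) (1 * C) (fun n => ?_) ?_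
  · have hc1 : Continuous (cutoff ((n : ℝ) + 1)) := (contDiff_cutoff _).continuous
    refine Continuous.aestronglyMeasurable ?_
    simp only [hf]
    fun_prop
  · filter_upwards [ae_diskMeasure_mem_ball γ] with z hz
    simp only [hf]
    rw [norm_mul]
    have h2 : ‖((cutoff ((n : ℝ) + 1) z : ℝ) : ℂ) - 1‖ ≤ 1 := by
      rw [← Complex.ofReal_one, ← Complex.ofReal_sub, Complex.norm_real, Real.norm_eq_abs,
        abs_le]
      have := cutoff_mem_Icc ((n : ℝ) + 1) z
      constructor <;> linarith
    exact mul_le_mul h2 (hC z hz) (norm_nonneg _) zero_le_one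
  · filter_upwards [ae_diskMeasure_mem_ball γ] with z hz
    refine tendsto_const_nhds.congr' ?_
    filter_upwards [tendsto_cutoff hz] with n hn
    simp only [hf]
    rw [hn.1]
    simp

lemma isWeightedGrad_mk {u f g : DiskSpace γ} (φ : ℕ → ℂ → ℂ)
    (hφ : ∀ n, ContDiff ℝ ∞ (φ n) ∧ HasCompactSupport (φ n) ∧ tsupport (φ n) ⊆ Metric.ball 0 1)
    (h0 : Tendsto (fun n => eLpNorm (fun z => φ n z - (((1 - ‖z‖ ^ 2) ^ γ : ℝ) : ℂ) * u z) 2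
      (diskMeasure (-γ))) atTop (𝓝 0))
    (h1 : Tendsto (fun n => eLpNorm (fun z => fderiv ℝ (φ n) z 1 -
      (((1 - ‖z‖ ^ 2) ^ γ : ℝ) : ℂ) * (f z + g z)) 2 (diskMeasure (-γ))) atTop (𝓝 0))
    (h2 : Tendsto (fun n => eLpNorm (fun z => fderiv ℝ (φ n) z Complex.I -
      (((1 - ‖z‖ ^ 2) ^ γ : ℝ) : ℂ) * (Complex.I * (f z - g z))) 2 (diskMeasure (-γ)))
      atTop (𝓝 0)) : IsWeightedGrad γ u f g where
  memLp := (memLp_diskMeasure_neg_iff γ _).2 (Lp.memLp u)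
  memLp_x := (memLp_diskMeasure_neg_iff γ _).2 ((Lp.memLp f).add (Lp.memLp g))
  memLp_y := (memLp_diskMeasure_neg_iff γ _).2 (((Lp.memLp f).sub (Lp.memLp g)).const_mul _)
  approx := ⟨φ, hφ, h0, h1, h2⟩

/-- Here h = d^{γ+1} P, the limit of its cutoffs; dividing h, ∂h and ∂̄h by d^γ leaves polynomials.
-/
lemma isWeightedGrad_poly (P : MvPolynomial (Fin 2) ℂ) :
    IsWeightedGrad γ (polyLp γ (weightPoly * P)) (polyLp γ (wirtPoly γ P))
      (polyLp γ (wirtBarPoly γ P)) := by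
  have hac := diskMeasure_ac (-γ) γ
  have e0 := hac.ae_le (polyLp_ae_eq (γ := γ) (weightPoly * P))
  have e1 := hac.ae_le (polyLp_ae_eq (γ := γ) (wirtPoly γ P))
  have e2 := hac.ae_le (polyLp_ae_eq (γ := γ) (wirtBarPoly γ P))
  generalize polyLp γ (weightPoly * P) = u at *
  generalize polyLp γ (wirtPoly γ P) = f at *
  generalize polyLp γ (wirtBarPoly γ P) = g at *
  refine isWeightedGrad_mk (fun n => cutoffWeight γ P (n + 1)) (fun n =>
    ⟨contDiff_cutoffWeight γ P (by positivity),
      hasCompactSupport_cutoffWeight γ P (by positivity),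
      (tsupport_cutoffWeight γ P _).trans (cutoff_set_subset (by positivity))⟩) ?_ ?_ ?_
  · refine (tendsto_cutoffWeight P).congr fun n => eLpNorm_congr_ae ?_
    filter_upwards [e0] with z h0
    rw [h0]
  · refine (tendsto_fderiv_cutoffWeight P 1).congr fun n => eLpNorm_congr_ae ?_
    filter_upwards [e1, e2] with z h1 h2
    rw [h1, h2, wirt_apply, (starRingEnd ℂ).map_one, mul_one, mul_one]
  · refine (tendsto_fderiv_cutoffWeight P Complex.I).congr fun n => eLpNorm_congr_ae ?_
    filter_upwards [e1, e2] with z h1 h2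
    rw [h1, h2, wirt_apply, Complex.conj_I]
    ring

end Sobolev

end DiskXRay
end

/-! ### Chord integrals and integration by parts for test functions. -/

noncomputable section
namespace DiskXRay

section TestFunctions

set_option linter.unusedSectionVars false

/-! ### Gradients of functions of `H_0^{1,-γ}` -/

lemma eLpNorm_div_weight (γ : ℝ) (F : ℂ → ℂ) :
    eLpNorm (fun z => (((1 - ‖z‖ ^ 2) ^ (-γ) : ℝ) : ℂ) * F z) 2 (diskMeasure γ) =
      eLpNorm F 2 (diskMeasure (-γ)) := by
  simpa only [neg_neg] using eLpNorm_diskMeasure_neg (-γ) F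

lemma memLp_div_weight_iff (γ : ℝ) (F : ℂ → ℂ) :
    MemLp (fun z => (((1 - ‖z‖ ^ 2) ^ (-γ) : ℝ) : ℂ) * F z) 2 (diskMeasure γ) ↔
      MemLp F 2 (diskMeasure (-γ)) := by
  simpa only [neg_neg] using memLp_diskMeasure_neg_iff (-γ) F

/-- The derivative `∂` of a function with given partial derivatives. -/
def delOf (hx hy : ℂ → ℂ) (z : ℂ) : ℂ := (hx z - Complex.I * hy z) / 2

/-- The derivative `∂̄` of a function with given partial derivatives. -/
def delBarOf (hx hy : ℂ → ℂ) (z : ℂ) : ℂ := (hx z + Complex.I * hy z) / 2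

lemma memLp_delOf {μ : Measure ℂ} {hx hy : ℂ → ℂ} (h1 : MemLp hx 2 μ) (h2 : MemLp hy 2 μ) :
    MemLp (delOf hx hy) 2 μ := by
  have h := (h1.sub (h2.const_mul Complex.I)).const_mul (1 / 2)
  refine (memLp_congr_ae (Eventually.of_forall fun z => ?_)).1 h
  simp only [Pi.sub_apply, delOf]
  ring

lemma memLp_delBarOf {μ : Measure ℂ} {hx hy : ℂ → ℂ} (h1 : MemLp hx 2 μ) (h2 : MemLp hy 2 μ) :
    MemLp (delBarOf hx hy) 2 μ := by
  have h := (h1.add (h2.const_mul Complex.I)).const_mul (1 / 2)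
  refine (memLp_congr_ae (Eventually.of_forall fun z => ?_)).1 h
  simp only [Pi.add_apply, delBarOf]
  ring

lemma one_sub_norm_geodesic_pos {p : ℝ × ℝ} {t : ℝ} (ht : t ∈ Set.Ioo 0 (2 * Real.cos p.2)) :
    0 < 1 - ‖geodesic p t‖ ^ 2 := by
  have hp : 0 < Real.cos p.2 := by linarith [ht.1.trans ht.2]
  have h1 : t = Real.cos p.2 * (t / Real.cos p.2 - 1) + Real.cos p.2 := by field_simp; ring
  rw [h1, geodesic_eq_chordPoint, one_sub_norm_chordPoint]
  have h2 : Real.cos p.2 ^ 2 * (1 - (t / Real.cos p.2 - 1) ^ 2) = t * (2 * Real.cos p.2 - t) := by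
    field_simp; ring
  rw [h2]
  exact mul_pos ht.1 (by linarith [ht.2])

lemma norm_geodesic_zero (p : ℝ × ℝ) : ‖geodesic p 0‖ = 1 := by
  simp [geodesic, Complex.norm_exp_ofReal_mul_I]

lemma norm_geodesic_end {p : ℝ × ℝ} : ‖geodesic p (2 * Real.cos p.2)‖ = 1 := by
  have h1 : 2 * Real.cos p.2 = Real.cos p.2 * 1 + Real.cos p.2 := by ring
  have h2 := one_sub_norm_chordPoint p 1
  rw [← geodesic_eq_chordPoint, ← h1] at h2
  have h3 : ‖geodesic p (2 * Real.cos p.2)‖ ^ 2 = 1 := by linarith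
  exact (pow_eq_one_iff_of_nonneg (norm_nonneg _) two_ne_zero).1 h3

/-- Inside the chord d is positive, so d^γ and d^{-γ} cancel; this may fail at the endpoints, where
d = 0, which is why the interval is open. -/
lemma rayIntegrand_div_weight (γ : ℝ) (F : ℂ → ℂ → ℂ) {p : ℝ × ℝ} {t : ℝ}
    (ht : t ∈ Set.Ioo 0 (2 * Real.cos p.2)) :
    rayIntegrand γ (fun z v => (((1 - ‖z‖ ^ 2) ^ (-γ) : ℝ) : ℂ) * F z v) p t =
      rayIntegrand 0 F p t := by
  have hd := one_sub_norm_geodesic_pos ht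
  rw [rayIntegrand, rayIntegrand, Real.rpow_zero, mul_right_comm, ← Complex.ofReal_mul,
    ← Real.rpow_add hd, neg_add_cancel, Real.rpow_zero, mul_comm]

lemma xray_div_weight (γ : ℝ) (F : ℂ → ℂ → ℂ) {p : ℝ × ℝ} (hp : 0 < Real.cos p.2) :
    xray γ (fun z v => (((1 - ‖z‖ ^ 2) ^ (-γ) : ℝ) : ℂ) * F z v) p = xray 0 F p := by
  rw [xray, xray, intervalIntegral.integral_of_le (by linarith),
    intervalIntegral.integral_of_le (by linarith), integral_Ioc_eq_integral_Ioo,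
    integral_Ioc_eq_integral_Ioo]
  exact setIntegral_congr_fun measurableSet_Ioo fun t ht => rayIntegrand_div_weight γ F ht

lemma intervalIntegrable_div_weight (γ : ℝ) (F : ℂ → ℂ → ℂ) {p : ℝ × ℝ} (hp : 0 < Real.cos p.2) :
    IntervalIntegrable (rayIntegrand γ (fun z v => (((1 - ‖z‖ ^ 2) ^ (-γ) : ℝ) : ℂ) * F z v) p)
      volume 0 (2 * Real.cos p.2) ↔
    IntervalIntegrable (rayIntegrand 0 F p) volume 0 (2 * Real.cos p.2) := by
  rw [intervalIntegrable_iff_integrableOn_Ioo_of_le (by linarith),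
    intervalIntegrable_iff_integrableOn_Ioo_of_le (by linarith)]
  exact integrableOn_congr_fun (fun t ht => rayIntegrand_div_weight γ F ht) measurableSet_Ioo

lemma apply_eq_delOf (L : ℂ →L[ℝ] ℂ) (v : ℂ) :
    L v = v * ((L 1 - Complex.I * L Complex.I) / 2) +
      (starRingEnd ℂ) v * ((L 1 + Complex.I * L Complex.I) / 2) := by
  have h1 : v = v.re • (1 : ℂ) + v.im • Complex.I := by
    simp [Complex.re_add_im]
  have h2 : L v = v.re * L 1 + v.im * L Complex.I := by
    conv_lhs => rw [h1]
    rw [map_add, map_smul, map_smul, Complex.real_smul, Complex.real_smul]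
  have h3 : (starRingEnd ℂ) v = v.re - v.im * Complex.I := by
    apply Complex.ext <;> simp
  have h4 : v = v.re + v.im * Complex.I := (Complex.re_add_im v).symm
  rw [h2, h3]
  nth_rewrite 3 [h4]
  linear_combination ((v.im : ℂ) * L Complex.I) * Complex.I_sq

/-- Fundamental theorem of calculus: both endpoints of the chord lie on the unit circle, where φ
vanishes. -/
lemma integral_fderiv_geodesic {φ : ℂ → ℂ} (hφ : ContDiff ℝ ∞ φ)
    (hs : tsupport φ ⊆ Metric.ball 0 1) (p : ℝ × ℝ) :
    ∫ t in (0 : ℝ)..(2 * Real.cos p.2), fderiv ℝ φ (geodesic p t) (direction p) = 0 := by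
  have h0 : ∀ z : ℂ, ‖z‖ = 1 → φ z = 0 := fun z hz => by
    refine image_eq_zero_of_notMem_tsupport fun h => ?_
    have := mem_ball_zero_iff.1 (hs h)
    linarith
  have hg : ∀ t, HasDerivAt (geodesic p) (direction p) t := fun t => by
    have h := ((Complex.ofRealCLM.hasDerivAt (x := t)).mul_const (direction p)).const_add
      (Complex.exp ((p.1 : ℂ) * Complex.I))
    exact h.congr_deriv (by simp)
  have hc : Continuous (geodesic p) := by unfold geodesic; fun_prop
  have hd : ∀ t, HasDerivAt (fun t => φ (geodesic p t))
      (fderiv ℝ φ (geodesic p t) (direction p)) t := fun t =>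
    ((hφ.differentiable (by simp)) (geodesic p t)).hasFDerivAt.comp_hasDerivAt t (hg t)
  rw [intervalIntegral.integral_eq_sub_of_hasDerivAt (fun t _ => hd t), h0 _ norm_geodesic_end,
    h0 _ (norm_geodesic_zero p), sub_zero]
  have h1 : Continuous (fderiv ℝ φ) := hφ.continuous_fderiv (by simp)
  exact ((h1.comp hc).clm_apply continuous_const).intervalIntegrable _ _

variable {γ : ℝ} [hγ : Fact (-1 < γ)]

/-- The density of the measure cancels d^{-γ}, leaving a Lebesgue integral suited to integration by
parts. -/
lemma inner_polyLp_div_weight (Q : MvPolynomial (Fin 2) ℂ) {f : DiskSpace γ} {F : ℂ → ℂ}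
    (hf : f =ᵐ[diskMeasure γ] fun z => (((1 - ‖z‖ ^ 2) ^ (-γ) : ℝ) : ℂ) * F z) :
    inner ℂ (polyLp γ Q) f = ∫ z in Metric.ball 0 1, (starRingEnd ℂ) (evalConj Q z) * F z := by
  rw [inner_eq_integral (polyLp_ae_eq Q) hf, diskMeasure_eq_ball,
    integral_withDensity_eq_integral_toReal_smul (by fun_prop) (by simp)]
  refine setIntegral_congr_fun measurableSet_ball fun z hz => ?_
  have hd := weight_pos hz
  rw [ENNReal.toReal_ofReal (by positivity), Complex.real_smul, mul_left_comm, ← mul_assoc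
    (((1 - ‖z‖ ^ 2) ^ γ : ℝ) : ℂ), ← Complex.ofReal_mul, ← Real.rpow_add hd, add_neg_cancel,
    Real.rpow_zero, Complex.ofReal_one, one_mul]

lemma fderiv_apply_eq_zero_of_notMem_tsupport {φ : ℂ → ℂ} (w : ℂ) {z : ℂ} (hz : z ∉ tsupport φ) :
    fderiv ℝ φ z w = 0 := by
  have h : fderiv ℝ φ z = 0 := by
    by_contra h
    exact hz (support_fderiv_subset ℝ h)
  rw [h]; rfl

lemma setIntegral_evalConj_mul_fderiv {φ : ℂ → ℂ} (hφ : ContDiff ℝ ∞ φ)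
    (hc : HasCompactSupport φ) (hs : tsupport φ ⊆ Metric.ball 0 1) (Q : MvPolynomial (Fin 2) ℂ)
    (w : ℂ) : ∫ z in Metric.ball 0 1, evalConj Q z * fderiv ℝ φ z w =
      -∫ z, wirt (evalConj (MvPolynomial.pderiv 0 Q) z) (evalConj (MvPolynomial.pderiv 1 Q) z) w *
        φ z := by
  have hcont : Continuous fun z => fderiv ℝ φ z w :=
    (hφ.continuous_fderiv (by simp)).clm_apply continuous_const
  have hsupp : HasCompactSupport fun z => fderiv ℝ φ z w := hc.fderiv_apply (𝕜 := ℝ) w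
  have e : ∀ z, fderiv ℝ (evalConj Q) z = wirt (evalConj (MvPolynomial.pderiv 0 Q) z)
      (evalConj (MvPolynomial.pderiv 1 Q) z) := fun z => (hasFDerivAt_evalConj Q z).fderiv
  have hQ := continuous_evalConj Q
  have hQ' : Continuous fun z => fderiv ℝ (evalConj Q) z w :=
    ((contDiff_evalConj Q).continuous_fderiv (by simp)).clm_apply continuous_const
  rw [setIntegral_eq_integral_of_forall_compl_eq_zero, integral_mul_fderiv_eq_neg_fderiv_mul_of_integrable]
  · simp_rw [e]
  · exact (hQ'.mul hφ.continuous).integrable_of_hasCompactSupport (hc.mul_left)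
  · exact (hQ.mul hcont).integrable_of_hasCompactSupport (hsupp.mul_left)
  · exact (hQ.mul hφ.continuous).integrable_of_hasCompactSupport (hc.mul_left)
  · exact fun z _ => (hasFDerivAt_evalConj Q z).differentiableAt
  · exact fun z _ => (hφ.differentiable (by simp)) z
  · intro z hz
    rw [fderiv_apply_eq_zero_of_notMem_tsupport w fun h => hz (hs h), mul_zero]

/-- The parameter c treats both operators at once: c = -i puts ∂ on φ and removes the second term on
the right, c = i puts ∂̄ on φ and removes the first. -/
lemma setIntegral_evalConj_mul_del {φ : ℂ → ℂ} (hφ : ContDiff ℝ ∞ φ)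
    (hc : HasCompactSupport φ) (hs : tsupport φ ⊆ Metric.ball 0 1) (Q : MvPolynomial (Fin 2) ℂ)
    (c : ℂ) : ∫ z in Metric.ball 0 1, evalConj Q z *
        ((fderiv ℝ φ z 1 + c * fderiv ℝ φ z Complex.I) / 2) =
      -∫ z, ((1 + c * Complex.I) / 2 * evalConj (MvPolynomial.pderiv 0 Q) z +
        (1 - c * Complex.I) / 2 * evalConj (MvPolynomial.pderiv 1 Q) z) * φ z := by
  have hcont : ∀ w, Continuous fun z => fderiv ℝ φ z w := fun w =>
    (hφ.continuous_fderiv (by simp)).clm_apply continuous_const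
  have hQ := continuous_evalConj Q
  have hQ0 := continuous_evalConj (MvPolynomial.pderiv 0 Q)
  have hQ1 := continuous_evalConj (MvPolynomial.pderiv 1 Q)
  have hint : ∀ w, IntegrableOn (fun z => evalConj Q z * fderiv ℝ φ z w) (Metric.ball 0 1) :=
    fun w => ((hQ.mul (hcont w)).integrable_of_hasCompactSupport
      ((hc.fderiv_apply (𝕜 := ℝ) w).mul_left)).integrableOn
  have hint' : ∀ w, Integrable fun z => wirt (evalConj (MvPolynomial.pderiv 0 Q) z)
      (evalConj (MvPolynomial.pderiv 1 Q) z) w * φ z := fun w => by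
    have hw : Continuous fun z => wirt (evalConj (MvPolynomial.pderiv 0 Q) z)
      (evalConj (MvPolynomial.pderiv 1 Q) z) w := by simp only [wirt_apply]; fun_prop
    exact (hw.mul hφ.continuous).integrable_of_hasCompactSupport (hc.mul_left)
  have e1 : ∫ z in Metric.ball 0 1, evalConj Q z *
        ((fderiv ℝ φ z 1 + c * fderiv ℝ φ z Complex.I) / 2) =
      (1 / 2) * (∫ z in Metric.ball 0 1, evalConj Q z * fderiv ℝ φ z 1) +
      (c / 2) * ∫ z in Metric.ball 0 1, evalConj Q z * fderiv ℝ φ z Complex.I := by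
    rw [← integral_const_mul, ← integral_const_mul,
      ← integral_add ((hint _).const_mul _) ((hint _).const_mul _)]
    refine integral_congr_ae (Eventually.of_forall fun z => ?_)
    simp only
    ring
  rw [e1, setIntegral_evalConj_mul_fderiv hφ hc hs, setIntegral_evalConj_mul_fderiv hφ hc hs,
    mul_neg, mul_neg, ← neg_add, ← integral_const_mul, ← integral_const_mul,
      ← integral_add ((hint' _).const_mul _) ((hint' _).const_mul _)]
  congr 1
  refine integral_congr_ae (Eventually.of_forall fun z => ?_)
  simp only [wirt_apply, map_one, Complex.conj_I]
  ring

end TestFunctions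

end DiskXRay
end

/-! ### The relations satisfied by gradients of functions in H_0^{1,-γ}. -/

noncomputable section
namespace DiskXRay

section GradientRelations

set_option linter.unusedSectionVars false

variable {γ : ℝ} [hγ : Fact (-1 < γ)]

/-- The relations satisfied by `f = d^{-γ} ∂h` and `g = d^{-γ} ∂̄h`. -/
structure IsGradPair (f g : DiskSpace γ) : Prop where
  left : f ∈ (bergman γ)ᗮ
  right : g ∈ (antiBergman γ)ᗮ
  xray_eq : modul γ 1 (xrayL γ f) + modul γ (-1) (xrayL γ g) = 0

/-- Pairing ∂φ with z^n is integration by parts against z̄^n, which ∂ kills; the other orthogonality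
exchanges z and z̄. The relation between transforms says that dφ(v) = v ∂φ + v̄ ∂̄φ integrates to
zero along chords. -/
lemma isGradPair_of_test {φ : ℂ → ℂ} (hφ : ContDiff ℝ ∞ φ) (hc : HasCompactSupport φ)
    (hs : tsupport φ ⊆ Metric.ball 0 1) {f g : DiskSpace γ}
    (hf : f =ᵐ[diskMeasure γ] fun z => (((1 - ‖z‖ ^ 2) ^ (-γ) : ℝ) : ℂ) *
      delOf (fun z => fderiv ℝ φ z 1) (fun z => fderiv ℝ φ z Complex.I) z)
    (hg : g =ᵐ[diskMeasure γ] fun z => (((1 - ‖z‖ ^ 2) ^ (-γ) : ℝ) : ℂ) *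
      delBarOf (fun z => fderiv ℝ φ z 1) (fun z => fderiv ℝ φ z Complex.I) z) :
    IsGradPair f g where
  left := by
    rw [mem_bergman_orthogonal_iff]
    intro n
    rw [inner_polyLp_div_weight _ hf]
    have h := setIntegral_evalConj_mul_del hφ hc hs (zMono 0 n) (-Complex.I)
    have e : MvPolynomial.pderiv 0 (zMono 0 n) = 0 := by
      simp [zMono, MvPolynomial.pderiv_X]
    have e1 : (1 - -Complex.I * Complex.I) / 2 = 0 := by simp
    simp only [e, e1, evalConj_zero, mul_zero, zero_mul, add_zero, integral_zero, neg_zero] at h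
    refine Eq.trans (integral_congr_ae (Eventually.of_forall fun z => ?_)) h
    simp only [evalConj_zMono, delOf, pow_zero, mul_one, one_mul, map_pow]
    ring
  right := by
    rw [mem_antiBergman_orthogonal_iff]
    intro n
    rw [inner_polyLp_div_weight _ hg]
    have h := setIntegral_evalConj_mul_del hφ hc hs (zMono n 0) Complex.I
    have e : MvPolynomial.pderiv 1 (zMono n 0) = 0 := by
      simp [zMono, MvPolynomial.pderiv_X]
    have e1 : (1 + Complex.I * Complex.I) / 2 = 0 := by simp
    simp only [e, e1, evalConj_zero, mul_zero, zero_mul, add_zero, integral_zero, neg_zero] at h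
    refine Eq.trans (integral_congr_ae (Eventually.of_forall fun z => ?_)) h
    simp only [evalConj_zMono, delBarOf, pow_zero, mul_one, one_mul, map_pow, Complex.conj_conj]
  xray_eq := by
    refine Lp.ext ?_
    have e1 := xrayFun_congr hf
    have e2 := xrayFun_congr hg
    filter_upwards [Lp.coeFn_add (modul γ 1 (xrayL γ f)) (modul γ (-1) (xrayL γ g)),
      Lp.coeFn_zero ℂ 2 (dataMeasure γ), modul_ae_eq 1 (xrayL γ f), modul_ae_eq (-1) (xrayL γ g),
      xrayL_ae_eq f, xrayL_ae_eq g, e1, e2, ae_dataMeasure_cos_pos γ] with p h1 h2 h3 h4 h5 h6 h7 h8 hp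
    rw [h1, h2, Pi.add_apply, h3, h4, h5, h6, h7, h8, xrayFun, xrayFun,
      xray_div_weight γ (fun z _ => delOf _ _ z) hp, xray_div_weight γ (fun z _ => delBarOf _ _ z) hp,
      Pi.zero_apply]
    have hcont : ∀ w, Continuous fun t => fderiv ℝ φ (geodesic p t) w := fun w =>
      ((hφ.continuous_fderiv (by simp)).comp (by unfold geodesic; fun_prop)).clm_apply
        continuous_const
    have hc1 := hcont 1
    have hc2 := hcont Complex.I
    rw [← integral_fderiv_geodesic hφ hs p, xray, xray, ← intervalIntegral.integral_const_mul,
      ← intervalIntegral.integral_const_mul, ← intervalIntegral.integral_add]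
    · refine intervalIntegral.integral_congr fun t _ => ?_
      have hv : direction p ^ (-1 : ℤ) = (starRingEnd ℂ) (direction p) := by
        rw [zpow_neg_one, Complex.inv_eq_conj (norm_direction p)]
      simp only [rayIntegrand, Real.rpow_zero, Complex.ofReal_one, mul_one, zpow_one, delOf,
        delBarOf, hv]
      rw [apply_eq_delOf (fderiv ℝ φ (geodesic p t)) (direction p)]
    · refine Continuous.intervalIntegrable ?_ _ _
      simp only [rayIntegrand, Real.rpow_zero, delOf]
      fun_prop
    · refine Continuous.intervalIntegrable ?_ _ _
      simp only [rayIntegrand, Real.rpow_zero, delBarOf]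
      fun_prop

lemma isGradPair_of_tendsto {f g : DiskSpace γ} {F G : ℕ → DiskSpace γ}
    (h : ∀ n, IsGradPair (F n) (G n)) (hF : Tendsto F atTop (𝓝 f)) (hG : Tendsto G atTop (𝓝 g)) :
    IsGradPair f g where
  left := (Submodule.isClosed_orthogonal _).mem_of_tendsto hF (Eventually.of_forall fun n => (h n).left)
  right := (Submodule.isClosed_orthogonal _).mem_of_tendsto hG
    (Eventually.of_forall fun n => (h n).right)
  xray_eq := by
    have hc : ∀ j, Continuous fun u : DiskSpace γ => modul γ j (xrayL γ u) := fun j =>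
      (modul γ j).continuous.comp (xrayL γ).continuous
    have h1 := (((hc 1).tendsto f).comp hF).add (((hc (-1)).tendsto g).comp hG)
    refine tendsto_nhds_unique h1 (tendsto_const_nhds.congr fun n => ?_)
    exact (h n).xray_eq.symm

lemma tendsto_eLpNorm_comb {μ : Measure ℂ} {a b : ℕ → ℂ → ℂ}
    (hm : ∀ n, AEStronglyMeasurable (a n) μ) (hm' : ∀ n, AEStronglyMeasurable (b n) μ)
    (ha : Tendsto (fun n => eLpNorm (a n) 2 μ) atTop (𝓝 0))
    (hb : Tendsto (fun n => eLpNorm (b n) 2 μ) atTop (𝓝 0)) (c d : ℂ) :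
    Tendsto (fun n => eLpNorm (fun z => c * a n z + d * b n z) 2 μ) atTop (𝓝 0) := by
  have h1 : Tendsto (fun n => ‖c‖ₑ * eLpNorm (a n) 2 μ + ‖d‖ₑ * eLpNorm (b n) 2 μ) atTop (𝓝 0) := by
    have := (ENNReal.Tendsto.const_mul (a := ‖c‖ₑ) ha (Or.inr (by simp))).add
      (ENNReal.Tendsto.const_mul (a := ‖d‖ₑ) hb (Or.inr (by simp)))
    simpa using this
  refine tendsto_of_tendsto_of_tendsto_of_le_of_le tendsto_const_nhds h1 (fun _ => zero_le)
    fun n => ?_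
  refine (eLpNorm_add_le ((hm n).const_mul c) ((hm' n).const_mul d) (by simp)).trans ?_
  exact add_le_add (eLpNorm_const_smul c (a n) 2 μ).le (eLpNorm_const_smul d (b n) 2 μ).le

/-- Division by d^γ is isometric from L²_{-γ} to L²_γ, so the derivatives of the approximating test
functions converge after division, and the relations of a gradient pair are closed conditions. -/
lemma isGradPair_of_isH01 [Fact (-1 < -γ)] {h hx hy : ℂ → ℂ} (hh : IsH01 (-γ) h hx hy)
    {f g : DiskSpace γ}
    (hf : f =ᵐ[diskMeasure γ] fun z => (((1 - ‖z‖ ^ 2) ^ (-γ) : ℝ) : ℂ) * delOf hx hy z)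
    (hg : g =ᵐ[diskMeasure γ] fun z => (((1 - ‖z‖ ^ 2) ^ (-γ) : ℝ) : ℂ) * delBarOf hx hy z) :
    IsGradPair f g := by
  obtain ⟨φ, hφ, -, h1, h2⟩ := hh.approx
  have hcont : ∀ n w, Continuous fun z => fderiv ℝ (φ n) z w := fun n w =>
    ((hφ n).1.continuous_fderiv (by simp)).clm_apply continuous_const
  have m : ∀ n w, MemLp (fun z => fderiv ℝ (φ n) z w) 2 (diskMeasure (-γ)) := fun n w =>
    memLp_of_continuous (hcont n w)
  have mF := fun n => (memLp_div_weight_iff γ _).2 (memLp_delOf (m n 1) (m n Complex.I))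
  have mG := fun n => (memLp_div_weight_iff γ _).2 (memLp_delBarOf (m n 1) (m n Complex.I))
  have s1 := fun n => ((m n 1).sub hh.memLp_x).aestronglyMeasurable
  have s2 := fun n => ((m n Complex.I).sub hh.memLp_y).aestronglyMeasurable
  refine isGradPair_of_tendsto (F := fun n => (mF n).toLp _) (G := fun n => (mG n).toLp _)
    (fun n => isGradPair_of_test (hφ n).1 (hφ n).2.1 (hφ n).2.2 (MemLp.coeFn_toLp _)
      (MemLp.coeFn_toLp _)) ?_ ?_
  · rw [Lp.tendsto_Lp_iff_tendsto_eLpNorm']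
    refine (tendsto_eLpNorm_comb s1 s2 h1 h2 (1 / 2) (-Complex.I / 2)).congr fun n => ?_
    rw [← eLpNorm_div_weight]
    refine eLpNorm_congr_ae ?_
    filter_upwards [MemLp.coeFn_toLp (mF n), hf] with z e1 e2
    simp only [Pi.sub_apply]
    rw [e1, e2]
    simp only [delOf]
    ring
  · rw [Lp.tendsto_Lp_iff_tendsto_eLpNorm']
    refine (tendsto_eLpNorm_comb s1 s2 h1 h2 (1 / 2) (Complex.I / 2)).congr fun n => ?_
    rw [← eLpNorm_div_weight]
    refine eLpNorm_congr_ae ?_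
    filter_upwards [MemLp.coeFn_toLp (mG n), hg] with z e1 e2
    simp only [Pi.sub_apply]
    rw [e1, e2]
    simp only [delBarOf]
    ring

lemma weight_neg_mul_weight (γ : ℝ) {z : ℂ} (hz : z ∈ Metric.ball (0 : ℂ) 1) :
    (((1 - ‖z‖ ^ 2) ^ (-γ) : ℝ) : ℂ) * (((1 - ‖z‖ ^ 2) ^ γ : ℝ) : ℂ) = 1 := by
  rw [← Complex.ofReal_mul, ← Real.rpow_add (weight_pos hz), neg_add_cancel, Real.rpow_zero,
    Complex.ofReal_one]

lemma ae_eq_delOf_weight (f g : ℂ → ℂ) : f =ᵐ[diskMeasure γ] fun z =>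
    (((1 - ‖z‖ ^ 2) ^ (-γ) : ℝ) : ℂ) *
      delOf (fun z => (((1 - ‖z‖ ^ 2) ^ γ : ℝ) : ℂ) * (f z + g z))
        (fun z => (((1 - ‖z‖ ^ 2) ^ γ : ℝ) : ℂ) * (Complex.I * (f z - g z))) z := by
  filter_upwards [ae_diskMeasure_mem_ball γ] with z hz
  rw [delOf]
  linear_combination (-f z) * weight_neg_mul_weight γ hz + (((1 - ‖z‖ ^ 2) ^ (-γ) : ℝ) : ℂ) *
    (((1 - ‖z‖ ^ 2) ^ γ : ℝ) : ℂ) * ((f z - g z) / 2) * Complex.I_sq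

lemma ae_eq_delBarOf_weight (f g : ℂ → ℂ) : g =ᵐ[diskMeasure γ] fun z =>
    (((1 - ‖z‖ ^ 2) ^ (-γ) : ℝ) : ℂ) *
      delBarOf (fun z => (((1 - ‖z‖ ^ 2) ^ γ : ℝ) : ℂ) * (f z + g z))
        (fun z => (((1 - ‖z‖ ^ 2) ^ γ : ℝ) : ℂ) * (Complex.I * (f z - g z))) z := by
  filter_upwards [ae_diskMeasure_mem_ball γ] with z hz
  rw [delBarOf]
  linear_combination (-g z) * weight_neg_mul_weight γ hz - (((1 - ‖z‖ ^ 2) ^ (-γ) : ℝ) : ℂ) *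
    (((1 - ‖z‖ ^ 2) ^ γ : ℝ) : ℂ) * ((f z - g z) / 2) * Complex.I_sq

lemma IsWeightedGrad.isGradPair [Fact (-1 < -γ)] {u f g : DiskSpace γ}
    (h : IsWeightedGrad γ u f g) : IsGradPair f g :=
  isGradPair_of_isH01 h (ae_eq_delOf_weight f g) (ae_eq_delBarOf_weight f g)

end GradientRelations

end DiskXRay
end

/-! ### A priori estimates comparing the ∂ and ∂̄ parts of a weighted gradient. -/

noncomputable section
namespace DiskXRay

section Estimates

set_option linter.unusedSectionVars false

open MvPolynomial (pderiv)

/-! ### A priori estimates for polynomials -/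

lemma conjPoly_pderiv (P : MvPolynomial (Fin 2) ℂ) :
    conjPoly (pderiv 0 P) = pderiv 1 (conjPoly P) ∧ conjPoly (pderiv 1 P) = pderiv 0 (conjPoly P) := by
  induction P using MvPolynomial.induction_on with
  | C c => simp
  | add P Q hP hQ => simp [hP.1, hP.2, hQ.1, hQ.2]
  | mul_X P i hP =>
    fin_cases i <;> simp [Derivation.leibniz, hP.1, hP.2, MvPolynomial.pderiv_X]

lemma conjPoly_conjPoly (P : MvPolynomial (Fin 2) ℂ) : conjPoly (conjPoly P) = P := by
  induction P using MvPolynomial.induction_on with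
  | C c => simp
  | add P Q hP hQ => rw [map_add, map_add, hP, hQ]
  | mul_X P i hP =>
    rw [map_mul, map_mul, hP]
    fin_cases i <;> simp

@[simp] lemma conjPoly_weightPoly : conjPoly weightPoly = weightPoly := by
  rw [weightPoly, map_sub, map_mul, conjPoly_X0, conjPoly_X1, map_one, mul_comm]

lemma conjPoly_C_real (γ : ℝ) :
    conjPoly (MvPolynomial.C (γ + 1 : ℂ)) = MvPolynomial.C (γ + 1 : ℂ) := by
  rw [conjPoly_C, map_add, map_one, Complex.conj_ofReal]

lemma conjPoly_wirtPoly (γ : ℝ) (P : MvPolynomial (Fin 2) ℂ) :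
    conjPoly (wirtPoly γ P) = wirtBarPoly γ (conjPoly P) := by
  rw [wirtPoly, wirtBarPoly, map_sub, map_mul, map_mul, map_mul, conjPoly_weightPoly, conjPoly_C_real,
    conjPoly_X1, (conjPoly_pderiv P).1]

lemma conjPoly_wirtBarPoly (γ : ℝ) (P : MvPolynomial (Fin 2) ℂ) :
    conjPoly (wirtBarPoly γ P) = wirtPoly γ (conjPoly P) := by
  rw [wirtPoly, wirtBarPoly, map_sub, map_mul, map_mul, map_mul, conjPoly_weightPoly, conjPoly_C_real,
    conjPoly_X0, (conjPoly_pderiv P).2]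

lemma pderiv_weightPoly :
    pderiv 0 weightPoly = -MvPolynomial.X 1 ∧ pderiv 1 weightPoly = -MvPolynomial.X 0 := by
  constructor <;> simp [weightPoly, MvPolynomial.pderiv_X, Derivation.leibniz]

/-- The conjugate of `z ∂ - z̄ ∂̄` applied to `P`, as a function of `R = P̄`. -/
def angularPoly (R : MvPolynomial (Fin 2) ℂ) : MvPolynomial (Fin 2) ℂ :=
  MvPolynomial.X 1 * pderiv 1 R - MvPolynomial.X 0 * pderiv 0 R

/-- With R = P̄ the left side is the squared modulus of d^{-γ} ∂(d^{γ+1} P). Integration by parts is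
done as an identity of polynomials: the last bracket is a combination of values of the two
operators, whose integrals against d^γ vanish. -/
lemma wirtPoly_mul_wirtBarPoly (γ : ℝ) (P R : MvPolynomial (Fin 2) ℂ) :
    wirtPoly γ P * wirtBarPoly γ R = weightPoly * P * angularPoly R +
      MvPolynomial.C (γ + 1 : ℂ) * (weightPoly * P * R) +
      (weightPoly * pderiv 1 P) * (weightPoly * pderiv 0 R) +
      (wirtPoly γ (weightPoly * P * pderiv 1 R) - wirtBarPoly γ (weightPoly * P * pderiv 0 R) -
        MvPolynomial.C (γ + 1 : ℂ) * wirtPoly γ (MvPolynomial.X 0 * P * R)) := by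
  simp only [wirtPoly, wirtBarPoly, angularPoly, Derivation.leibniz, smul_eq_mul,
    pderiv_weightPoly.1, pderiv_weightPoly.2, pderiv_comm R, MvPolynomial.pderiv_X_self]
  rw [weightPoly]
  ring

lemma wirtBarPoly_mul_wirtPoly (γ : ℝ) (P R : MvPolynomial (Fin 2) ℂ) :
    wirtBarPoly γ P * wirtPoly γ R = -(weightPoly * P * angularPoly R) +
      MvPolynomial.C (γ + 1 : ℂ) * (weightPoly * P * R) +
      (weightPoly * pderiv 0 P) * (weightPoly * pderiv 1 R) +
      (wirtBarPoly γ (weightPoly * P * pderiv 0 R) - wirtPoly γ (weightPoly * P * pderiv 1 R) -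
        MvPolynomial.C (γ + 1 : ℂ) * wirtBarPoly γ (MvPolynomial.X 1 * P * R)) := by
  simp only [wirtPoly, wirtBarPoly, angularPoly, Derivation.leibniz, smul_eq_mul,
    pderiv_weightPoly.1, pderiv_weightPoly.2, pderiv_comm R, MvPolynomial.pderiv_X_self]
  rw [weightPoly]
  ring

/-- For R = P̄ this compares the two squared norms: up to terms of zero integral they differ by γ
times an angular term, so that they agree when γ = 0. -/
lemma wirtBarPoly_sub_wirtPoly (γ : ℝ) (P R : MvPolynomial (Fin 2) ℂ) :
    wirtBarPoly γ P * wirtPoly γ R = wirtPoly γ P * wirtBarPoly γ R +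
      MvPolynomial.C (γ : ℂ) * (weightPoly * P * angularPoly R) +
      (wirtBarPoly γ (weightPoly * P * pderiv 0 R) - wirtPoly γ (weightPoly * P * pderiv 1 R) +
        MvPolynomial.C (γ + 1 : ℂ) * (wirtPoly γ (MvPolynomial.X 0 * P * R) -
          wirtBarPoly γ (MvPolynomial.X 1 * P * R))) := by
  simp only [wirtPoly, wirtBarPoly, angularPoly, Derivation.leibniz, smul_eq_mul,
    pderiv_weightPoly.1, pderiv_weightPoly.2, pderiv_comm R, MvPolynomial.pderiv_X_self]
  rw [weightPoly, map_add, map_one]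
  ring

variable {γ : ℝ} [hγ : Fact (-1 < γ)]

variable (γ) in
/-- The functional `Q ↦ ∫ Q d^γ`. -/
def diskInt : MvPolynomial (Fin 2) ℂ →ₗ[ℂ] ℂ :=
  (innerₛₗ ℂ (polyLp γ 1)).comp (polyLp γ)

lemma diskInt_eq (Q : MvPolynomial (Fin 2) ℂ) : diskInt γ Q = ∫ z, evalConj Q z ∂diskMeasure γ := by
  change inner ℂ (polyLp γ 1) (polyLp γ Q) = _
  rw [inner_eq_integral (polyLp_ae_eq 1) (polyLp_ae_eq Q)]
  simp

lemma inner_polyLp (P Q : MvPolynomial (Fin 2) ℂ) :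
    inner ℂ (polyLp γ P) (polyLp γ Q) = diskInt γ (Q * conjPoly P) := by
  rw [inner_eq_integral (polyLp_ae_eq P) (polyLp_ae_eq Q), diskInt_eq]
  simp_rw [evalConj_mul, evalConj_conjPoly, mul_comm]

/-- Orthogonality of the ∂ part of a weighted gradient to the constants. -/
lemma diskInt_wirtPoly [Fact (-1 < -γ)] (Q : MvPolynomial (Fin 2) ℂ) :
    diskInt γ (wirtPoly γ Q) = 0 := by
  have h := mem_bergman_orthogonal_iff.1 (isWeightedGrad_poly (γ := γ) Q).isGradPair.left 0
  rwa [zMono, pow_zero, pow_zero, mul_one] at h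

lemma diskInt_wirtBarPoly [Fact (-1 < -γ)] (Q : MvPolynomial (Fin 2) ℂ) :
    diskInt γ (wirtBarPoly γ Q) = 0 := by
  have h := mem_antiBergman_orthogonal_iff.1 (isWeightedGrad_poly (γ := γ) Q).isGradPair.right 0
  rwa [zMono, pow_zero, pow_zero, mul_one] at h

lemma diskInt_mul_conjPoly (P : MvPolynomial (Fin 2) ℂ) :
    (diskInt γ (P * conjPoly P)).re = ‖polyLp γ P‖ ^ 2 := by
  rw [← inner_polyLp]
  exact inner_self_eq_norm_sq (𝕜 := ℂ) _

lemma diskInt_weight_nonneg (P : MvPolynomial (Fin 2) ℂ) :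
    0 ≤ (diskInt γ (weightPoly * P * conjPoly P)).re := by
  have h : diskInt γ (weightPoly * P * conjPoly P) =
      ∫ z, (((1 - ‖z‖ ^ 2) * ‖evalConj P z‖ ^ 2 : ℝ) : ℂ) ∂diskMeasure γ := by
    rw [diskInt_eq]
    refine integral_congr_ae (Eventually.of_forall fun z => ?_)
    simp only [evalConj_mul, evalConj_weightPoly, evalConj_conjPoly]
    rw [mul_assoc, Complex.mul_conj, Complex.normSq_eq_norm_sq]
    push_cast
    ring
  rw [h, integral_complex_ofReal, Complex.ofReal_re]
  refine integral_nonneg_of_ae ?_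
  filter_upwards [ae_diskMeasure_mem_ball γ] with z hz
  have := weight_pos hz
  simp only [Pi.zero_apply]
  positivity

lemma norm_weight_mul_le (P : MvPolynomial (Fin 2) ℂ) :
    ‖polyLp γ (weightPoly * P)‖ ^ 2 ≤ (diskInt γ (weightPoly * P * conjPoly P)).re := by
  -- Applied to z̄ P because d |z|² = d - d², so that positivity reads ∫ d² |P|² d^γ ≤ ∫ d |P|² d^γ.
  have h := diskInt_weight_nonneg (γ := γ) (MvPolynomial.X 1 * P)
  have e : weightPoly * (MvPolynomial.X 1 * P) * conjPoly (MvPolynomial.X 1 * P) =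
      weightPoly * P * conjPoly P - weightPoly * P * conjPoly (weightPoly * P) := by
    rw [map_mul, map_mul, conjPoly_X1, conjPoly_weightPoly, weightPoly]
    ring
  rw [e, map_sub, Complex.sub_re, diskInt_mul_conjPoly] at h
  linarith

/-- S is the real part of the integral of d P times the conjugate of z∂P - z̄∂̄P, and X, Y are the
squared norms of d ∂̄P and d ∂P. S has no sign, but it enters the last two identities with opposite
signs, which bounds it on both sides. -/
lemma norm_wirt_identities [Fact (-1 < -γ)] (P : MvPolynomial (Fin 2) ℂ) :
    ∃ S X Y : ℝ, 0 ≤ X ∧ 0 ≤ Y ∧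
      ‖polyLp γ (wirtBarPoly γ P)‖ ^ 2 = ‖polyLp γ (wirtPoly γ P)‖ ^ 2 + γ * S ∧
      ‖polyLp γ (wirtPoly γ P)‖ ^ 2 =
        S + (γ + 1) * (diskInt γ (weightPoly * P * conjPoly P)).re + X ∧
      ‖polyLp γ (wirtBarPoly γ P)‖ ^ 2 =
        -S + (γ + 1) * (diskInt γ (weightPoly * P * conjPoly P)).re + Y := by
  have hC : ∀ (c : ℝ) Q, (diskInt γ (MvPolynomial.C (c : ℂ) * Q)).re = c * (diskInt γ Q).re := by
    intro c Q
    rw [← MvPolynomial.smul_eq_C_mul, map_smul, smul_eq_mul, Complex.re_ofReal_mul]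
  have hC0 : ∀ (c : ℂ) Q, diskInt γ (MvPolynomial.C c * Q) = c * diskInt γ Q := by
    intro c Q
    rw [← MvPolynomial.smul_eq_C_mul, map_smul, smul_eq_mul]
  have hg : ((γ + 1 : ℝ) : ℂ) = (γ : ℂ) + 1 := by push_cast; rfl
  refine ⟨(diskInt γ (weightPoly * P * angularPoly (conjPoly P))).re,
    ‖polyLp γ (weightPoly * pderiv 1 P)‖ ^ 2, ‖polyLp γ (weightPoly * pderiv 0 P)‖ ^ 2,
    sq_nonneg _, sq_nonneg _, ?_, ?_, ?_⟩
  · rw [← diskInt_mul_conjPoly, ← diskInt_mul_conjPoly, conjPoly_wirtPoly, conjPoly_wirtBarPoly,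
      wirtBarPoly_sub_wirtPoly, map_add, map_add, Complex.add_re, Complex.add_re, hC, ← hg]
    simp only [map_add, map_sub, hC0, diskInt_wirtPoly, diskInt_wirtBarPoly]
    simp
  · rw [← diskInt_mul_conjPoly, ← diskInt_mul_conjPoly, conjPoly_wirtPoly,
      wirtPoly_mul_wirtBarPoly, map_add, map_add, map_add, Complex.add_re, Complex.add_re,
      Complex.add_re, ← hg, hC, map_mul conjPoly, conjPoly_weightPoly, (conjPoly_pderiv P).2]
    simp only [map_sub, hC0, diskInt_wirtPoly, diskInt_wirtBarPoly]
    simp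
  · rw [← diskInt_mul_conjPoly, ← diskInt_mul_conjPoly, conjPoly_wirtBarPoly,
      wirtBarPoly_mul_wirtPoly, map_add, map_add, map_add, Complex.add_re, Complex.add_re,
      Complex.add_re, ← hg, hC, map_mul conjPoly, conjPoly_weightPoly, (conjPoly_pderiv P).1,
      map_neg, Complex.neg_re]
    simp only [map_sub, hC0, diskInt_wirtPoly, diskInt_wirtBarPoly]
    simp

/-- Let a and b be the squared norms of the ∂ and ∂̄ parts. Then b = a + γ S with -b ≤ S ≤ a. For γ
≥ 0 this gives b ≤ (1 + γ) a and a ≤ (1 + γ) b; for γ < 0 it gives (1 + γ) b ≤ a and (1 + γ) a ≤ b.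
Adding the formulas for a and b cancels S and bounds the weighted norm of P. -/
lemma exists_wirt_bound [Fact (-1 < -γ)] : ∃ C : ℝ, ∀ P : MvPolynomial (Fin 2) ℂ,
    ‖polyLp γ (wirtBarPoly γ P)‖ ^ 2 ≤ C * ‖polyLp γ (wirtPoly γ P)‖ ^ 2 ∧
    ‖polyLp γ (wirtPoly γ P)‖ ^ 2 ≤ C * ‖polyLp γ (wirtBarPoly γ P)‖ ^ 2 ∧
    ‖polyLp γ (weightPoly * P)‖ ^ 2 ≤ C * ‖polyLp γ (wirtPoly γ P)‖ ^ 2 := by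
  have hg : 0 < γ + 1 := by linarith [hγ.out]
  obtain ⟨C, hC1, hC⟩ : ∃ C : ℝ, 0 ≤ C ∧ ∀ P : MvPolynomial (Fin 2) ℂ,
    ‖polyLp γ (wirtBarPoly γ P)‖ ^ 2 ≤ C * ‖polyLp γ (wirtPoly γ P)‖ ^ 2 ∧
    ‖polyLp γ (wirtPoly γ P)‖ ^ 2 ≤ C * ‖polyLp γ (wirtBarPoly γ P)‖ ^ 2 := by
    refine ⟨max (γ + 1) (1 / (γ + 1)), by positivity, fun P => ?_⟩
    obtain ⟨S, X, Y, hX, hY, h1, h2, h3⟩ := norm_wirt_identities (γ := γ) P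
    have hN := (sq_nonneg _).trans (norm_weight_mul_le (γ := γ) P)
    have ha := sq_nonneg ‖polyLp γ (wirtPoly γ P)‖
    have hb := sq_nonneg ‖polyLp γ (wirtBarPoly γ P)‖
    generalize ‖polyLp γ (wirtPoly γ P)‖ ^ 2 = a at *
    generalize ‖polyLp γ (wirtBarPoly γ P)‖ ^ 2 = b at *
    generalize (diskInt γ (weightPoly * P * conjPoly P)).re = N at *
    have hgN : 0 ≤ (γ + 1) * N := by positivity
    have hS1 : S ≤ a := by linarith
    have hS2 : -S ≤ b := by linarith
    rcases le_or_gt 0 γ with h0 | h0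
    · have k1 : b ≤ (γ + 1) * a := by nlinarith
      have k2 : a ≤ (γ + 1) * b := by nlinarith
      exact ⟨k1.trans (mul_le_mul_of_nonneg_right (le_max_left _ _) ha),
        k2.trans (mul_le_mul_of_nonneg_right (le_max_left _ _) hb)⟩
    · have k1 : b ≤ 1 / (γ + 1) * a := by
        rw [one_div, ← div_eq_inv_mul, le_div_iff₀ hg]; nlinarith
      have k2 : a ≤ 1 / (γ + 1) * b := by
        rw [one_div, ← div_eq_inv_mul, le_div_iff₀ hg]; nlinarith
      exact ⟨k1.trans (mul_le_mul_of_nonneg_right (le_max_right _ _) ha),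
        k2.trans (mul_le_mul_of_nonneg_right (le_max_right _ _) hb)⟩
  -- The second constant comes from 2 (γ + 1) N ≤ a + b ≤ (1 + C) a, where N is the integral of d
  -- |P|² against d^γ.
  refine ⟨max C ((1 + C) / (2 * (γ + 1))), fun P => ⟨(hC P).1.trans ?_, (hC P).2.trans ?_, ?_⟩⟩
  · exact mul_le_mul_of_nonneg_right (le_max_left _ _) (sq_nonneg _)
  · exact mul_le_mul_of_nonneg_right (le_max_left _ _) (sq_nonneg _)
  · refine le_trans ?_ (mul_le_mul_of_nonneg_right (le_max_right _ _) (sq_nonneg _))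
    obtain ⟨S, X, Y, hX, hY, h1, h2, h3⟩ := norm_wirt_identities (γ := γ) P
    have hN := norm_weight_mul_le (γ := γ) P
    have h4 := (hC P).1
    rw [div_mul_eq_mul_div, le_div_iff₀ (by positivity)]
    nlinarith

end Estimates

end DiskXRay
end

/-! ### Every function orthogonal to A or to Ā is a component of a weighted gradient. -/

noncomputable section
namespace DiskXRay

section Existence

set_option linter.unusedSectionVars false

open MvPolynomial (pderiv)

/-! ### Existence of weighted gradients -/

lemma wirtPoly_zMono (γ : ℝ) (a b : ℕ) :
    wirtPoly γ (zMono a b) = MvPolynomial.C (a : ℂ) * zMono (a - 1) b -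
      MvPolynomial.C (a + γ + 1 : ℂ) * zMono a (b + 1) := by
  have h : pderiv 0 (zMono a b) = MvPolynomial.C (a : ℂ) * zMono (a - 1) b := by
    simp [zMono, Derivation.leibniz, MvPolynomial.pderiv_X, Derivation.leibniz_pow]
    ring
  rw [wirtPoly, h, weightPoly]
  cases a with
  | zero =>
    simp only [zMono, Nat.cast_zero, map_zero, zero_mul, map_add, map_one]
    ring
  | succ n =>
    simp only [zMono, Nat.add_sub_cancel, map_add, map_one]
    ring

/-- Induction on the power of z̄: modulo a weighted derivative, z^a z̄^{b+1} is a multiple of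
z^{a-1} z̄^b by `wirtPoly_zMono`, the divisor a + γ + 1 being positive. -/
lemma exists_wirtPoly_add_zMono {γ : ℝ} (hγ : -1 < γ) (b : ℕ) : ∀ a : ℕ,
    ∃ Q A, zMono a b = wirtPoly γ Q + A ∧ A ∈ Submodule.span ℂ (Set.range fun n => zMono n 0) := by
  induction b with
  | zero => exact fun a => ⟨0, zMono a 0, by simp [wirtPoly], Submodule.subset_span ⟨a, rfl⟩⟩
  | succ b ih =>
    intro a
    -- For a = 0 the truncated exponent is harmless, since the corresponding term carries the
    -- coefficient a.
    obtain ⟨Q, A, h, hA⟩ := ih (a - 1)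
    have hc : (a + γ + 1 : ℂ) ≠ 0 := by
      have : (0 : ℝ) < a + γ + 1 := by
        have := a.cast_nonneg (α := ℝ)
        linarith
      exact_mod_cast this.ne'
    have hlin : ∀ (c d : ℂ) (Q Q' : MvPolynomial (Fin 2) ℂ), wirtPoly γ
        (MvPolynomial.C c * Q + MvPolynomial.C d * Q') = MvPolynomial.C c * wirtPoly γ Q +
          MvPolynomial.C d * wirtPoly γ Q' := by
      intro c d Q Q'
      simp only [wirtPoly, map_add, MvPolynomial.pderiv_C_mul]
      ring
    refine ⟨MvPolynomial.C (a / (a + γ + 1) : ℂ) * Q + MvPolynomial.C (-1 / (a + γ + 1) : ℂ) *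
      zMono a b, (a / (a + γ + 1) : ℂ) • A, ?_, Submodule.smul_mem _ _ hA⟩
    rw [hlin, wirtPoly_zMono, h, MvPolynomial.smul_eq_C_mul]
    have e1 : (MvPolynomial.C (-1 / (a + γ + 1) : ℂ) : MvPolynomial (Fin 2) ℂ) *
        MvPolynomial.C (a + γ + 1 : ℂ) = -1 := by
      rw [← MvPolynomial.C_mul, div_mul_cancel₀ _ hc]; simp
    have e2 : (MvPolynomial.C (-1 / (a + γ + 1) : ℂ) : MvPolynomial (Fin 2) ℂ) *
        MvPolynomial.C (a : ℂ) = -MvPolynomial.C (a / (a + γ + 1) : ℂ) := by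
      rw [← MvPolynomial.C_mul, ← MvPolynomial.C_neg]; congr 1; ring
    linear_combination zMono a (b + 1) * e1 - (wirtPoly γ Q + A) * e2

/-- Every polynomial is the sum of a weighted derivative and of an analytic polynomial. -/
lemma exists_wirtPoly_add {γ : ℝ} (hγ : -1 < γ) (P : MvPolynomial (Fin 2) ℂ) :
    ∃ Q A, P = wirtPoly γ Q + A ∧ A ∈ Submodule.span ℂ (Set.range fun n => zMono n 0) := by
  have hP : P ∈ Submodule.span ℂ (Set.range fun ab : ℕ × ℕ => zMono ab.1 ab.2) := by
    rw [span_zMono]; trivial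
  induction hP using Submodule.span_induction with
  | mem x hx =>
    obtain ⟨⟨a, b⟩, rfl⟩ := hx
    exact exists_wirtPoly_add_zMono hγ b a
  | zero => exact ⟨0, 0, by simp [wirtPoly], Submodule.zero_mem _⟩
  | add x y _ _ hx hy =>
    obtain ⟨Q, A, rfl, hA⟩ := hx
    obtain ⟨Q', A', rfl, hA'⟩ := hy
    refine ⟨Q + Q', A + A', ?_, Submodule.add_mem _ hA hA'⟩
    simp only [wirtPoly, map_add]
    ring
  | smul c x _ hx =>
    obtain ⟨Q, A, rfl, hA⟩ := hx
    refine ⟨c • Q, c • A, ?_, Submodule.smul_mem _ _ hA⟩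
    simp only [wirtPoly, Derivation.map_smul]
    simp only [MvPolynomial.smul_eq_C_mul]
    ring

variable {γ : ℝ} [hγ : Fact (-1 < γ)]

/-- Since `f` and `T Q` lie in `Bᗮ` and `A` gives an element of `B`, Pythagoras shows that `T Q` is
at least as close to `f` as the polynomial `P`; density of the polynomials thus becomes density of
the values of `T` in `Bᗮ`. -/
lemma exists_seq_of_add {B : Submodule ℂ (DiskSpace γ)} {T : MvPolynomial (Fin 2) ℂ →
    MvPolynomial (Fin 2) ℂ} (hT : ∀ Q, polyLp γ (T Q) ∈ Bᗮ)
    (h : ∀ P, ∃ Q A, P = T Q + A ∧ polyLp γ A ∈ B) {f : DiskSpace γ} (hf : f ∈ Bᗮ) :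
    ∃ Q : ℕ → MvPolynomial (Fin 2) ℂ, Tendsto (fun n => polyLp γ (T (Q n))) atTop (𝓝 f) := by
  have hf' : f ∈ closure (Set.range fun Q => polyLp γ (T Q)) := by
    rw [Metric.mem_closure_range_iff]
    intro ε hε
    have hd : f ∈ (LinearMap.range (polyLp γ)).topologicalClosure := by
      rw [dense_polyLp]; trivial
    obtain ⟨y, ⟨P, rfl⟩, hP⟩ := Metric.mem_closure_iff.1 hd ε hε
    obtain ⟨Q, A, rfl, hA⟩ := h P
    refine ⟨Q, lt_of_le_of_lt ?_ hP⟩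
    rw [dist_eq_norm, dist_eq_norm, map_add, ← sub_sub]
    have ho : inner ℂ (f - polyLp γ (T Q)) (polyLp γ A) = 0 :=
      Submodule.inner_left_of_mem_orthogonal hA (Submodule.sub_mem _ hf (hT Q))
    refine (pow_le_pow_iff_left₀ (norm_nonneg _) (norm_nonneg _) two_ne_zero).1 ?_
    rw [@norm_sub_sq ℂ _ _ _ _ (f - polyLp γ (T Q)) (polyLp γ A), ho]
    simp
  obtain ⟨x, hx, hlim⟩ := mem_closure_iff_seq_limit.1 hf'
  choose Q hQ using hx
  exact ⟨Q, hlim.congr fun n => (hQ n).symm⟩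

/-- By linearity the estimate applies to differences, so it carries the Cauchy property from `S` to
`S'`. -/
lemma exists_tendsto_of_bound {S S' : MvPolynomial (Fin 2) ℂ →ₗ[ℂ] DiskSpace γ} {C : ℝ}
    (h : ∀ P, ‖S' P‖ ^ 2 ≤ C * ‖S P‖ ^ 2) {Q : ℕ → MvPolynomial (Fin 2) ℂ} {f : DiskSpace γ}
    (hQ : Tendsto (fun n => S (Q n)) atTop (𝓝 f)) :
    ∃ g, Tendsto (fun n => S' (Q n)) atTop (𝓝 g) := by
  have hC : ∀ P, ‖S' P‖ ≤ Real.sqrt (max C 0) * ‖S P‖ := fun P => by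
    refine (pow_le_pow_iff_left₀ (norm_nonneg _) (by positivity) two_ne_zero).1 ?_
    rw [mul_pow, Real.sq_sqrt (le_max_right _ _)]
    exact (h P).trans (mul_le_mul_of_nonneg_right (le_max_left _ _) (sq_nonneg _))
  refine cauchySeq_tendsto_of_complete ?_
  have hc := hQ.cauchySeq
  rw [Metric.cauchySeq_iff'] at hc ⊢
  intro ε hε
  obtain ⟨N, hN⟩ := hc (ε / (Real.sqrt (max C 0) + 1)) (by positivity)
  refine ⟨N, fun n hn => ?_⟩
  have h1 := hN n hn
  rw [dist_eq_norm, ← map_sub, lt_div_iff₀ (by positivity)] at h1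
  rw [dist_eq_norm, ← map_sub]
  refine (hC _).trans_lt (lt_of_le_of_lt ?_ h1)
  rw [mul_comm]
  exact mul_le_mul_of_nonneg_left (by linarith) (norm_nonneg _)

/-- A diagonal choice: for each n, one test function within 1/(n + 1) of the n-th weighted gradient
in all three norms. -/
lemma isWeightedGrad_of_tendsto {u f g : DiskSpace γ} {U F G : ℕ → DiskSpace γ}
    (h : ∀ n, IsWeightedGrad γ (U n) (F n) (G n)) (hU : Tendsto U atTop (𝓝 u))
    (hF : Tendsto F atTop (𝓝 f)) (hG : Tendsto G atTop (𝓝 g)) : IsWeightedGrad γ u f g := by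
  have key : ∀ n, ∃ φ : ℂ → ℂ,
      (ContDiff ℝ ∞ φ ∧ HasCompactSupport φ ∧ tsupport φ ⊆ Metric.ball 0 1) ∧
      eLpNorm (fun z => φ z - (((1 - ‖z‖ ^ 2) ^ γ : ℝ) : ℂ) * U n z) 2 (diskMeasure (-γ)) <
        ENNReal.ofReal (1 / (n + 1)) ∧
      eLpNorm (fun z => fderiv ℝ φ z 1 - (((1 - ‖z‖ ^ 2) ^ γ : ℝ) : ℂ) * (F n z + G n z)) 2
        (diskMeasure (-γ)) < ENNReal.ofReal (1 / (n + 1)) ∧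
      eLpNorm (fun z => fderiv ℝ φ z Complex.I -
        (((1 - ‖z‖ ^ 2) ^ γ : ℝ) : ℂ) * (Complex.I * (F n z - G n z))) 2
        (diskMeasure (-γ)) < ENNReal.ofReal (1 / (n + 1)) := fun n => by
    obtain ⟨φ, hφ, h0, h1, h2⟩ := (h n).approx
    have hε : 0 < ENNReal.ofReal (1 / ((n : ℝ) + 1)) := by
      rw [ENNReal.ofReal_pos]; positivity
    obtain ⟨k, hk⟩ := ((h0.eventually (gt_mem_nhds hε)).and ((h1.eventually (gt_mem_nhds hε)).and
      (h2.eventually (gt_mem_nhds hε)))).exists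
    exact ⟨φ k, hφ k, hk⟩
  choose φ hφ h0 h1 h2 using key
  have hlim : Tendsto (fun n : ℕ => ENNReal.ofReal (1 / ((n : ℝ) + 1))) atTop (𝓝 0) := by
    have := ENNReal.tendsto_ofReal tendsto_one_div_add_atTop_nhds_zero_nat
    rwa [ENNReal.ofReal_zero] at this
  have step : ∀ {ψ : ℕ → ℂ → ℂ} {V : ℕ → DiskSpace γ} {v : DiskSpace γ},
      (∀ n, Continuous (ψ n)) → Tendsto V atTop (𝓝 v) →
      (∀ n : ℕ, eLpNorm (fun z => ψ n z - (((1 - ‖z‖ ^ 2) ^ γ : ℝ) : ℂ) * V n z) 2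
        (diskMeasure (-γ)) < ENNReal.ofReal (1 / (n + 1))) →
      Tendsto (fun n => eLpNorm (fun z => ψ n z - (((1 - ‖z‖ ^ 2) ^ γ : ℝ) : ℂ) * v z) 2
        (diskMeasure (-γ))) atTop (𝓝 0) := by
    intro ψ V v hc hV hψ
    rw [Lp.tendsto_Lp_iff_tendsto_eLpNorm'] at hV
    have hs := hlim.add hV
    rw [add_zero] at hs
    have m : ∀ w : DiskSpace γ, AEStronglyMeasurable
        (fun z => (((1 - ‖z‖ ^ 2) ^ γ : ℝ) : ℂ) * w z) (diskMeasure (-γ)) := fun w =>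
      ((memLp_diskMeasure_neg_iff γ _).2 (Lp.memLp w)).aestronglyMeasurable
    refine tendsto_of_tendsto_of_tendsto_of_le_of_le tendsto_const_nhds hs (fun _ => zero_le)
      fun n => ?_
    have e : (fun z => ψ n z - (((1 - ‖z‖ ^ 2) ^ γ : ℝ) : ℂ) * v z) =
        (fun z => ψ n z - (((1 - ‖z‖ ^ 2) ^ γ : ℝ) : ℂ) * V n z) +
          fun z => (((1 - ‖z‖ ^ 2) ^ γ : ℝ) : ℂ) * (V n - v : ℂ → ℂ) z := by
      funext z; simp only [Pi.add_apply, Pi.sub_apply]; ring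
    simp only
    rw [e]
    refine (eLpNorm_add_le ((hc n).aestronglyMeasurable.sub (m (V n))) ?_ (by simp)).trans
      (add_le_add (hψ n).le ?_)
    · refine ((m (V n)).sub (m v)).congr (Eventually.of_forall fun z => ?_)
      simp only [Pi.sub_apply]; ring
    · exact (eLpNorm_diskMeasure_neg γ _).le
  have hd : ∀ n w, Continuous fun z => fderiv ℝ (φ n) z w := fun n w =>
    ((hφ n).1.continuous_fderiv (by simp)).clm_apply continuous_const
  have ae_add := fun a b : DiskSpace γ => (diskMeasure_ac (-γ) γ).ae_le (Lp.coeFn_add a b)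
  have ae_sub := fun a b : DiskSpace γ => (diskMeasure_ac (-γ) γ).ae_le (Lp.coeFn_sub a b)
  have ae_smul := fun (c : ℂ) (b : DiskSpace γ) =>
    (diskMeasure_ac (-γ) γ).ae_le (Lp.coeFn_smul c b)
  refine isWeightedGrad_mk φ hφ (step (fun n => (hφ n).1.continuous) hU h0) ?_ ?_
  · refine (step (fun n => hd n 1) (hF.add hG) fun n => ?_).congr fun n => eLpNorm_congr_ae ?_
    · refine lt_of_eq_of_lt (eLpNorm_congr_ae ?_) (h1 n)
      filter_upwards [ae_add (F n) (G n)] with z hz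
      rw [hz, Pi.add_apply]
    · filter_upwards [ae_add f g] with z hz
      rw [hz, Pi.add_apply]
  · refine (step (fun n => hd n Complex.I) ((hF.sub hG).const_smul Complex.I) fun n => ?_).congr
      fun n => eLpNorm_congr_ae ?_
    · refine lt_of_eq_of_lt (eLpNorm_congr_ae ?_) (h2 n)
      filter_upwards [ae_smul Complex.I (F n - G n), ae_sub (F n) (G n)] with z hz hz'
      rw [hz, Pi.smul_apply, hz', Pi.sub_apply, smul_eq_mul]
    · filter_upwards [ae_smul Complex.I (f - g), ae_sub f g] with z hz hz'
      rw [hz, Pi.smul_apply, hz', Pi.sub_apply, smul_eq_mul]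

variable (γ) in
/-- `wirtPoly` with values in `L²_γ`. -/
def wirtLp : MvPolynomial (Fin 2) ℂ →ₗ[ℂ] DiskSpace γ where
  toFun P := polyLp γ (wirtPoly γ P)
  map_add' P Q := by
    rw [← map_add]; congr 1; simp only [wirtPoly, map_add]; ring
  map_smul' c P := by
    rw [RingHom.id_apply, ← map_smul]; congr 1
    simp only [wirtPoly, Derivation.map_smul]; simp only [MvPolynomial.smul_eq_C_mul]; ring

variable (γ) in
/-- `wirtBarPoly` with values in `L²_γ`. -/
def wirtBarLp : MvPolynomial (Fin 2) ℂ →ₗ[ℂ] DiskSpace γ where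
  toFun P := polyLp γ (wirtBarPoly γ P)
  map_add' P Q := by
    rw [← map_add]; congr 1; simp only [wirtBarPoly, map_add]; ring
  map_smul' c P := by
    rw [RingHom.id_apply, ← map_smul]; congr 1
    simp only [wirtBarPoly, Derivation.map_smul]; simp only [MvPolynomial.smul_eq_C_mul]; ring

variable [Fact (-1 < -γ)]

lemma polyLp_mem_bergman {A : MvPolynomial (Fin 2) ℂ}
    (hA : A ∈ Submodule.span ℂ (Set.range fun n => zMono n 0)) : polyLp γ A ∈ bergman γ := by
  have h : Submodule.span ℂ (Set.range fun n => zMono n 0) ≤ (bergman γ).comap (polyLp γ) :=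
    Submodule.span_le.2 (by rintro _ ⟨n, rfl⟩; exact zMono_mem_bergman n)
  exact h hA

/-- The ∂ parts for h = d^{γ+1} Q are dense in Aᗮ, and the a priori bounds make the ∂̄ parts and
d^{-γ} h converge with them. Reaching every f is what yields equality of algebraic sums and not only
of their closures. -/
lemma exists_isWeightedGrad {f : DiskSpace γ} (hf : f ∈ (bergman γ)ᗮ) :
    ∃ u g, IsWeightedGrad γ u f g := by
  obtain ⟨Q, hQ⟩ := exists_seq_of_add (fun Q => (isWeightedGrad_poly Q).isGradPair.left)
    (fun P => by
      obtain ⟨Q, A, h, hA⟩ := exists_wirtPoly_add hγ.out P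
      exact ⟨Q, A, h, polyLp_mem_bergman hA⟩) hf
  obtain ⟨C, hC⟩ := exists_wirt_bound (γ := γ)
  obtain ⟨g, hg⟩ := exists_tendsto_of_bound (S := wirtLp γ) (S' := wirtBarLp γ)
    (fun P => (hC P).1) hQ
  obtain ⟨u, hu⟩ := exists_tendsto_of_bound (S := wirtLp γ)
    (S' := (polyLp γ).comp (LinearMap.mulLeft ℂ weightPoly)) (fun P => (hC P).2.2) hQ
  exact ⟨u, g, isWeightedGrad_of_tendsto (fun n => isWeightedGrad_poly (Q n)) hu hQ hg⟩

/-- Mirror image of `exists_isWeightedGrad`: density is transported by conjugation, and the ∂̄ part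
now controls the ∂ part. -/
lemma exists_isGradPair {g : DiskSpace γ} (hg : g ∈ (antiBergman γ)ᗮ) : ∃ f, IsGradPair f g := by
  obtain ⟨Q, hQ⟩ := exists_seq_of_add (fun Q => (isWeightedGrad_poly Q).isGradPair.right)
    (fun P => by
      obtain ⟨Q, A, h, hA⟩ := exists_wirtPoly_add hγ.out (conjPoly P)
      refine ⟨conjPoly Q, conjPoly A, ?_, ?_⟩
      · rw [← conjPoly_wirtPoly, ← map_add, ← h, conjPoly_conjPoly]
      · rw [← conjLp_polyLp]
        exact conjLp_mem_antiBergman (polyLp_mem_bergman hA)) hg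
  obtain ⟨C, hC⟩ := exists_wirt_bound (γ := γ)
  obtain ⟨f, hf⟩ := exists_tendsto_of_bound (S := wirtBarLp γ) (S' := wirtLp γ)
    (fun P => (hC P).2.1) hQ
  exact ⟨f, isGradPair_of_tendsto (fun n => (isWeightedGrad_poly (Q n)).isGradPair) hf hQ⟩

end Existence

end DiskXRay
end

/-! ### The ranges on tensor fields as sums of modes M^k T. -/

noncomputable section
namespace DiskXRay

section Tensors

set_option linter.unusedSectionVars false

/-! ### Transforms of tensor fields -/

variable {γ : ℝ} [hγ : Fact (-1 < γ)]

variable (γ) in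
/-- The transform of `f v^j`. -/
def xrayMod (j : ℤ) : DiskSpace γ →L[ℂ] DataSpace γ :=
  (modul γ j).toContinuousLinearMap.comp (xrayL γ)

lemma xrayMod_apply (j : ℤ) (u : DiskSpace γ) : xrayMod γ j u = modul γ j (xrayL γ u) := rfl

lemma rayIntegrand_zpow_mul (j : ℤ) (f : ℂ → ℂ) (p : ℝ × ℝ) (t : ℝ) :
    rayIntegrand γ (fun z v => v ^ j * f z) p t =
      direction p ^ j * rayIntegrand γ (fun z _ => f z) p t := by
  simp only [rayIntegrand]
  ring

lemma xrayMod_ae_eq (j : ℤ) {u : DiskSpace γ} {f : ℂ → ℂ} (hu : u =ᵐ[diskMeasure γ] f) :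
    xrayMod γ j u =ᵐ[dataMeasure γ] xray γ fun z v => v ^ j * f z := by
  filter_upwards [modul_ae_eq j (xrayL γ u), xrayL_ae_eq u, xrayFun_congr hu] with p h1 h2 h3
  rw [xrayMod_apply, h1, h2, h3, xrayFun, xray, xray, ← intervalIntegral.integral_const_mul]
  exact intervalIntegral.integral_congr fun t _ => (rayIntegrand_zpow_mul j f p t).symm

lemma coeFn_lp_sum {ι α : Type*} [MeasurableSpace α] {μ : Measure α} (s : Finset ι)
    (w : ι → Lp ℂ 2 μ) : (∑ i ∈ s, w i : Lp ℂ 2 μ) =ᵐ[μ] fun x => ∑ i ∈ s, w i x := by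
  classical
  induction s using Finset.induction_on with
  | empty =>
    simp only [Finset.sum_empty]
    exact Lp.coeFn_zero ℂ 2 μ
  | insert i s hi ih =>
    rw [Finset.sum_insert hi]
    filter_upwards [Lp.coeFn_add (w i) (∑ i ∈ s, w i), ih] with x h1 h2
    rw [h1, Pi.add_apply, h2, Finset.sum_insert hi]

/-- All transforms of tensor fields reduce to this: on unit vectors the integrand is a Laurent
polynomial in v, and powers of v leave the integral because v is constant along a chord. -/
lemma xray_sum {ι : Type*} (s : Finset ι) (k : ι → ℤ) {f : ι → ℂ → ℂ} {u : ι → DiskSpace γ}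
    (hu : ∀ i ∈ s, u i =ᵐ[diskMeasure γ] f i) {F : ℂ → ℂ → ℂ}
    (hF : ∀ z v, ‖v‖ = 1 → F z v = ∑ i ∈ s, v ^ k i * f i z) :
    (∀ᵐ p ∂dataMeasure γ,
      IntervalIntegrable (rayIntegrand γ F p) volume 0 (2 * Real.cos p.2)) ∧
    xray γ F =ᵐ[dataMeasure γ] (∑ i ∈ s, xrayMod γ (k i) (u i) : DataSpace γ) := by
  have hm : ∀ i ∈ s, MemLp (f i) 2 (diskMeasure γ) := fun i hi =>
    (memLp_congr_ae (hu i hi)).1 (Lp.memLp _)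
  have hR : ∀ p, rayIntegrand γ F p =
      fun t => ∑ i ∈ s, rayIntegrand γ (fun z v => v ^ k i * f i z) p t := fun p => by
    funext t
    simp only [rayIntegrand]
    rw [hF _ _ (norm_direction p), Finset.sum_mul]
  have hI : ∀ᵐ p ∂dataMeasure γ, ∀ i ∈ s, IntervalIntegrable
      (rayIntegrand γ (fun z v => v ^ k i * f i z) p) volume 0 (2 * Real.cos p.2) := by
    refine (Finset.eventually_all s).2 fun i hi => ?_
    filter_upwards [ae_intervalIntegrable_rayIntegrand (hm i hi)] with p hp
    refine (hp.const_mul (direction p ^ k i)).congr ?_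
    exact fun t _ => (rayIntegrand_zpow_mul _ _ p t).symm
  refine ⟨?_, ?_⟩
  · filter_upwards [hI] with p hp
    rw [hR]
    exact ⟨integrable_finsetSum s fun i hi => (hp i hi).1,
      integrable_finsetSum s fun i hi => (hp i hi).2⟩
  · have hx : ∀ᵐ p ∂dataMeasure γ, ∀ i ∈ s, xrayMod γ (k i) (u i) p =
        xray γ (fun z v => v ^ k i * f i z) p :=
      (Finset.eventually_all s).2 fun i hi => xrayMod_ae_eq (k i) (hu i hi)
    have hs : (∑ i ∈ s, xrayMod γ (k i) (u i) : DataSpace γ) =ᵐ[dataMeasure γ]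
        fun p => ∑ i ∈ s, xrayMod γ (k i) (u i) p := coeFn_lp_sum s _
    filter_upwards [hI, hx, hs] with p h1 h2 h3
    rw [h3, Finset.sum_congr rfl h2, xray, hR, intervalIntegral.integral_finsetSum h1]
    rfl

lemma conj_eq_zpow {v : ℂ} (hv : ‖v‖ = 1) : (starRingEnd ℂ) v = v ^ (-1 : ℤ) := by
  rw [zpow_neg_one, Complex.inv_eq_conj hv]

/-! #### The range on functions -/

lemma rangeFun_eq : rangeFun γ = (LinearMap.range (xrayMod γ 0).toLinearMap : Set (DataSpace γ)) := by
  ext w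
  constructor
  · rintro ⟨f, hf, hw⟩
    refine ⟨hf.toLp f, Lp.ext ?_⟩
    refine (xrayMod_ae_eq 0 (MemLp.coeFn_toLp hf)).trans ?_
    simp only [zpow_zero, one_mul]
    exact hw.symm
  · rintro ⟨u, rfl⟩
    refine ⟨u, Lp.memLp u, ?_⟩
    refine (xrayMod_ae_eq 0 (Filter.EventuallyEq.refl _ _)).trans ?_
    simp only [zpow_zero, one_mul]
    rfl

/-! #### The range on transverse-tracefree fields -/

variable (γ) in
/-- The range on transverse-tracefree fields, as a subspace. -/
def ttSpace (m : ℕ) : Submodule ℂ (DataSpace γ) :=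
  (bergman γ).map (xrayMod γ m).toLinearMap ⊔ (antiBergman γ).map (xrayMod γ (-m)).toLinearMap

lemma ell_tt {m : ℕ} {f : ℂ → Tensor m} {fp fm : ℂ → ℂ}
    (hf : ∀ z, f z = fp z • dzPow m + fm z • dzbarPow m) (z v : ℂ) (hv : ‖v‖ = 1) :
    ell f z v = ∑ b : Bool, v ^ (bif b then (m : ℤ) else -m) * (bif b then fp else fm) z := by
  rw [ell, hf]
  simp [dzPow, dzbarPow, conj_eq_zpow hv, mul_comm]

lemma xray_tt {m : ℕ} {f : ℂ → Tensor m} {fp fm : ℂ → ℂ}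
    (hf : ∀ z, f z = fp z • dzPow m + fm z • dzbarPow m) {up um : DiskSpace γ}
    (hp : up =ᵐ[diskMeasure γ] fp) (hm : um =ᵐ[diskMeasure γ] fm) :
    xray γ (ell f) =ᵐ[dataMeasure γ] (xrayMod γ m up + xrayMod γ (-m) um : DataSpace γ) := by
  have h := (xray_sum (γ := γ) Finset.univ (fun b : Bool => bif b then (m : ℤ) else -m)
    (u := fun b => bif b then up else um) (f := fun b => bif b then fp else fm)
    (by rintro (_ | _) _ <;> assumption) (ell_tt hf)).2
  simpa using h

lemma rangeTT_eq (m : ℕ) : rangeTT γ m = (ttSpace γ m : Set (DataSpace γ)) := by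
  ext w
  constructor
  · rintro ⟨f, ⟨fp, fm, hp, hp', hm, hm', hf⟩, hw⟩
    have h := xray_tt hf (MemLp.coeFn_toLp hp) (MemLp.coeFn_toLp hm)
    rw [Lp.ext (hw.trans h)]
    exact Submodule.add_mem_sup (Submodule.mem_map_of_mem (toLp_mem_bergman hp hp'))
      (Submodule.mem_map_of_mem (toLp_mem_antiBergman hm hm'))
  · intro hw
    obtain ⟨_, ⟨up, hup, rfl⟩, _, ⟨um, hum, rfl⟩, rfl⟩ := Submodule.mem_sup.1 hw
    obtain ⟨fp, h1, h2⟩ := exists_analytic_of_mem_bergman hup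
    obtain ⟨fm, h3, h4⟩ := exists_antianalytic_of_mem_antiBergman hum
    have hp : MemLp fp 2 (diskMeasure γ) := (memLp_congr_ae h2).1 (Lp.memLp _)
    have hm : MemLp fm 2 (diskMeasure γ) := (memLp_congr_ae h4).1 (Lp.memLp _)
    refine ⟨fun z => fp z • dzPow m + fm z • dzbarPow m, ⟨fp, fm, hp, h1, hm, h3, fun _ => rfl⟩, ?_⟩
    exact (xray_tt (fun _ => rfl) h2 h4).symm

/-! #### The range on all symmetric fields -/

variable (γ) in
/-- The range on symmetric fields, as a subspace. -/
def symSpace (m : ℕ) : Submodule ℂ (DataSpace γ) :=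
  ⨆ j : Fin (m + 1), LinearMap.range (xrayMod γ ((m : ℤ) - 2 * (j : ℕ))).toLinearMap

/-- The coefficients of `v ↦ Re v` and `v ↦ Im v` in terms of `v` and `v̄`. -/
def frameCoeff (c s : Fin 2) : ℂ :=
  ![![1 / 2, 1 / 2], ![-Complex.I / 2, Complex.I / 2]] c s

lemma eq_sum_frame (v : ℂ) : v = ∑ c : Fin 2, (![v.re, v.im] : Fin 2 → ℝ) c •
    (![1, Complex.I] : Fin 2 → ℂ) c := by
  simp [Complex.re_add_im]

lemma coord_eq_sum {v : ℂ} (hv : ‖v‖ = 1) (c : Fin 2) :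
    (((![v.re, v.im] : Fin 2 → ℝ) c : ℝ) : ℂ) =
      ∑ s : Fin 2, frameCoeff c s * v ^ (1 - 2 * ((s : ℕ) : ℤ)) := by
  have h1 : v⁻¹ = (starRingEnd ℂ) v := Complex.inv_eq_conj hv
  fin_cases c
  · simp [frameCoeff, Fin.sum_univ_two, h1]
    rw [Complex.re_eq_add_conj]
    ring
  · simp [frameCoeff, Fin.sum_univ_two, h1]
    rw [Complex.im_eq_sub_conj]
    field_simp
    linear_combination (v - (starRingEnd ℂ) v) * Complex.I_sq

/-- Expand v in the real frame, then each coordinate in v and v⁻¹. The multi-index s marks the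
factors v⁻¹; if there are j of them, the exponent is m - 2j. -/
lemma ell_eq_sum {m : ℕ} (f : ℂ → Tensor m) (z v : ℂ) (hv : ‖v‖ = 1) :
    ell f z v = ∑ s : Fin m → Fin 2, v ^ ((m : ℤ) - 2 * ((∑ i, (s i : ℕ) : ℕ) : ℤ)) *
      ∑ r : Fin m → Fin 2, (∏ i, frameCoeff (r i) (s i)) *
        f z fun i => (![1, Complex.I] : Fin 2 → ℂ) (r i) := by
  have hv0 : v ≠ 0 := fun h => by simp [h] at hv
  have h1 : ell f z v = ∑ r : Fin m → Fin 2, (∏ i, (((![v.re, v.im] : Fin 2 → ℝ) (r i) : ℝ) : ℂ)) *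
      f z fun i => (![1, Complex.I] : Fin 2 → ℂ) (r i) := by
    have h2 : ell f z v = f z fun _ => ∑ c : Fin 2, (![v.re, v.im] : Fin 2 → ℝ) c •
        (![1, Complex.I] : Fin 2 → ℂ) c := by
      rw [← eq_sum_frame v, ell]
    rw [h2, MultilinearMap.map_sum]
    refine Finset.sum_congr rfl fun r _ => ?_
    rw [MultilinearMap.map_smul_univ, Complex.real_smul, Complex.ofReal_prod]
  rw [h1]
  have h3 : ∀ r : Fin m → Fin 2, ∏ i, (((![v.re, v.im] : Fin 2 → ℝ) (r i) : ℝ) : ℂ) =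
      ∑ s : Fin m → Fin 2, (∏ i, frameCoeff (r i) (s i)) *
        v ^ ((m : ℤ) - 2 * ((∑ i, (s i : ℕ) : ℕ) : ℤ)) := fun r => by
    simp_rw [coord_eq_sum hv]
    rw [Finset.prod_univ_sum, Fintype.piFinset_univ]
    refine Finset.sum_congr rfl fun s _ => ?_
    rw [Finset.prod_mul_distrib]
    congr 1
    have : ∀ t : Finset (Fin m), ∏ i ∈ t, v ^ (1 - 2 * ((s i : ℕ) : ℤ)) =
        v ^ (∑ i ∈ t, (1 - 2 * ((s i : ℕ) : ℤ))) := fun t => by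
      induction t using Finset.induction_on with
      | empty => simp
      | insert i t hi ih => rw [Finset.prod_insert hi, Finset.sum_insert hi, ih, zpow_add₀ hv0]
    rw [this, Finset.sum_sub_distrib, ← Finset.mul_sum]
    simp
  simp_rw [h3, Finset.sum_mul, Finset.mul_sum]
  rw [Finset.sum_comm]
  refine Finset.sum_congr rfl fun s _ => Finset.sum_congr rfl fun r _ => ?_
  ring

lemma xray_sym {m : ℕ} {f : ℂ → Tensor m} (hf : IsL2SymTensorField γ m f) :
    (∀ᵐ p ∂dataMeasure γ,
      IntervalIntegrable (rayIntegrand γ (ell f) p) volume 0 (2 * Real.cos p.2)) ∧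
    ∃ w ∈ symSpace γ m, xray γ (ell f) =ᵐ[dataMeasure γ] w := by
  have hm : ∀ s : Fin m → Fin 2, MemLp (fun z => ∑ r : Fin m → Fin 2,
      (∏ i, frameCoeff (r i) (s i)) * f z fun i => (![1, Complex.I] : Fin 2 → ℂ) (r i)) 2
      (diskMeasure γ) := fun s => memLp_finsetSum _ fun r _ => (hf.memLp r).const_mul _
  obtain ⟨h1, h2⟩ := xray_sum (γ := γ) Finset.univ _ (fun s _ => MemLp.coeFn_toLp (hm s))
    (ell_eq_sum f)
  refine ⟨h1, _, Submodule.sum_mem _ fun s _ => ?_, h2⟩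
  have hs : ∑ i, (s i : ℕ) < m + 1 := by
    have : ∑ i, (s i : ℕ) ≤ ∑ _i : Fin m, 1 := Finset.sum_le_sum fun i _ => by omega
    simp at this
    omega
  exact Submodule.mem_iSup_of_mem (⟨_, hs⟩ : Fin (m + 1)) ⟨_, rfl⟩

/-- The symmetrization of `dz^{m-j} dz̄^j`, up to a factor `m!`. -/
def symTensor (m j : ℕ) : Tensor m :=
  ∑ σ : Equiv.Perm (Fin m), ((MultilinearMap.mkPiAlgebra ℝ (Fin m) ℂ).compLinearMap
    fun i => if (i : ℕ) < j then Complex.conjAe.toLinearMap else LinearMap.id).domDomCongr σ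

lemma symTensor_apply (m j : ℕ) (v : Fin m → ℂ) : symTensor m j v =
    ∑ σ : Equiv.Perm (Fin m), ∏ i : Fin m,
      if (i : ℕ) < j then (starRingEnd ℂ) (v (σ i)) else v (σ i) := by
  rw [symTensor, _root_.sum_apply]
  refine Finset.sum_congr rfl fun σ _ => ?_
  rw [MultilinearMap.domDomCongr_apply, MultilinearMap.compLinearMap_apply,
    MultilinearMap.mkPiAlgebra_apply]
  refine Finset.prod_congr rfl fun i _ => ?_
  split_ifs <;> rfl

lemma symTensor_symm (m j : ℕ) (τ : Equiv.Perm (Fin m)) (v : Fin m → ℂ) :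
    symTensor m j (fun i => v (τ i)) = symTensor m j v := by
  rw [symTensor_apply, symTensor_apply]
  exact Equiv.sum_comp (Equiv.mulLeft τ) fun σ : Equiv.Perm (Fin m) => ∏ i : Fin m,
      if (i : ℕ) < j then (starRingEnd ℂ) (v (σ i)) else v (σ i)

lemma symTensor_diag {m j : ℕ} (hj : j ≤ m) {v : ℂ} (hv : ‖v‖ = 1) :
    symTensor m j (fun _ => v) = (m.factorial : ℂ) * v ^ ((m : ℤ) - 2 * (j : ℤ)) := by
  have hv0 : v ≠ 0 := fun h => by simp [h] at hv
  have h1 : ∏ i : Fin m, (if (i : ℕ) < j then (starRingEnd ℂ) v else v) =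
      v ^ ((m : ℤ) - 2 * (j : ℤ)) := by
    rw [Fin.prod_univ_eq_prod_range (fun i => if i < j then (starRingEnd ℂ) v else v) m,
      Finset.prod_ite, Finset.prod_const, Finset.prod_const]
    have c1 : (Finset.filter (fun i => i < j) (Finset.range m)).card = j := by
      have : Finset.filter (fun i => i < j) (Finset.range m) = Finset.range j := by
        ext i; simp; omega
      rw [this, Finset.card_range]
    have c2 : (Finset.filter (fun i => ¬ i < j) (Finset.range m)).card = m - j := by
      have := Finset.card_filter_add_card_filter_not (s := Finset.range m) (fun i => i < j)
      rw [c1, Finset.card_range] at this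
      omega
    rw [c1, c2, conj_eq_zpow hv, ← zpow_natCast, ← zpow_natCast, ← zpow_mul, ← zpow_add₀ hv0]
    congr 1
    push_cast [hj]
    ring
  rw [symTensor_apply]
  simp_rw [h1]
  simp [Finset.card_univ, Fintype.card_perm]

lemma exists_sum_of_mem_iSup {ι M : Type*} [Fintype ι] [AddCommGroup M] [Module ℂ M]
    {N : Type*} [AddCommGroup N] [Module ℂ N] (L : ι → N →ₗ[ℂ] M) {w : M}
    (hw : w ∈ ⨆ i, LinearMap.range (L i)) : ∃ u : ι → N, w = ∑ i, L i (u i) := by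
  classical
  have h : ⨆ i, LinearMap.range (L i) ≤ LinearMap.range (∑ i, (L i).comp (LinearMap.proj i) :
      (ι → N) →ₗ[ℂ] M) := by
    refine iSup_le fun i => ?_
    rintro _ ⟨x, rfl⟩
    refine ⟨Pi.single i x, ?_⟩
    rw [LinearMap.sum_apply, Finset.sum_eq_single i]
    · simp
    · intro b _ hb
      simp [Pi.single_eq_of_ne hb]
    · simp
  obtain ⟨u, hu⟩ := h hw
  exact ⟨u, by rw [← hu, LinearMap.sum_apply]; rfl⟩

/-- Conversely, prescribed coefficients u_j are realized by the sum of the fields u_j / m! times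
`symTensor m j`, whose value on (v, ..., v) is m! v^{m-2j}. -/
lemma rangeSym_eq (m : ℕ) : rangeSym γ m = (symSpace γ m : Set (DataSpace γ)) := by
  ext w
  constructor
  · rintro ⟨f, hf, hw⟩
    obtain ⟨-, w', hw', h⟩ := xray_sym hf
    rwa [Lp.ext (hw.trans h)]
  · intro hw
    obtain ⟨u, rfl⟩ := exists_sum_of_mem_iSup _ hw
    have hev : ∀ (z : ℂ) (v : Fin m → ℂ),
        (∑ j : Fin (m + 1), (((m.factorial : ℂ)⁻¹ * u j z) • symTensor m j : Tensor m)) v =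
          ∑ j : Fin (m + 1), (m.factorial : ℂ)⁻¹ * symTensor m j v * u j z := fun z v => by
      rw [_root_.sum_apply]
      refine Finset.sum_congr rfl fun j _ => ?_
      rw [_root_.smul_apply, smul_eq_mul]
      ring
    refine ⟨fun z => ∑ j : Fin (m + 1), ((m.factorial : ℂ)⁻¹ * u j z) • symTensor m j, ⟨?_, ?_⟩, ?_⟩
    · intro z σ v
      rw [hev, hev]
      simp_rw [symTensor_symm]
    · intro r
      simp_rw [hev]
      exact memLp_finsetSum _ fun j _ => (Lp.memLp (u j)).const_mul _
    · refine (xray_sum (γ := γ) Finset.univ _ (u := u) (f := fun j => u j)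
        (fun j _ => Filter.EventuallyEq.refl _ _) fun z v hv => ?_).2.symm
      rw [ell, hev]
      refine Finset.sum_congr rfl fun j _ => ?_
      have hj : (j : ℕ) ≤ m := Nat.lt_succ_iff.1 j.2
      have hm : (m.factorial : ℂ) ≠ 0 := by exact_mod_cast m.factorial_ne_zero
      rw [symTensor_diag hj hv, inv_mul_cancel_left₀ hm]

/-! #### The range on the exact fields `⋆dh` -/

/-- On unit vectors ⋆dh(v) = h_x Im v - h_y Re v = -i (v ∂h - v̄ ∂̄h), which is -i dh(v) with the
sign of its ∂̄ term reversed. -/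
lemma ell_starD (hx hy : ℂ → ℂ) (z v : ℂ) (hv : ‖v‖ = 1) :
    ell (starD hx hy) z v = v * (-Complex.I * delOf hx hy z) +
      v ^ (-1 : ℤ) * (Complex.I * delBarOf hx hy z) := by
  rw [← conj_eq_zpow hv]
  have h1 : ell (starD hx hy) z v = hx z * v.im - hy z * v.re := by
    simp [ell, starD, covectorTensor, hodgeStar, dx, dy]
  rw [h1, delOf, delBarOf, Complex.re_eq_add_conj, Complex.im_eq_sub_conj]
  rw [div_mul_eq_div_div, Complex.div_I]
  linear_combination (-v * hy z / 2 - (starRingEnd ℂ) v * hy z / 2) * Complex.I_sq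

variable [Fact (-1 < -γ)]

variable (γ) in
/-- The space `I_1(⋆d H_0^{1,-γ})` as a subspace. -/
def starSpace : Submodule ℂ (DataSpace γ) := (bergman γ)ᗮ.map (xrayMod γ 1).toLinearMap

/-- The two terms give -i M T f + i M⁻¹ T g, and the relation M T f + M⁻¹ T g = 0 merges them into
-2i M T f. -/
lemma xray_starD {h hx hy : ℂ → ℂ} (hh : IsH01 (-γ) h hx hy) {f g : DiskSpace γ}
    (hf : f =ᵐ[diskMeasure γ] fun z => (((1 - ‖z‖ ^ 2) ^ (-γ) : ℝ) : ℂ) * delOf hx hy z)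
    (hg : g =ᵐ[diskMeasure γ] fun z => (((1 - ‖z‖ ^ 2) ^ (-γ) : ℝ) : ℂ) * delBarOf hx hy z) :
    (∀ᵐ p ∂dataMeasure γ, IntervalIntegrable (rayIntegrand 0 (ell (starD hx hy)) p) volume 0
      (2 * Real.cos p.2)) ∧
    xray 0 (ell (starD hx hy)) =ᵐ[dataMeasure γ] xrayMod γ 1 ((-2 * Complex.I) • f) := by
  have e1 : ((-Complex.I) • f : DiskSpace γ) =ᵐ[diskMeasure γ] fun z =>
      (((1 - ‖z‖ ^ 2) ^ (-γ) : ℝ) : ℂ) * (-Complex.I * delOf hx hy z) := by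
    filter_upwards [Lp.coeFn_smul (-Complex.I) f, hf] with z h1 h2
    rw [h1, Pi.smul_apply, h2, smul_eq_mul]; ring
  have e2 : (Complex.I • g : DiskSpace γ) =ᵐ[diskMeasure γ] fun z =>
      (((1 - ‖z‖ ^ 2) ^ (-γ) : ℝ) : ℂ) * (Complex.I * delBarOf hx hy z) := by
    filter_upwards [Lp.coeFn_smul Complex.I g, hg] with z h1 h2
    rw [h1, Pi.smul_apply, h2, smul_eq_mul]; ring
  obtain ⟨h1, h2⟩ := xray_sum (γ := γ) (Finset.univ : Finset Bool) (fun b => bif b then 1 else -1)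
    (u := fun b => bif b then (-Complex.I) • f else Complex.I • g)
    (f := fun b => bif b then (fun z => (((1 - ‖z‖ ^ 2) ^ (-γ) : ℝ) : ℂ) *
      (-Complex.I * delOf hx hy z)) else fun z => (((1 - ‖z‖ ^ 2) ^ (-γ) : ℝ) : ℂ) *
        (Complex.I * delBarOf hx hy z))
    (by rintro (_ | _) _ <;> assumption)
    (F := fun z v => (((1 - ‖z‖ ^ 2) ^ (-γ) : ℝ) : ℂ) * ell (starD hx hy) z v)
    (fun z v hv => by
      rw [ell_starD hx hy z v hv]
      simp
      ring)
  refine ⟨?_, ?_⟩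
  · filter_upwards [h1, ae_dataMeasure_cos_pos γ] with p hp hc
    exact (intervalIntegrable_div_weight γ _ hc).1 hp
  · have h3 := (isGradPair_of_isH01 hh hf hg).xray_eq
    have h4 : (∑ b : Bool, xrayMod γ (bif b then 1 else -1)
        (bif b then (-Complex.I) • f else Complex.I • g)) = xrayMod γ 1 ((-2 * Complex.I) • f) := by
      rw [Fintype.sum_bool]
      simp only [cond_true, cond_false, map_smul, xrayMod_apply]
      rw [eq_neg_of_add_eq_zero_right h3]
      module
    rw [h4] at h2
    filter_upwards [h2, ae_dataMeasure_cos_pos γ] with p hp hc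
    rw [← hp, xray_div_weight γ _ hc]

lemma memLp_xray_starD {h hx hy : ℂ → ℂ} (hh : IsH01 (-γ) h hx hy) :
    (∀ᵐ p ∂dataMeasure γ, IntervalIntegrable (rayIntegrand 0 (ell (starD hx hy)) p) volume 0
      (2 * Real.cos p.2)) ∧ MemLp (xray 0 (ell (starD hx hy))) 2 (dataMeasure γ) := by
  have h1 := (memLp_div_weight_iff γ _).2 (memLp_delOf hh.memLp_x hh.memLp_y)
  have h2 := (memLp_div_weight_iff γ _).2 (memLp_delBarOf hh.memLp_x hh.memLp_y)
  obtain ⟨h3, h4⟩ := xray_starD hh (MemLp.coeFn_toLp h1) (MemLp.coeFn_toLp h2)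
  exact ⟨h3, (memLp_congr_ae h4).2 (Lp.memLp _)⟩

lemma rangeStarD_eq : rangeStarD γ = (starSpace γ : Set (DataSpace γ)) := by
  ext w
  constructor
  · rintro ⟨h, hx, hy, hh, hw⟩
    have h1 := (memLp_div_weight_iff γ _).2 (memLp_delOf hh.memLp_x hh.memLp_y)
    have h2 := (memLp_div_weight_iff γ _).2 (memLp_delBarOf hh.memLp_x hh.memLp_y)
    have h3 := (xray_starD hh (MemLp.coeFn_toLp h1) (MemLp.coeFn_toLp h2)).2
    rw [Lp.ext (hw.trans h3)]
    refine Submodule.mem_map_of_mem (Submodule.smul_mem _ _ ?_)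
    exact (isGradPair_of_isH01 hh (MemLp.coeFn_toLp h1) (MemLp.coeFn_toLp h2)).left
  · rintro ⟨f, hf, rfl⟩
    -- The factor i/2 inverts the constant -2i of `xray_starD`.
    obtain ⟨u, g, hu⟩ := exists_isWeightedGrad (Submodule.smul_mem _ (Complex.I / 2) hf)
    refine ⟨_, _, _, hu, ?_⟩
    have h3 := (xray_starD hu (ae_eq_delOf_weight _ _) (ae_eq_delBarOf_weight _ _)).2
    refine Filter.EventuallyEq.trans (Filter.EventuallyEq.of_eq ?_) h3.symm
    rw [smul_smul]
    have : -2 * Complex.I * (Complex.I / 2) = 1 := by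
      linear_combination -Complex.I_sq
    rw [this, one_smul]
    rfl

end Tensors

end DiskXRay
end

/-! ### Lowering of modes, orthogonality, and the decomposition by induction on the order. -/

noncomputable section
namespace DiskXRay

section Decomposition

set_option linter.unusedSectionVars false

/-! ### The orthogonal decomposition -/

variable {γ : ℝ} [hγ : Fact (-1 < γ)]

lemma inner_xrayMod (i j : ℤ) (u w : DiskSpace γ) :
    inner ℂ (xrayMod γ i u) (xrayMod γ j w) = inner ℂ (modul γ (i - j) (xrayL γ u)) (xrayL γ w) := by
  rw [xrayMod_apply, xrayMod_apply, ← (modul γ j).inner_map_map (modul γ (i - j) (xrayL γ u)), modul_modul, add_sub_cancel]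

lemma isOrtho_ttSpace {V : Submodule ℂ (DataSpace γ)} {m : ℕ}
    (h1 : ∀ g ∈ bergman γ, ∀ w ∈ V, inner ℂ (xrayMod γ m g) w = 0)
    (h2 : ∀ g ∈ antiBergman γ, ∀ w ∈ V, inner ℂ (xrayMod γ (-m) g) w = 0) : V ⟂ ttSpace γ m := by
  refine Submodule.isOrtho_sup_right.2 ⟨(Submodule.isOrtho_iff_inner_eq.2 ?_).symm,
    (Submodule.isOrtho_iff_inner_eq.2 ?_).symm⟩
  · rintro _ ⟨g, hg, rfl⟩ w hw
    exact h1 g hg w hw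
  · rintro _ ⟨g, hg, rfl⟩ w hw
    exact h2 g hg w hw

lemma range_isOrtho_ttSpace {m : ℕ} (hm : 1 ≤ m) :
    LinearMap.range (xrayMod γ 0).toLinearMap ⟂ ttSpace γ m := by
  refine isOrtho_ttSpace ?_ ?_
  · rintro g hg _ ⟨f, rfl⟩
    exact (inner_xrayMod _ _ _ _).trans (inner_modul_xrayL_bergman hg (by omega) f)
  · rintro g hg _ ⟨f, rfl⟩
    exact (inner_xrayMod _ _ _ _).trans (inner_modul_xrayL_antiBergman hg (by omega) f)

/-- Moving all powers of v to one side leaves exponents m ∓ k ≥ 1 on the analytic part and -m ∓ k ≤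
-1 on the antianalytic part, the signs for which the selection rule applies. -/
lemma ttSpace_isOrtho_of_lt {k m : ℕ} (h : k < m) : ttSpace γ k ⟂ ttSpace γ m := by
  refine isOrtho_ttSpace ?_ ?_
  · intro g hg w hw
    obtain ⟨_, ⟨a, -, rfl⟩, _, ⟨b, -, rfl⟩, rfl⟩ := Submodule.mem_sup.1 hw
    rw [inner_add_right]
    refine (congrArg₂ _ ((inner_xrayMod _ _ _ _).trans (inner_modul_xrayL_bergman hg (by omega) a))
      ((inner_xrayMod _ _ _ _).trans (inner_modul_xrayL_bergman hg (by omega) b))).trans (add_zero 0)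
  · intro g hg w hw
    obtain ⟨_, ⟨a, -, rfl⟩, _, ⟨b, -, rfl⟩, rfl⟩ := Submodule.mem_sup.1 hw
    rw [inner_add_right]
    refine (congrArg₂ _ ((inner_xrayMod _ _ _ _).trans
      (inner_modul_xrayL_antiBergman hg (by omega) a)) ((inner_xrayMod _ _ _ _).trans
        (inner_modul_xrayL_antiBergman hg (by omega) b))).trans (add_zero 0)

lemma ttSpace_isOrtho {k m : ℕ} (h : k ≠ m) : ttSpace γ k ⟂ ttSpace γ m := by
  rcases lt_or_gt_of_ne h with h | h
  · exact ttSpace_isOrtho_of_lt h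
  · exact (ttSpace_isOrtho_of_lt h).symm

variable [Fact (-1 < -γ)]

/-- The relation M T f + M⁻¹ T g = 0 multiplied by M^{j-1}: data of functions orthogonal to A go two
modes down. -/
lemma exists_xrayMod_eq {f : DiskSpace γ} (hf : f ∈ (bergman γ)ᗮ) (j : ℤ) :
    ∃ g ∈ (antiBergman γ)ᗮ, xrayMod γ j f = xrayMod γ (j - 2) g := by
  obtain ⟨u, g, h⟩ := exists_isWeightedGrad hf
  have hp := h.isGradPair
  refine ⟨-g, Submodule.neg_mem _ hp.right, ?_⟩
  have h2 := congrArg (modul γ (j - 1)) (eq_neg_of_add_eq_zero_left hp.xray_eq)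
  rw [map_neg, modul_modul, modul_modul] at h2
  rw [map_neg, xrayMod_apply, xrayMod_apply]
  convert h2 using 3
  · ring_nf
  · ring_nf

lemma exists_xrayMod_eq' {g : DiskSpace γ} (hg : g ∈ (antiBergman γ)ᗮ) (j : ℤ) :
    ∃ f ∈ (bergman γ)ᗮ, xrayMod γ j g = xrayMod γ (j + 2) f := by
  obtain ⟨f, hp⟩ := exists_isGradPair hg
  refine ⟨-f, Submodule.neg_mem _ hp.left, ?_⟩
  have h2 := congrArg (modul γ (j + 1)) (eq_neg_of_add_eq_zero_right hp.xray_eq)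
  rw [map_neg, modul_modul, modul_modul] at h2
  rw [map_neg, xrayMod_apply, xrayMod_apply]
  convert h2 using 3
  · ring_nf
  · ring_nf

/-- For m = 1 the shift of mode is zero and the selection rule alone does not suffice. The analytic
part then uses f ⊥ A; the antianalytic part uses M T f = M⁻¹ T f' with f' ⊥ Ā. -/
lemma starSpace_isOrtho_ttSpace {m : ℕ} (hm : 1 ≤ m) : starSpace γ ⟂ ttSpace γ m := by
  refine isOrtho_ttSpace ?_ ?_
  · rintro g hg _ ⟨f, hf, rfl⟩
    refine (inner_xrayMod _ _ _ _).trans ?_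
    rcases hm.eq_or_lt with rfl | hm
    · rw [Nat.cast_one, sub_self, modul_zero]
      exact inner_xrayL_bergman hg hf
    · exact inner_modul_xrayL_bergman hg (by omega) f
  · rintro g hg _ ⟨f, hf, rfl⟩
    obtain ⟨f', hf', h⟩ := exists_xrayMod_eq hf 1
    refine (congrArg _ h).trans ((inner_xrayMod _ _ _ _).trans ?_)
    rcases hm.eq_or_lt with rfl | hm
    · have : (-((1 : ℕ) : ℤ) - (1 - 2)) = 0 := by norm_num
      rw [this, modul_zero]
      exact inner_xrayL_antiBergman hg hf'
    · exact inner_modul_xrayL_antiBergman hg (by omega) f'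

/-- Split f along A: the analytic component gives transverse-tracefree data, the orthogonal one goes
two modes down. -/
lemma range_xrayMod_le (m : ℕ) : LinearMap.range (xrayMod γ (m + 2 : ℕ)).toLinearMap ≤
    LinearMap.range (xrayMod γ m).toLinearMap ⊔ ttSpace γ (m + 2) := by
  rintro _ ⟨f, rfl⟩
  have : CompleteSpace (bergman γ) := (Submodule.isClosed_topologicalClosure _).completeSpace_coe
  obtain ⟨y, hy, w, hw, rfl⟩ := (bergman γ).exists_add_mem_mem_orthogonal f
  obtain ⟨g, -, hg⟩ := exists_xrayMod_eq hw (m + 2 : ℕ)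
  have e : ((m + 2 : ℕ) : ℤ) - 2 = m := by push_cast; ring
  rw [e] at hg
  rw [map_add, add_comm (_ : DataSpace γ)]
  refine Submodule.add_mem_sup ⟨g, hg.symm⟩ (Submodule.mem_sup_left ⟨y, hy, rfl⟩)

lemma range_xrayMod_neg_le (m : ℕ) : LinearMap.range (xrayMod γ (-(m + 2 : ℕ))).toLinearMap ≤
    LinearMap.range (xrayMod γ (-m)).toLinearMap ⊔ ttSpace γ (m + 2) := by
  rintro _ ⟨f, rfl⟩
  have : CompleteSpace (antiBergman γ) :=
    (Submodule.isClosed_topologicalClosure _).completeSpace_coe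
  obtain ⟨y, hy, w, hw, rfl⟩ := (antiBergman γ).exists_add_mem_mem_orthogonal f
  obtain ⟨g, -, hg⟩ := exists_xrayMod_eq' hw (-(m + 2 : ℕ))
  have e : -((m + 2 : ℕ) : ℤ) + 2 = -m := by push_cast; ring
  rw [e] at hg
  rw [map_add, add_comm (_ : DataSpace γ)]
  refine Submodule.add_mem_sup ⟨g, hg.symm⟩ (Submodule.mem_sup_right ⟨y, hy, rfl⟩)

lemma range_le_symSpace {m : ℕ} {k : ℤ} (j : ℕ) (hj : j ≤ m) (hk : k = m - 2 * j) :
    LinearMap.range (xrayMod γ k).toLinearMap ≤ symSpace γ m := by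
  subst hk
  exact le_iSup (fun j : Fin (m + 1) =>
    LinearMap.range (xrayMod γ ((m : ℤ) - 2 * (j : ℕ))).toLinearMap) ⟨j, Nat.lt_succ_iff.2 hj⟩

lemma ttSpace_le_symSpace (m : ℕ) : ttSpace γ m ≤ symSpace γ m :=
  sup_le ((LinearMap.map_le_range).trans (range_le_symSpace 0 (by omega) (by simp)))
    ((LinearMap.map_le_range).trans (range_le_symSpace m le_rfl (by ring)))

/-- The modes of order m + 2 are those of order m and the two extreme ones ±(m + 2), which are
absorbed up to tt data. -/
lemma symSpace_add_two (m : ℕ) : symSpace γ (m + 2) = symSpace γ m ⊔ ttSpace γ (m + 2) := by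
  refine le_antisymm (iSup_le fun j => ?_) (sup_le (iSup_le fun j => ?_) (ttSpace_le_symSpace _))
  · rcases Nat.eq_zero_or_pos (j : ℕ) with h0 | h0
    · have e : ((m + 2 : ℕ) : ℤ) - 2 * (j : ℕ) = (m + 2 : ℕ) := by rw [h0]; simp
      rw [e]
      exact (range_xrayMod_le m).trans (sup_le_sup_right (range_le_symSpace 0 (by omega) (by simp)) _)
    · rcases Nat.lt_or_ge (j : ℕ) (m + 2) with h1 | h1
      -- Index shift: (m + 2) - 2j = m - 2(j - 1).
      · exact (range_le_symSpace (j - 1 : ℕ) (by omega) (by omega)).trans le_sup_left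
      · have e : ((m + 2 : ℕ) : ℤ) - 2 * (j : ℕ) = -(m + 2 : ℕ) := by
          have := j.2
          omega
        rw [e]
        exact (range_xrayMod_neg_le m).trans
          (sup_le_sup_right (range_le_symSpace m le_rfl (by ring)) _)
  · exact range_le_symSpace (j + 1 : ℕ) (by have := j.2; omega) (by push_cast; ring)

lemma symSpace_zero : symSpace γ 0 = LinearMap.range (xrayMod γ 0).toLinearMap :=
  le_antisymm (iSup_le fun j => by
    have e : ((0 : ℕ) : ℤ) - 2 * (j : ℕ) = 0 := by have := j.2; omega
    rw [e]) (range_le_symSpace 0 le_rfl (by simp))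

/-- Lowering exchanges the modes 1 and -1, so nothing is absorbed by a smaller order: besides tt
data, both leave the same space M T(Aᗮ) = M⁻¹ T(Āᗮ). -/
lemma symSpace_one : symSpace γ 1 = starSpace γ ⊔ ttSpace γ 1 := by
  refine le_antisymm (iSup_le fun j => ?_) (sup_le ?_ (ttSpace_le_symSpace 1))
  · rintro _ ⟨f, rfl⟩
    rcases Nat.eq_zero_or_pos (j : ℕ) with h0 | h0
    · have e : ((1 : ℕ) : ℤ) - 2 * (j : ℕ) = (1 : ℕ) := by rw [h0]; simp
      rw [e]
      have : CompleteSpace (bergman γ) := (Submodule.isClosed_topologicalClosure _).completeSpace_coe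
      obtain ⟨y, hy, w, hw, rfl⟩ := (bergman γ).exists_add_mem_mem_orthogonal f
      rw [map_add, add_comm]
      exact Submodule.add_mem_sup ⟨w, hw, rfl⟩ (Submodule.mem_sup_left ⟨y, hy, rfl⟩)
    · have e : ((1 : ℕ) : ℤ) - 2 * (j : ℕ) = -(1 : ℕ) := by have := j.2; omega
      rw [e]
      have : CompleteSpace (antiBergman γ) :=
        (Submodule.isClosed_topologicalClosure _).completeSpace_coe
      obtain ⟨y, hy, w, hw, rfl⟩ := (antiBergman γ).exists_add_mem_mem_orthogonal f
      obtain ⟨g, hg, h⟩ := exists_xrayMod_eq' hw (-(1 : ℕ))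
      rw [map_add, add_comm]
      exact Submodule.add_mem_sup ⟨g, hg, h.symm⟩ (Submodule.mem_sup_right ⟨y, hy, rfl⟩)
  · exact (LinearMap.map_le_range).trans (range_le_symSpace 0 (by omega) (by simp))

lemma iSup_fin_succ {α : Type*} [CompleteLattice α] {n : ℕ} (f : ℕ → α) :
    ⨆ j : Fin (n + 1), f j = (⨆ j : Fin n, f j) ⊔ f n := by
  refine le_antisymm (iSup_le fun j => ?_) (sup_le (iSup_le fun j => ?_) ?_)
  · rcases Nat.lt_or_ge (j : ℕ) n with h | h
    · exact (le_iSup (fun j : Fin n => f j) ⟨j, h⟩).trans le_sup_left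
    · have : (j : ℕ) = n := by have := j.2; omega
      rw [this]; exact le_sup_right
  · exact le_iSup (fun j : Fin (n + 1) => f j) j.castSucc
  · exact le_iSup (fun j : Fin (n + 1) => f j) (Fin.last n)

lemma symSpace_even (p : ℕ) : symSpace γ (2 * p) =
    LinearMap.range (xrayMod γ 0).toLinearMap ⊔ ⨆ j : Fin p, ttSpace γ (2 * ((j : ℕ) + 1)) := by
  induction p with
  | zero => simp [symSpace_zero]
  | succ p ih =>
    rw [iSup_fin_succ fun j => ttSpace γ (2 * (j + 1)), ← sup_assoc, ← ih]
    exact symSpace_add_two (2 * p)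

lemma symSpace_odd (p : ℕ) : symSpace γ (2 * p + 1) =
    starSpace γ ⊔ ⨆ j : Fin (p + 1), ttSpace γ (2 * (j : ℕ) + 1) := by
  induction p with
  | zero => simp [symSpace_one]
  | succ p ih =>
    rw [iSup_fin_succ fun j => ttSpace γ (2 * j + 1), ← sup_assoc, ← ih]
    exact symSpace_add_two (2 * p + 1)

lemma isOrthogonalSum_even (p : ℕ) : IsOrthogonalSum (rangeSym γ (2 * p)) (rangeFun γ)
    (fun j : Fin p => rangeTT γ (2 * ((j : ℕ) + 1))) :=
  ⟨_, fun j : Fin p => ttSpace γ (2 * ((j : ℕ) + 1)), rangeFun_eq.symm,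
    fun _ => (rangeTT_eq _).symm, fun _ => range_isOrtho_ttSpace (by omega),
    fun i j hij => ttSpace_isOrtho fun h => hij (Fin.ext (by omega)),
    by rw [rangeSym_eq, symSpace_even]⟩

lemma isOrthogonalSum_odd (p : ℕ) : IsOrthogonalSum (rangeSym γ (2 * p + 1)) (rangeStarD γ)
    (fun j : Fin (p + 1) => rangeTT γ (2 * (j : ℕ) + 1)) :=
  ⟨_, fun j : Fin (p + 1) => ttSpace γ (2 * (j : ℕ) + 1), rangeStarD_eq.symm,
    fun _ => (rangeTT_eq _).symm, fun _ => starSpace_isOrtho_ttSpace (by omega),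
    fun i j hij => ttSpace_isOrtho fun h => hij (Fin.ext (by omega)),
    by rw [rangeSym_eq, symSpace_odd]⟩

end Decomposition

end DiskXRay
end

/-! ### Orthogonal polynomials, Zernike functions, and the closure of I_1(⋆d H_0^{1,-γ}). -/

noncomputable section
namespace DiskXRay

section OrthogonalPolynomials

set_option linter.unusedSectionVars false

/-! ### Orthogonal polynomials -/

variable {γ : ℝ} [hγ : Fact (-1 < γ)]

instance : Fact (-1 < γ + 1 / 2) := ⟨by linarith [hγ.out]⟩

lemma polyPairing_eq_integral (p q : Polynomial ℝ) :
    polyPairing γ p q = ∫ x, p.eval x * q.eval x ∂jacobiMeasure (γ + 1 / 2) := by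
  rw [polyPairing, jacobiMeasure, intervalIntegral.integral_of_le (by norm_num),
    integral_Ioc_eq_integral_Ioo, integral_withDensity_eq_integral_toReal_smul (by fun_prop) (by simp)]
  refine setIntegral_congr_fun measurableSet_Ioo fun x hx => ?_
  have h : 0 ≤ 1 - x ^ 2 := by nlinarith [hx.1, hx.2]
  rw [ENNReal.toReal_ofReal (by positivity), smul_eq_mul, mul_comm]

lemma integrable_jacobi_of_continuous {f : ℝ → ℝ} (hf : Continuous f) :
    Integrable f (jacobiMeasure (γ + 1 / 2)) := by
  obtain ⟨C, hC⟩ := (isCompact_Icc (a := (-1 : ℝ)) (b := 1)).exists_bound_of_continuousOn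
    hf.continuousOn
  refine Integrable.of_bound hf.aestronglyMeasurable C ?_
  rw [jacobiMeasure]
  refine (withDensity_absolutelyContinuous _ _).ae_le ?_
  filter_upwards [ae_restrict_mem measurableSet_Ioo] with x hx using hC x (Set.Ioo_subset_Icc_self hx)

lemma polyPairing_comm (p q : Polynomial ℝ) : polyPairing γ p q = polyPairing γ q p := by
  simp only [polyPairing, mul_comm (Polynomial.eval _ p)]

lemma polyPairing_sub_left (p p' q : Polynomial ℝ) :
    polyPairing γ (p - p') q = polyPairing γ p q - polyPairing γ p' q := by
  rw [polyPairing_eq_integral, polyPairing_eq_integral, polyPairing_eq_integral, ← integral_sub]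
  · simp only [Polynomial.eval_sub, sub_mul]
  · exact integrable_jacobi_of_continuous (by fun_prop)
  · exact integrable_jacobi_of_continuous (by fun_prop)

lemma polyPairing_sum_left {ι : Type*} (s : Finset ι) (p : ι → Polynomial ℝ) (q : Polynomial ℝ) :
    polyPairing γ (∑ i ∈ s, p i) q = ∑ i ∈ s, polyPairing γ (p i) q := by
  simp_rw [polyPairing_eq_integral]
  rw [← integral_finsetSum]
  · simp only [Polynomial.eval_finsetSum, Finset.sum_mul]
  · exact fun i _ => integrable_jacobi_of_continuous (by fun_prop)

lemma polyPairing_C_mul_left (c : ℝ) (p q : Polynomial ℝ) :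
    polyPairing γ (Polynomial.C c * p) q = c * polyPairing γ p q := by
  simp_rw [polyPairing_eq_integral]
  rw [← integral_const_mul]
  simp only [Polynomial.eval_mul, Polynomial.eval_C, mul_assoc]

/-- The integrand is positive on (-1, 1) outside the finitely many roots of p. -/
lemma polyPairing_self_pos {p : Polynomial ℝ} (hp : p ≠ 0) : 0 < polyPairing γ p p := by
  have hpos : ∀ x ∈ Set.Ioo (-1 : ℝ) 1, 0 < 1 - x ^ 2 := fun x hx => by nlinarith [hx.1, hx.2]
  have hint : IntegrableOn (fun x => p.eval x * p.eval x * (1 - x ^ 2) ^ (γ + 1 / 2))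
      (Set.Ioo (-1) 1) := by
    have h := integrable_jacobi_of_continuous (γ := γ) (f := fun x => p.eval x * p.eval x)
      (by fun_prop)
    rw [jacobiMeasure, integrable_withDensity_iff_integrable_smul' (by fun_prop) (by simp)] at h
    refine (integrableOn_congr_fun (fun x hx => ?_) measurableSet_Ioo).1 h
    have := hpos x hx
    rw [ENNReal.toReal_ofReal (by positivity), smul_eq_mul, mul_comm]
  rw [polyPairing, intervalIntegral.integral_of_le (by norm_num), integral_Ioc_eq_integral_Ioo,
    setIntegral_pos_iff_support_of_nonneg_ae ?_ hint]
  · have hsub : Set.Ioo (-1 : ℝ) 1 \ (p.roots.toFinset : Set ℝ) ⊆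
        Function.support (fun x => p.eval x * p.eval x * (1 - x ^ 2) ^ (γ + 1 / 2)) ∩
          Set.Ioo (-1) 1 := by
      rintro x ⟨hx, hr⟩
      have hx0 : p.eval x ≠ 0 := fun h => hr (by simp [hp, h])
      have := Real.rpow_pos_of_pos (hpos x hx) (γ + 1 / 2)
      exact ⟨by simp only [Function.mem_support]; positivity, hx⟩
    refine lt_of_lt_of_le ?_ (measure_mono hsub)
    rw [measure_sdiff_null (Finset.measure_zero _ _), Real.volume_Ioo]
    norm_num
  · filter_upwards [ae_restrict_mem measurableSet_Ioo] with x hx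
    have := Real.rpow_pos_of_pos (hpos x hx) (γ + 1 / 2)
    exact mul_nonneg (mul_self_nonneg _) this.le

/-- Gram-Schmidt; by strong induction the earlier polynomials are monic, hence nonzero, so every
denominator is positive. -/
lemma monicOrthoPoly_spec (n : ℕ) : (monicOrthoPoly γ n).Monic ∧ (monicOrthoPoly γ n).natDegree = n ∧
    ∀ k < n, polyPairing γ (monicOrthoPoly γ n) (monicOrthoPoly γ k) = 0 := by
  induction n using Nat.strong_induction_on with
  | _ n ih =>
    have hlt : (∑ k : Fin n, Polynomial.C (polyPairing γ (Polynomial.X ^ n) (monicOrthoPoly γ k) /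
      polyPairing γ (monicOrthoPoly γ k) (monicOrthoPoly γ k)) * monicOrthoPoly γ k).degree <
        (Polynomial.X ^ n : Polynomial ℝ).degree := by
      rw [Polynomial.degree_X_pow]
      refine (Polynomial.degree_sum_le _ _).trans_lt ?_
      rw [Finset.sup_lt_iff (by exact WithBot.bot_lt_coe n)]
      intro k _
      obtain ⟨h1, h2, -⟩ := ih k k.2
      refine (Polynomial.degree_mul_le _ _).trans_lt ?_
      refine (add_le_add_left Polynomial.degree_C_le _).trans_lt ?_
      rw [zero_add]
      rw [Polynomial.degree_eq_natDegree h1.ne_zero, h2]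
      exact_mod_cast k.2
    rw [monicOrthoPoly]
    refine ⟨(Polynomial.monic_X_pow n).sub_of_left hlt, ?_, fun k hk => ?_⟩
    · refine Polynomial.natDegree_eq_of_degree_eq_some ?_
      rw [Polynomial.degree_sub_eq_left_of_degree_lt hlt, Polynomial.degree_X_pow]
    · rw [polyPairing_sub_left, polyPairing_sum_left]
      simp_rw [polyPairing_C_mul_left]
      rw [Finset.sum_eq_single (⟨k, hk⟩ : Fin n)]
      · rw [div_mul_cancel₀ _ (polyPairing_self_pos (ih k hk).1.ne_zero).ne', sub_self]
      · intro l _ hl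
        rcases lt_or_gt_of_ne (fun h => hl (Fin.ext h) : (l : ℕ) ≠ k) with h | h
        · rw [polyPairing_comm (monicOrthoPoly γ l) (monicOrthoPoly γ k), (ih k hk).2.2 l h, mul_zero]
        · rw [(ih l l.2).2.2 k h, mul_zero]
      · simp

variable (γ) in
/-- The orthogonal polynomials with complex coefficients. -/
def orthoPolyC (n : ℕ) : Polynomial ℂ := (orthoPoly γ n).map Complex.ofRealHom

lemma orthoPoly_const_pos (n : ℕ) : 0 < Real.sqrt (2 * Real.pi) /
    Real.sqrt (polyPairing γ (monicOrthoPoly γ n) (monicOrthoPoly γ n)) :=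
  div_pos (Real.sqrt_pos.2 (by positivity))
    (Real.sqrt_pos.2 (polyPairing_self_pos (monicOrthoPoly_spec n).1.ne_zero))

lemma orthoPolyC_coeff_ne_zero (n : ℕ) : (orthoPolyC γ n).coeff n ≠ 0 := by
  obtain ⟨h1, h2, -⟩ := monicOrthoPoly_spec (γ := γ) n
  have h3 := h1.coeff_natDegree
  rw [h2] at h3
  rw [orthoPolyC, Polynomial.coeff_map, orthoPoly, Polynomial.coeff_C_mul, h3, mul_one]
  exact Complex.ofReal_ne_zero.2 (orthoPoly_const_pos n).ne'

lemma natDegree_orthoPolyC (n : ℕ) : (orthoPolyC γ n).natDegree = n := by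
  rw [orthoPolyC, Polynomial.natDegree_map_eq_of_injective Complex.ofReal_injective, orthoPoly,
    Polynomial.natDegree_C_mul (orthoPoly_const_pos n).ne', (monicOrthoPoly_spec n).2.1]

lemma orthoPolyC_eval (n : ℕ) (x : ℝ) :
    (orthoPolyC γ n).eval (x : ℂ) = (((orthoPoly γ n).eval x : ℝ) : ℂ) := by
  rw [orthoPolyC]
  exact Polynomial.eval_map_apply Complex.ofRealHom x

lemma polyPairing_orthoPoly {m n : ℕ} (h : m ≠ n) :
    polyPairing γ (orthoPoly γ m) (orthoPoly γ n) = 0 := by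
  have h0 : polyPairing γ (monicOrthoPoly γ m) (monicOrthoPoly γ n) = 0 := by
    rcases lt_or_gt_of_ne h with h | h
    · rw [polyPairing_comm, (monicOrthoPoly_spec n).2.2 m h]
    · exact (monicOrthoPoly_spec m).2.2 n h
  rw [orthoPoly, orthoPoly, polyPairing_C_mul_left, polyPairing_comm (monicOrthoPoly γ m)
    (Polynomial.C _ * _), polyPairing_C_mul_left, polyPairing_comm (monicOrthoPoly γ n) (monicOrthoPoly γ m), h0, mul_zero, mul_zero]

lemma inner_fanLp_orthoPolyC (j j' : ℤ) {m n : ℕ} (h : m ≠ n) :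
    inner ℂ (fanLp γ j (orthoPolyC γ m)) (fanLp γ j' (orthoPolyC γ n)) = 0 := by
  rw [inner_fanLp_fanLp]
  have e : ∫ x, (starRingEnd ℂ) ((orthoPolyC γ m).eval (x : ℂ)) * (orthoPolyC γ n).eval (x : ℂ)
      ∂jacobiMeasure (γ + 1 / 2) = ((polyPairing γ (orthoPoly γ m) (orthoPoly γ n) : ℝ) : ℂ) := by
    rw [polyPairing_eq_integral, ← integral_complex_ofReal]
    congr 1
    funext x
    rw [orthoPolyC_eval, orthoPolyC_eval, Complex.conj_ofReal, Complex.ofReal_mul]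
  rw [e, polyPairing_orthoPoly h, Complex.ofReal_zero, mul_zero]

lemma exists_eq_add_orthoPolyC {n : ℕ} {q : Polynomial ℂ} (hq : q.degree < (n + 1 : ℕ)) :
    ∃ (c : ℂ) (r : Polynomial ℂ), q = r + c • orthoPolyC γ n ∧ r.degree < n := by
  refine ⟨q.coeff n / (orthoPolyC γ n).coeff n, q - (q.coeff n / (orthoPolyC γ n).coeff n) •
    orthoPolyC γ n, by ring, ?_⟩
  rw [Polynomial.degree_lt_iff_coeff_zero] at hq ⊢
  intro m hm
  rw [Polynomial.coeff_sub, Polynomial.coeff_smul, smul_eq_mul]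
  rcases hm.eq_or_lt with rfl | hm
  · rw [div_mul_cancel₀ _ (orthoPolyC_coeff_ne_zero _), sub_self]
  · have h0 : (orthoPolyC γ n).coeff m = 0 :=
      Polynomial.coeff_eq_zero_of_natDegree_lt (by rwa [natDegree_orthoPolyC])
    rw [hq m hm, h0, mul_zero, sub_zero]

lemma mem_span_orthoPolyC {n : ℕ} {q : Polynomial ℂ} (hq : q.degree < n) :
    q ∈ Submodule.span ℂ (orthoPolyC γ '' Set.Iio n) := by
  induction n generalizing q with
  | zero =>
    have : q = 0 := by
      rw [← Polynomial.degree_eq_bot]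
      exact Nat.WithBot.lt_zero_iff.1 hq
    rw [this]
    exact Submodule.zero_mem _
  | succ n ih =>
    obtain ⟨c, r, rfl, hr⟩ := exists_eq_add_orthoPolyC (γ := γ) hq
    refine Submodule.add_mem _ (Submodule.span_mono (Set.image_mono ?_) (ih hr))
      (Submodule.smul_mem _ _ (Submodule.subset_span ⟨n, Nat.lt_succ_self n, rfl⟩))
    exact Set.Iio_subset_Iio (Nat.le_succ n)

lemma inner_fanLp_orthoPolyC_of_degree_lt (j j' : ℤ) {n : ℕ} {q : Polynomial ℂ}
    (hq : q.degree < n) : inner ℂ (fanLp γ j (orthoPolyC γ n)) (fanLp γ j' q) = 0 := by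
  have h : Submodule.span ℂ (orthoPolyC γ '' Set.Iio n) ≤
      (ℂ ∙ fanLp γ j (orthoPolyC γ n))ᗮ.comap (fanLp γ j') := by
    refine Submodule.span_le.2 ?_
    rintro _ ⟨m, hm, rfl⟩
    exact Submodule.mem_orthogonal_singleton_iff_inner_right.2
      (inner_fanLp_orthoPolyC j j' (ne_of_gt hm))
  exact Submodule.mem_orthogonal_singleton_iff_inner_right.1 (h (mem_span_orthoPolyC hq))

/-! ### The singular functions -/

variable (γ) in
/-- The back-projection of the orthogonal polynomial of degree `n` in mode `j`. -/
def zernike (n : ℕ) (j : ℤ) : DiskSpace γ := polyLp γ (backProjPoly (orthoPolyC γ n) j)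

lemma inner_zernike (n : ℕ) (j : ℤ) (u : DiskSpace γ) :
    inner ℂ (zernike γ n j) u = inner ℂ (fanLp γ j (orthoPolyC γ n)) (xrayL γ u) :=
  (inner_fanLp_xrayL _ _ _).symm

lemma backProjPoly_orthoPolyC_mem (n : ℕ) (j : ℤ) :
    backProjPoly (orthoPolyC γ n) j ∈ modePoly j n := by
  simpa only [natDegree_orthoPolyC] using backProjPoly_mem (orthoPolyC γ n) j

/-- T(z^a z̄^b) is a data function whose polynomial in sin α has degree less than n, hence is
orthogonal to the n-th orthogonal polynomial. -/
lemma inner_zernike_zMono {n a b : ℕ} (h : a + b < n) (j : ℤ) :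
    inner ℂ (zernike γ n j) (polyLp γ (zMono a b)) = 0 := by
  obtain ⟨q, hq, e⟩ := exists_xrayL_zMono (γ := γ) a b
  rw [inner_zernike, e]
  refine inner_fanLp_orthoPolyC_of_degree_lt _ _ (Polynomial.degree_le_natDegree.trans_lt ?_)
  exact_mod_cast hq.trans_lt h

lemma inner_zernike_modePoly {n N : ℕ} {i j : ℤ} {P : MvPolynomial (Fin 2) ℂ}
    (hP : P ∈ modePoly i N) (h : ∀ a b : ℕ, (a : ℤ) - b = i → a + b ≤ N → a + b < n) :
    inner ℂ (zernike γ n j) (polyLp γ P) = 0 := by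
  have hle : modePoly i N ≤ (ℂ ∙ zernike γ n j)ᗮ.comap (polyLp γ) := by
    refine Submodule.span_le.2 ?_
    rintro _ ⟨a, b, h1, h2, rfl⟩
    exact Submodule.mem_orthogonal_singleton_iff_inner_right.2 (inner_zernike_zMono (h a b h1 h2) j)
  exact Submodule.mem_orthogonal_singleton_iff_inner_right.1 (hle hP)

/-- The back-projections vanish outside of the range `j = n - 2k`, `0 ≤ k ≤ n`. -/
lemma zernike_eq_zero {n : ℕ} {j : ℤ} (h : ∀ k : ℕ, k ≤ n → j ≠ n - 2 * k) : zernike γ n j = 0 := by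
  refine inner_self_eq_zero (𝕜 := ℂ).1 ?_
  -- A monomial of full degree a + b = n would give j = n - 2b, which is excluded; so only degrees
  -- below n occur and the function is orthogonal to itself.
  refine inner_zernike_modePoly (backProjPoly_orthoPolyC_mem n j) fun a b h1 h2 => ?_
  by_contra h3
  exact h b (by omega) (by omega)

lemma eqOn_zero_of_polyLp_eq_zero {P : MvPolynomial (Fin 2) ℂ} (h : polyLp γ P = 0) :
    Set.EqOn (evalConj P) 0 (Metric.ball 0 1) := by
  have h1 : evalConj P =ᵐ[diskMeasure γ] fun _ => 0 := by
    have h2 := polyLp_ae_eq (γ := γ) P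
    rw [h] at h2
    exact h2.symm.trans (Lp.coeFn_zero ℂ 2 _)
  have hac : volume.restrict (Metric.ball (0 : ℂ) 1) ≪ diskMeasure γ := by
    rw [diskMeasure_eq_ball]
    refine withDensity_absolutelyContinuous' (by fun_prop) ?_
    filter_upwards [ae_ball_pos] with z hz
    simpa using Real.rpow_pos_of_pos hz _
  exact Measure.eqOn_open_of_ae_eq (hac.ae_le h1) Metric.isOpen_ball
    (continuous_evalConj P).continuousOn continuousOn_const

lemma evalConj_backProjMono_real (m : ℕ) (j : ℤ) (r : ℝ) :
    evalConj (backProjMono m j) r = evalConj (backProjMono m j) 1 * (r : ℂ) ^ m := by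
  rw [backProjMono, evalConj_sum, evalConj_sum, Finset.sum_mul]
  refine Finset.sum_congr rfl fun i hi => ?_
  split_ifs
  · rw [evalConj_smul, evalConj_smul, evalConj_zMono, evalConj_zMono, Complex.conj_ofReal, ← pow_add,
      Nat.add_sub_cancel' (Nat.le_of_lt_succ (Finset.mem_range.1 hi))]
    simp
  · simp

lemma evalConj_backProjMono_one {n k : ℕ} (hk : k ≤ n) :
    evalConj (backProjMono n (n - 2 * k)) 1 ≠ 0 := by
  rw [backProjMono, evalConj_sum, Finset.sum_eq_single (n - k)]
  · rw [if_pos (by push_cast [hk]; ring), evalConj_smul, evalConj_zMono]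
    have h1 : ((n.choose (n - k) : ℕ) : ℂ) ≠ 0 := by
      exact_mod_cast (Nat.choose_pos (Nat.sub_le n k)).ne'
    have h2 : (Real.pi : ℂ) ≠ 0 := by exact_mod_cast Real.pi_ne_zero
    simp [h1, h2]
  · intro i _ hi
    rw [if_neg (by omega), evalConj_zero]
  · intro h
    exact absurd (Finset.mem_range.2 (by omega)) h

/-- On the real axis the back-projection is a polynomial in r whose coefficient of r^n is the
leading coefficient of the orthogonal polynomial times a nonzero multiple of a binomial coefficient.
-/
lemma zernike_ne_zero {n k : ℕ} (hk : k ≤ n) : zernike γ n (n - 2 * k) ≠ 0 := by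
  intro h
  have h1 := eqOn_zero_of_polyLp_eq_zero h
  set R : Polynomial ℂ := ∑ m ∈ Finset.range (n + 1), Polynomial.C ((orthoPolyC γ n).coeff m *
    evalConj (backProjMono m (n - 2 * k)) 1) * Polynomial.X ^ m with hR
  have h2 : ∀ r : ℝ, R.eval (r : ℂ) =
      evalConj (backProjPoly (orthoPolyC γ n) (n - 2 * k)) (r : ℂ) := fun r => by
    rw [hR, Polynomial.eval_finsetSum, backProjPoly, natDegree_orthoPolyC, evalConj_sum]
    refine Finset.sum_congr rfl fun m _ => ?_
    rw [evalConj_smul, evalConj_backProjMono_real]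
    simp
    ring
  have h3 : R = 0 := by
    refine Polynomial.eq_zero_of_infinite_isRoot R (Set.Infinite.mono ?_
      ((Set.Ioo_infinite (zero_lt_one (α := ℝ))).image Complex.ofReal_injective.injOn))
    rintro _ ⟨r, hr, rfl⟩
    change R.eval (r : ℂ) = 0
    rw [h2]
    refine h1 ?_
    rw [mem_ball_zero_iff, Complex.norm_real, Real.norm_eq_abs, abs_of_pos hr.1]
    exact hr.2
  have h4 := congrArg (fun p => Polynomial.coeff p n) h3
  simp only [hR, Polynomial.finsetSum_coeff, Polynomial.coeff_C_mul, Polynomial.coeff_X_pow,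
    Polynomial.coeff_zero] at h4
  rw [Finset.sum_eq_single n (fun m _ hm => by rw [if_neg (Ne.symm hm), mul_zero])
    (fun h => absurd (Finset.self_mem_range_succ n) h), if_pos rfl, mul_one] at h4
  exact mul_ne_zero (orthoPolyC_coeff_ne_zero n) (evalConj_backProjMono_one hk) h4

lemma exists_xrayL_modePoly {j : ℤ} {N : ℕ} {P : MvPolynomial (Fin 2) ℂ} (hP : P ∈ modePoly j N) :
    ∃ q : Polynomial ℂ, q.degree < (N + 1 : ℕ) ∧ xrayL γ (polyLp γ P) = fanLp γ j q := by
  induction hP using Submodule.span_induction with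
  | mem P hP =>
    obtain ⟨a, b, rfl, h, rfl⟩ := hP
    obtain ⟨q, hq, e⟩ := exists_xrayL_zMono (γ := γ) a b
    refine ⟨q, Polynomial.degree_le_natDegree.trans_lt ?_, e⟩
    exact_mod_cast (hq.trans h).trans_lt (Nat.lt_succ_self N)
  | zero => exact ⟨0, by simp, by simp⟩
  | add P Q _ _ hP hQ =>
    obtain ⟨q, hq, e⟩ := hP
    obtain ⟨q', hq', e'⟩ := hQ
    exact ⟨q + q', (Polynomial.degree_add_le _ _).trans_lt (max_lt hq hq'),
      by rw [map_add, map_add, map_add, e, e']⟩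
  | smul c P _ hP =>
    obtain ⟨q, hq, e⟩ := hP
    exact ⟨c • q, (Polynomial.degree_smul_le _ _).trans_lt hq, by
      rw [map_smul, map_smul, map_smul, e]⟩

/-- T Z is a data function with polynomial r + c L, L the n-th orthogonal polynomial and deg r < n.
The part r is orthogonal to T Z, because its back-projection has degree less than n and so is
orthogonal to Z; it is also orthogonal to L. Thus it is orthogonal to itself. -/
lemma exists_xrayL_zernike (n : ℕ) (j : ℤ) :
    ∃ c : ℂ, xrayL γ (zernike γ n j) = c • fanLp γ j (orthoPolyC γ n) := by
  obtain ⟨q, hq, e⟩ := exists_xrayL_modePoly (γ := γ) (backProjPoly_orthoPolyC_mem (γ := γ) n j)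
  obtain ⟨c, r, rfl, hr⟩ := exists_eq_add_orthoPolyC (γ := γ) hq
  refine ⟨c, ?_⟩
  have h1 : inner ℂ (fanLp γ j r) (fanLp γ j (orthoPolyC γ n)) = 0 := by
    rw [← inner_conj_symm, inner_fanLp_orthoPolyC_of_degree_lt (γ := γ) j j hr, map_zero]
  have h2 : inner ℂ (fanLp γ j r) (xrayL γ (zernike γ n j)) = 0 := by
    rw [inner_fanLp_xrayL, ← inner_conj_symm]
    rcases eq_or_ne r 0 with rfl | hr0
    · have : backProjPoly 0 j = 0 := by simp [backProjPoly]
      rw [this, map_zero, inner_zero_right, map_zero]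
    · have hr' : r.natDegree < n := (Polynomial.natDegree_lt_iff_degree_lt hr0).2 hr
      rw [inner_zernike_modePoly (γ := γ) (backProjPoly_mem r j) fun a b _ h => h.trans_lt hr', map_zero]
  have h3 : fanLp γ j r = 0 := by
    refine inner_self_eq_zero (𝕜 := ℂ).1 ?_
    rw [zernike, e, map_add, inner_add_right, map_smul, inner_smul_right, h1, mul_zero, add_zero] at h2
    exact h2
  rw [zernike, e, map_add, h3, zero_add, map_smul]

lemma exists_fanLp_eq {n k : ℕ} (hk : k ≤ n) : ∃ c : ℂ,
    fanLp γ (n - 2 * k) (orthoPolyC γ n) = c • xrayL γ (zernike γ n (n - 2 * k)) := by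
  obtain ⟨c, hc⟩ := exists_xrayL_zernike (γ := γ) n (n - 2 * k)
  refine ⟨c⁻¹, ?_⟩
  rw [hc, smul_smul, inv_mul_cancel₀, one_smul]
  -- If c were 0, adjointness would give ‖Z‖² = 0, contrary to `zernike_ne_zero`.
  rintro rfl
  refine zernike_ne_zero (γ := γ) hk (inner_self_eq_zero (𝕜 := ℂ).1 ?_)
  rw [inner_zernike, hc, zero_smul, inner_zero_right]

/-- The powers z^m with m < n are excluded by degree, those with m ≥ n by angular momentum, since n
- 2k < n. -/
lemma zernike_mem_bergman_orthogonal {n k : ℕ} (hk : 1 ≤ k) :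
    zernike γ n (n - 2 * k) ∈ (bergman γ)ᗮ := by
  rw [mem_bergman_orthogonal_iff]
  intro m
  rw [← inner_conj_symm]
  rcases Nat.lt_or_ge m n with h | h
  · rw [inner_zernike_zMono (by omega), map_zero]
  · rw [zernike, inner_polyLp_eq_zero (j' := m) (N' := m) (by omega)
      (backProjPoly_orthoPolyC_mem n _), map_zero]
    rw [modePoly_eq_span]
    exact Submodule.mem_span_singleton_self _

lemma zernike_mem_bergman (n : ℕ) : zernike γ n n ∈ bergman γ := by
  have h := backProjPoly_orthoPolyC_mem (γ := γ) n n
  rw [modePoly_eq_span] at h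
  obtain ⟨c, hc⟩ := Submodule.mem_span_singleton.1 h
  rw [zernike, ← hc, map_smul]
  exact Submodule.smul_mem _ _ (zMono_mem_bergman n)

lemma psiMinus_eq (n : ℕ) (k : ℤ) : psiMinus γ n k =ᵐ[dataMeasure γ]
    ((1 / (2 * Real.pi) : ℂ) • fanLp γ (n - 2 * k + 1) (orthoPolyC γ n) : DataSpace γ) := by
  filter_upwards [Lp.coeFn_smul (1 / (2 * Real.pi) : ℂ) (fanLp γ (n - 2 * k + 1) (orthoPolyC γ n)),
    fanLp_ae_eq (γ := γ) (n - 2 * k + 1) (orthoPolyC γ n)] with p h1 h2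
  have e : direction p ^ (n - 2 * k + 1 : ℤ) =
      Complex.exp (((p.1 + p.2 + Real.pi : ℝ) : ℂ) * Complex.I) *
        Complex.exp ((((n : ℝ) - 2 * (k : ℝ)) * (p.1 + p.2 + Real.pi) : ℝ) * Complex.I) := by
    rw [direction, ← Complex.exp_int_mul, ← Complex.exp_add]
    congr 1
    push_cast
    ring
  rw [h1, Pi.smul_apply, h2, fanMode, orthoPolyC_eval, e, psiMinus, psi, smul_eq_mul]
  ring

variable [Fact (-1 < -γ)]

lemma span_psiMinusFamily_le : Submodule.span ℂ (psiMinusFamily γ) ≤ starSpace γ := by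
  refine Submodule.span_le.2 ?_
  rintro u ⟨n, k, -, hk, hkn, hu⟩
  lift k to ℕ using by omega
  rw [Lp.ext (hu.trans (psiMinus_eq n k)), add_comm, ← modul_fanLp]
  obtain ⟨c, hc⟩ := exists_fanLp_eq (γ := γ) (n := n) (k := k) (by omega)
  rw [hc, map_smul]
  exact Submodule.smul_mem _ _ (Submodule.smul_mem _ _
    ⟨_, zernike_mem_bergman_orthogonal (by omega), rfl⟩)

/-- T f is orthogonal to every data function v^j q(sin α), hence to the transform of every
polynomial, hence by density to itself. -/
lemma xrayL_eq_zero {f : DiskSpace γ} (h : ∀ n j, inner ℂ (zernike γ n j) f = 0) :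
    xrayL γ f = 0 := by
  have h1 : ∀ (j : ℤ) (q : Polynomial ℂ), inner ℂ (fanLp γ j q) (xrayL γ f) = 0 := fun j q => by
    have hle : Submodule.span ℂ (orthoPolyC γ '' Set.Iio (q.natDegree + 1)) ≤
        (ℂ ∙ xrayL γ f)ᗮ.comap (fanLp γ j) := by
      refine Submodule.span_le.2 ?_
      rintro _ ⟨m, -, rfl⟩
      exact Submodule.mem_orthogonal_singleton_iff_inner_left.2
        ((inner_zernike m j f).symm.trans (h m j))
    refine Submodule.mem_orthogonal_singleton_iff_inner_left.1
      (hle (mem_span_orthoPolyC (Polynomial.degree_le_natDegree.trans_lt ?_)))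
    exact_mod_cast Nat.lt_succ_self _
  have h2 : ∀ P, inner ℂ (xrayL γ (polyLp γ P)) (xrayL γ f) = 0 := fun P => by
    have hP : P ∈ Submodule.span ℂ (Set.range fun ab : ℕ × ℕ => zMono ab.1 ab.2) := by
      rw [span_zMono]; trivial
    have hle : Submodule.span ℂ (Set.range fun ab : ℕ × ℕ => zMono ab.1 ab.2) ≤
        (ℂ ∙ xrayL γ f)ᗮ.comap ((xrayL γ).toLinearMap.comp (polyLp γ)) := by
      refine Submodule.span_le.2 ?_
      rintro _ ⟨⟨a, b⟩, rfl⟩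
      obtain ⟨q, -, e⟩ := exists_xrayL_zMono (γ := γ) a b
      refine Submodule.mem_orthogonal_singleton_iff_inner_left.2 ?_
      change inner ℂ (xrayL γ (polyLp γ (zMono a b))) _ = 0
      rw [e, h1]
    exact Submodule.mem_orthogonal_singleton_iff_inner_left.1 (hle hP)
  refine inner_self_eq_zero (𝕜 := ℂ).1 ?_
  refine inner_eq_zero_of_mem_closure (S := LinearMap.range (polyLp γ)) (xrayL γ) _ ?_ ?_
  · rintro _ ⟨P, rfl⟩
    exact h2 P
  · rw [Submodule.span_eq, dense_polyLp]
    trivial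

/-- Split f along the closed span of the Zernike functions with k ≥ 1. The remainder is orthogonal
to these, to those with k = 0 because it stays in Aᗮ, and trivially to the others, which vanish; so
T kills it. -/
lemma starSpace_le : starSpace γ ≤ (Submodule.span ℂ (psiMinusFamily γ)).topologicalClosure := by
  rintro _ ⟨f, hf, rfl⟩
  set S : Submodule ℂ (DiskSpace γ) := (Submodule.span ℂ {u | ∃ n k : ℕ, 1 ≤ k ∧ k ≤ n ∧
    u = zernike γ n (n - 2 * k)}).topologicalClosure with hS
  have hcS : CompleteSpace S := (Submodule.isClosed_topologicalClosure _).completeSpace_coe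
  obtain ⟨s, hs, f', hf', rfl⟩ := S.exists_add_mem_mem_orthogonal f
  have hSB : S ≤ (bergman γ)ᗮ := by
    refine Submodule.topologicalClosure_minimal _ (Submodule.span_le.2 ?_)
      (Submodule.isClosed_orthogonal _)
    rintro _ ⟨n, k, hk, -, rfl⟩
    exact zernike_mem_bergman_orthogonal hk
  have hf'B : f' ∈ (bergman γ)ᗮ := by
    have := Submodule.sub_mem _ hf (hSB hs)
    rwa [add_sub_cancel_left] at this
  have h0 : xrayL γ f' = 0 := by
    refine xrayL_eq_zero fun n j => ?_
    by_cases hj : ∃ k : ℕ, k ≤ n ∧ j = n - 2 * k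
    · obtain ⟨k, hk, rfl⟩ := hj
      rcases Nat.eq_zero_or_pos k with rfl | hk0
      · refine hf'B _ ?_
        have := zernike_mem_bergman (γ := γ) n
        simpa using this
      · exact hf' _ (Submodule.le_topologicalClosure _ (Submodule.subset_span ⟨n, k, hk0, hk, rfl⟩))
    · rw [zernike_eq_zero fun k hk h => hj ⟨k, hk, h⟩, inner_zero_left]
  have hle : S ≤ ((Submodule.span ℂ (psiMinusFamily γ)).topologicalClosure).comap
      (xrayMod γ 1).toLinearMap := by
    refine Submodule.topologicalClosure_minimal _ (Submodule.span_le.2 ?_)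
      ((Submodule.isClosed_topologicalClosure _).preimage (xrayMod γ 1).continuous)
    rintro _ ⟨n, k, hk, hkn, rfl⟩
    obtain ⟨c, hc⟩ := exists_xrayL_zernike (γ := γ) n (n - 2 * k)
    change xrayMod γ 1 (zernike γ n (n - 2 * k)) ∈
      (Submodule.span ℂ (psiMinusFamily γ)).topologicalClosure
    rw [xrayMod_apply, hc, map_smul, modul_fanLp]
    refine Submodule.smul_mem _ _ (Submodule.le_topologicalClosure _ ?_)
    have hpi : (2 * Real.pi : ℂ) ≠ 0 := by
      exact_mod_cast (by positivity : (2 * Real.pi : ℝ) ≠ 0)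
    have e : fanLp γ (1 + (n - 2 * k)) (orthoPolyC γ n) = (2 * Real.pi : ℂ) •
        ((1 / (2 * Real.pi) : ℂ) • fanLp γ (n - 2 * (k : ℤ) + 1) (orthoPolyC γ n)) := by
      rw [smul_smul, mul_one_div_cancel hpi, one_smul, add_comm]
    rw [e]
    refine Submodule.smul_mem _ _ (Submodule.subset_span ⟨n, k, by omega, by omega, by omega, ?_⟩)
    exact (psiMinus_eq n k).symm
  have e : xrayMod γ 1 (s + f') = xrayMod γ 1 s := by
    rw [map_add, xrayMod_apply 1 f', h0, map_zero, add_zero]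
  change xrayMod γ 1 (s + f') ∈ (Submodule.span ℂ (psiMinusFamily γ)).topologicalClosure
  rw [e]
  exact hle hs

lemma closure_rangeStarD : closure (rangeStarD γ) =
    ((Submodule.span ℂ (psiMinusFamily γ)).topologicalClosure : Set (DataSpace γ)) := by
  rw [rangeStarD_eq]
  refine le_antisymm (closure_minimal starSpace_le (Submodule.isClosed_topologicalClosure _)) ?_
  rw [Submodule.topologicalClosure_coe]
  exact closure_mono span_psiMinusFamily_le

end OrthogonalPolynomials

end DiskXRay
end

theorem theorem2p5 (γ : ℝ) (hγ : -1 < γ) (hγ' : γ < 1) :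
    -- the transforms are well defined
    (∀ (m : ℕ) (f : ℂ → Tensor m), IsL2SymTensorField γ m f →
      (∀ᵐ p ∂(dataMeasure γ),
        IntervalIntegrable (rayIntegrand γ (ell f) p) volume 0 (2 * Real.cos p.2)) ∧
      MemLp (xray γ (ell f)) 2 (dataMeasure γ)) ∧
    (∀ h hx hy : ℂ → ℂ, IsH01 (-γ) h hx hy →
      (∀ᵐ p ∂(dataMeasure γ),
        IntervalIntegrable (rayIntegrand 0 (ell (starD hx hy)) p) volume 0
          (2 * Real.cos p.2)) ∧
      MemLp (xray 0 (ell (starD hx hy))) 2 (dataMeasure γ)) ∧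
    -- even order
    (∀ p : ℕ, 1 ≤ p →
      IsOrthogonalSum (rangeSym γ (2 * p)) (rangeFun γ)
        (fun j : Fin p => rangeTT γ (2 * ((j : ℕ) + 1)))) ∧
    -- odd order
    (∀ p : ℕ,
      IsOrthogonalSum (rangeSym γ (2 * p + 1)) (rangeStarD γ)
        (fun j : Fin (p + 1) => rangeTT γ (2 * (j : ℕ) + 1))) ∧
    -- the closure of the first summand in odd order
    closure (rangeStarD γ) =
      ((Submodule.span ℂ (psiMinusFamily γ)).topologicalClosure : Set (DataSpace γ)) := by
  have : Fact (-1 < γ) := ⟨hγ⟩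
  have : Fact (-1 < -γ) := ⟨by linarith⟩
  refine ⟨fun m f hf => ?_, fun h hx hy hh => memLp_xray_starD hh,
    fun p _ => isOrthogonalSum_even p, isOrthogonalSum_odd, closure_rangeStarD⟩
  obtain ⟨h1, w, -, h2⟩ := xray_sym hf
  exact ⟨h1, (memLp_congr_ae h2).2 (Lp.memLp w)⟩
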